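/- All graphs are undirected, may have parallel edges, and are finite; all input numbers are nonnegative integers written in binary. Let $G=(V,E)$ be a graph with node capacities $q_u\ge 1$ ($u\in V$). For distinct $u,v\in V$ the $q$-connectivity $\lambda^q_G(u,v)$ is the maximum value of an integral $uv$-flow in $G$ when every edge has capacity $1$ and every node $w\ne u,v$ has capacity $q_w$. In $a$-Based SNA (Survivable Network Augmentation) we are given $G$, $q$, a node $a$, a list $F$ of additional edges (parallel edges allowed), each joining $a$ to some node other than $a$, a set $D$ of demand edges $uv$ ($u\ne v$) with requirements $r_{uv}$, and costs either of the edges in $F$ or of the nodes in $V$; the goal is to find a minimum cost $I\subseteq F$ such that $\lambda^q_{G+I}(u,v)\ge r_{uv}$ for all $uv\in D$. For edge-costs the cost of $I$ is the sum of the costs of its edges, for node-costs it is the sum of the costs of all the nodes that are endnodes of edges of $I$. Let $k$ be the maximum requirement and $p_{\max}$ the maximum number of parallel edges in $F$. In $s$-Based Rooted SNA both $F$ and $D$ are stars with the same center $s=a$. In SSL (Survivable Source Location) we are given $G$, demands $d_v$ with maximum $k$, node capacities $q_v$ and flow supplies $p_v$ with $1\le q_v\le p_v\le k$, and node costs; the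 goal is to find a minimum cost $S\subseteq V$ such that for every $v\in V$ we have $\lambda^{q}_{G_S}(s,v)\ge d_v$, where $G_S$ is obtained from $G$ by adding a new node $s$ and joining it to each $u\in S$ by $p_u$ parallel edges; here $p_{\max}=\max_v p_v$. A problem admits approximation ratio $\rho$ if there is a polynomial time algorithm that on every instance that has a feasible solution outputs a feasible solution of cost at most $\rho$ times the minimum cost, where $\rho$ may depend on the parameters $k,p_{\max}$ of the instance. Let $H(j)=\sum_{i=1}^j 1/i$ and $\Delta_\ell=(4\ell-3)^2$. Theorem 4. (i) Undirected $a$-Based SNA with edge-costs admits approximation ratio $$\sum_{\ell=1}^k \frac{H(\Delta_\ell)}{k-\ell+1}\ \le\ H(k)\cdot H(\Delta_k)=O(\ln^2 k),$$ and undirected $s$-Based Rooted SNA with edge-costs admits approximation ratio $$\sum_{\ell=1}^k \frac{H(2\ell-1)}{k-\ell+1}\ \le\ H(k)\cdot H(2k-1)=O(\ln^2 k).$$ (ii) Undirected $a$-Based SNA with node-costs admits approximation ratio $$\sum_{\ell=1}^k H(\Delta_\ell)\min\Big\{\frac{p_{\max}}{k-\ell+1},1\Big\}\ \le\ \min\{k,\,p_{\max}H(k)\}\cdot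 H(\Delta_k),$$ and undirected $s$-Based Rooted SNA with node-costs, as well as undirected SSL, admits approximation ratio $$\sum_{\ell=1}^k H(2\ell-1)\min\Big\{\frac{p_{\max}}{k-\ell+1},1\Big\}\ \le\ \min\{k,\,p_{\max}H(k)\}\cdot H(2k-1).$$ (For $k=0$ the products on the right-hand sides are read as $0$.) -/

import Mathlib

open Filter Asymptotics

/-! ### Machine model: a while-language over binary trees with natural numbers at the leaves,
every elementary operation being charged the bit size of its argument and of its result. -/

/-- Data values: binary trees whose leaves are natural numbers. -/
inductive Val : Type
  | num : ℕ → Val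
  | pair : Val → Val → Val
  deriving DecidableEq

namespace Val

/-- Bit size of a value; numbers are measured by the length of their binary expansion. -/
def size : Val → ℕ
  | num n => Nat.size n + 1
  | pair v w => size v + size w + 1

/-- Lists of values: the empty list is the leaf `0`, a nonempty list is (head, tail). -/
def ofList : List Val → Val
  | [] => num 0
  | v :: l => pair v (ofList l)

/-- The list of the numbers of a list. -/
def ofNats (l : List ℕ) : Val := ofList (l.map num)

end Val

/-- The elementary operations. -/
inductive Prim : Type
  | ident
  | const (n : ℕ)
  | fst
  | snd
  | isPair
  | eq
  | le
  | add
  | sub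
  | mul
  | div

/-- Effect of an elementary operation; binary operations act on a pair, and an operation that is
applied to an argument of the wrong shape returns `0`. -/
def Prim.apply : Prim → Val → Val
  | .ident, v => v
  | .const n, _ => .num n
  | .fst, .pair v _ => v
  | .snd, .pair _ w => w
  | .isPair, .pair _ _ => .num 1
  | .eq, .pair v w => if v = w then .num 1 else .num 0
  | .le, .pair (.num m) (.num n) => if m ≤ n then .num 1 else .num 0
  | .add, .pair (.num m) (.num n) => .num (m + n)
  | .sub, .pair (.num m) (.num n) => .num (m - n)
  | .mul, .pair (.num m) (.num n) => .num (m * n)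
  | .div, .pair (.num m) (.num n) => .num (m / n)
  | _, _ => .num 0

/-- Programs: elementary operations, sequential composition (`comp f g` runs `g` first),
pairing of two results, branching, and unbounded while-loops. -/
inductive Code : Type
  | prim (p : Prim)
  | comp (f g : Code)
  | pair (f g : Code)
  | cond (b f g : Code)
  | loop (b f : Code)

/-- `Code.Runs f v w t`: on input `v` the program `f` halts with output `w` after time `t`.
In tests the value `num 0` means false and every other value means true. The time is always at
least the size of every value that occurs in the run, so polynomial time in this sense is
polynomial time on a Turing machine. -/
inductive Code.Runs : Code → Val → Val → ℕ → Prop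
  | prim (p : Prim) (v : Val) :
      Code.Runs (.prim p) v (p.apply v) (v.size + (p.apply v).size)
  | comp {f g : Code} {v w z : Val} {t₁ t₂ : ℕ} :
      Code.Runs g v w t₁ → Code.Runs f w z t₂ → Code.Runs (.comp f g) v z (t₁ + t₂ + 1)
  | pair {f g : Code} {v w z : Val} {t₁ t₂ : ℕ} :
      Code.Runs f v w t₁ → Code.Runs g v z t₂ →
      Code.Runs (.pair f g) v (.pair w z) (t₁ + t₂ + 1)
  | cond_true {b f g : Code} {v w z : Val} {t₁ t₂ : ℕ} :
      Code.Runs b v w t₁ → w ≠ .num 0 → Code.Runs f v z t₂ →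
      Code.Runs (.cond b f g) v z (t₁ + t₂ + 1)
  | cond_false {b f g : Code} {v z : Val} {t₁ t₂ : ℕ} :
      Code.Runs b v (.num 0) t₁ → Code.Runs g v z t₂ →
      Code.Runs (.cond b f g) v z (t₁ + t₂ + 1)
  | loop_stop {b f : Code} {v : Val} {t : ℕ} :
      Code.Runs b v (.num 0) t → Code.Runs (.loop b f) v v (t + 1)
  | loop_step {b f : Code} {v w v' z : Val} {t₁ t₂ t₃ : ℕ} :
      Code.Runs b v w t₁ → w ≠ .num 0 → Code.Runs f v v' t₂ → Code.Runs (.loop b f) v' z t₃ →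
      Code.Runs (.loop b f) v z (t₁ + t₂ + t₃ + 1)

/-! ### Minimization problems and approximation ratios -/

/-- A minimization problem. `Represents x v S` says that the data value `v` describes the candidate
solution `S` of the instance `x`. -/
structure MinProblem where
  Inst : Type
  encode : Inst → Val
  Sol : Inst → Type
  Represents : (x : Inst) → Val → Sol x → Prop
  Feasible : (x : Inst) → Sol x → Prop
  cost : (x : Inst) → Sol x → ℕ

/-- The problem admits approximation ratio `ρ`: one program halts on all instances in time
polynomial in the size of the encoded instance, and on every instance `x` that has a feasible
solution its output is a feasible solution of cost at most `ρ x` times that of every feasible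
solution. -/
def MinProblem.AdmitsRatio (P : MinProblem) (ρ : P.Inst → ℚ) : Prop :=
  ∃ (f : Code) (T : Polynomial ℕ), ∀ x : P.Inst, ∃ (v : Val) (t : ℕ),
    f.Runs (P.encode x) v t ∧ t ≤ T.eval (P.encode x).size ∧
    ((∃ S, P.Feasible x S) → ∃ S, P.Represents x v S ∧ P.Feasible x S ∧
      ∀ S', P.Feasible x S' → (P.cost x S : ℚ) ≤ ρ x * (P.cost x S' : ℚ))

/-- The value `v` is a listing, in any order, of the members of `S ⊆ {0, …, m-1}`. -/
def ListsFinset {m : ℕ} (v : Val) (S : Finset (Fin m)) : Prop :=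
  ∃ l : List (Fin m), l.toFinset = S ∧ v = Val.ofNats (l.map Fin.val)

/-- The problem `P` restricted to the instances that satisfy `p`. -/
def MinProblem.restrict (P : MinProblem) (p : P.Inst → Prop) : MinProblem where
  Inst := {x : P.Inst // p x}
  encode x := P.encode x.1
  Sol x := P.Sol x.1
  Represents x := P.Represents x.1
  Feasible x := P.Feasible x.1
  cost x := P.cost x.1

/-! ### Flows and connectivity in undirected multigraphs with node capacities

A multigraph on `V` is given by the pair of endnodes of each edge `e : ι`. In a flow `(f, g)`, `f e`
is the amount sent along `e` from its first to its second endnode, `g e` the amount sent along `e`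
in the opposite direction. -/

section Flow

variable {V ι : Type} [Fintype ι] [DecidableEq V]

def outflow (ends : ι → V × V) (f g : ι → ℕ) (u : V) : ℕ :=
  ∑ e, ((if (ends e).1 = u then f e else 0) + (if (ends e).2 = u then g e else 0))

def inflow (ends : ι → V × V) (f g : ι → ℕ) (u : V) : ℕ :=
  ∑ e, ((if (ends e).2 = u then f e else 0) + (if (ends e).1 = u then g e else 0))

/-- Integral `s`-`t`-flows in the undirected multigraph with edge capacities `1` and capacity `q u`
of every node `u` other than `s` and `t`. -/
structure IsFlow (ends : ι → V × V) (q : V → ℕ) (s t : V) (f g : ι → ℕ) : Prop where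
  edge_cap : ∀ e, f e + g e ≤ 1
  conserve : ∀ u, u ≠ s → u ≠ t → inflow ends f g u = outflow ends f g u
  node_cap : ∀ u, u ≠ s → u ≠ t → inflow ends f g u ≤ q u

/-- The `q`-connectivity from `s` to `t`: the maximum value of an `s`-`t`-flow. -/
noncomputable def qConnectivity (ends : ι → V × V) (q : V → ℕ) (s t : V) : ℕ :=
  sSup {m : ℕ | ∃ f g : ι → ℕ, IsFlow ends q s t f g ∧ outflow ends f g s = inflow ends f g s + m}

end Flow

/-! ### Star-based survivable network augmentation -/

/-- Undirected instances, without the costs: a multigraph `E` on the nodes `0, …, n-1`, node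
capacities `q`, a multiset `F` of further edges forming a star with center `a` (edge `i` of `F` joins
`a` to its `i`-th entry), and demand edges `(u, v, r)` with requirement `r`. -/
structure StarSNA where
  n : ℕ
  E : List (Fin n × Fin n)
  q : Fin n → ℕ
  a : Fin n
  F : List (Fin n)
  D : List (Fin n × Fin n × ℕ)
  one_le_q : ∀ u, 1 ≤ q u
  F_ne : ∀ v ∈ F, v ≠ a
  D_ne : ∀ d ∈ D, d.1 ≠ d.2.1

namespace StarSNA

/-- The edges of `G + I`, for a set `I` of (indices of) edges of `F`. -/
def ends (x : StarSNA) (I : Finset (Fin x.F.length)) :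
    Fin x.E.length ⊕ I → Fin x.n × Fin x.n :=
  Sum.elim (fun e => x.E.get e) (fun i => (x.a, x.F.get i.1))

def Feasible (x : StarSNA) (I : Finset (Fin x.F.length)) : Prop :=
  ∀ d ∈ x.D, d.2.2 ≤ qConnectivity (x.ends I) x.q d.1 d.2.1

/-- The maximum requirement. -/
def k (x : StarSNA) : ℕ := x.D.toFinset.sup fun d => d.2.2

/-- The maximum number of parallel edges in `F`. -/
def pMax (x : StarSNA) : ℕ := Finset.univ.sup fun v => x.F.count v

/-- The demand edges form a star whose center is also the center of `F`. -/
def Rooted (x : StarSNA) : Prop := ∀ d ∈ x.D, d.1 = x.a ∨ d.2.1 = x.a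

/-- The set of endnodes of the edges in `I`. -/
def endnodes (x : StarSNA) (I : Finset (Fin x.F.length)) : Finset (Fin x.n) :=
  I.biUnion fun i => {x.a, x.F.get i}

def encode (x : StarSNA) : Val :=
  .ofList [.num x.n,
    .ofList (x.E.map fun e => .pair (.num e.1) (.num e.2)),
    .ofNats (List.ofFn x.q),
    .num x.a,
    .ofNats (x.F.map Fin.val),
    .ofList (x.D.map fun d => .pair (.num d.1) (.pair (.num d.2.1) (.num d.2.2)))]

/-- Undirected `a`-based survivable network augmentation with edge costs. -/
def edgeCost : MinProblem where
  Inst := (x : StarSNA) × (Fin x.F.length → ℕ)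
  encode y := .pair y.1.encode (.ofNats (List.ofFn y.2))
  Sol y := Finset (Fin y.1.F.length)
  Represents _ v I := ListsFinset v I
  Feasible y I := y.1.Feasible I
  cost y I := ∑ i ∈ I, y.2 i

/-- Undirected `a`-based survivable network augmentation with node costs: the cost of a set of
edges is the cost of the set of its endnodes. -/
def nodeCost : MinProblem where
  Inst := (x : StarSNA) × (Fin x.n → ℕ)
  encode y := .pair y.1.encode (.ofNats (List.ofFn y.2))
  Sol y := Finset (Fin y.1.F.length)
  Represents _ v I := ListsFinset v I
  Feasible y I := y.1.Feasible I
  cost y I := ∑ u ∈ y.1.endnodes I, y.2 u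

/-- `s`-based rooted survivable network augmentation with edge costs. -/
def rootedEdgeCost : MinProblem := edgeCost.restrict fun y => y.1.Rooted

/-- `s`-based rooted survivable network augmentation with node costs. -/
def rootedNodeCost : MinProblem := nodeCost.restrict fun y => y.1.Rooted

end StarSNA

/-! ### Survivable source location -/

/-- Undirected instances: a multigraph `E` on the nodes `0, …, n-1`, node capacities `q`,
flow supplies `p`, demands `d` and node costs `c`, with `1 ≤ q u ≤ p u ≤ k` for the maximum
demand `k`. -/
structure SSL where
  n : ℕ
  E : List (Fin n × Fin n)
  q : Fin n → ℕ
  p : Fin n → ℕ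
  d : Fin n → ℕ
  c : Fin n → ℕ
  one_le_q : ∀ u, 1 ≤ q u
  q_le_p : ∀ u, q u ≤ p u
  p_le_k : ∀ u, p u ≤ Finset.univ.sup d

namespace SSL

/-- The maximum demand. -/
def k (x : SSL) : ℕ := Finset.univ.sup x.d

/-- The maximum flow supply. -/
def pMax (x : SSL) : ℕ := Finset.univ.sup x.p

/-- The edges of the network obtained by adding a new node `none` that is joined to every
`u ∈ S` by `p u` parallel edges. -/
def ends (x : SSL) (S : Finset (Fin x.n)) :
    Fin x.E.length ⊕ ((u : S) × Fin (x.p u.1)) → Option (Fin x.n) × Option (Fin x.n) :=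
  Sum.elim (fun e => (some (x.E.get e).1, some (x.E.get e).2)) (fun j => (none, some j.1.1))

/-- The `(p,q)`-connectivity from `S` to `v`. The new node is the source of the flow, so that its
capacity (here `0`) plays no role. -/
noncomputable def pqConnectivity (x : SSL) (S : Finset (Fin x.n)) (v : Fin x.n) : ℕ :=
  qConnectivity (x.ends S) (fun u => u.elim 0 x.q) none (some v)

def encode (x : SSL) : Val :=
  .ofList [.num x.n,
    .ofList (x.E.map fun e => .pair (.num e.1) (.num e.2)),
    .ofNats (List.ofFn x.q),
    .ofNats (List.ofFn x.p),
    .ofNats (List.ofFn x.d),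
    .ofNats (List.ofFn x.c)]

/-- Undirected survivable source location. -/
def problem : MinProblem where
  Inst := SSL
  encode := encode
  Sol x := Finset (Fin x.n)
  Represents _ v S := ListsFinset v S
  Feasible x S := ∀ v, x.d v ≤ x.pqConnectivity S v
  cost x S := ∑ u ∈ S, x.c u

end SSL

/-! ### The ratios -/

/-- `Δ_ℓ = (4ℓ - 3)²`, for `ℓ ≥ 1`. -/
def degBound (l : ℕ) : ℕ := (4 * l - 3) ^ 2

/-- `2ℓ - 1`, for `ℓ ≥ 1`. -/
def rootedDegBound (l : ℕ) : ℕ := 2 * l - 1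

/-- `∑_{ℓ=1}^k H(Δ_ℓ) / (k - ℓ + 1)`. -/
def edgeRatio (Δ : ℕ → ℕ) (k : ℕ) : ℚ :=
  ∑ l ∈ Finset.Icc 1 k, harmonic (Δ l) / ((k : ℚ) - l + 1)

/-- `∑_{ℓ=1}^k H(Δ_ℓ) min {p / (k - ℓ + 1), 1}`. -/
def nodeRatio (Δ : ℕ → ℕ) (k p : ℕ) : ℚ :=
  ∑ l ∈ Finset.Icc 1 k, harmonic (Δ l) * min ((p : ℚ) / ((k : ℚ) - l + 1)) 1

/-!
All five problems reduce to one: given a multigraph with unit edge capacities and node capacities, a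
center `a`, demands `(u, v, r)`, and items that consist of parallel edges from `a` to one node, buy
items so that the requirements hold. By max-flow min-cut (`le_qConnectivity_iff`) a requirement holds
if and only if every biset `A ⊆ B` with `u ∈ A` and `v ∉ B` has capacity at least `r`, where the
capacity counts the edges between `A` and the complement of `B` and the capacities of the nodes in
`B \ A`. The edge-cost problem has one item for each edge and the node-cost problem one item for each
node. For source location the new node is the center; supplies and demands are truncated so that they
can be written in unary (`SSL.le_pqConnectivity_iff`).

The algorithm (`solve`) raises the connectivity in phases, so that before a phase every requirement
is missed by at most `s + 1`, and after it by at most `s`. A phase has to cover the tight bisets, those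
that miss a requirement by exactly `s + 1`; passing to complements, those with `a ∉ B` suffice, and an
edge from `a` covers such a biset if its other end lies in `A`. So it is enough to hit the minimal
inner parts `A` of tight bisets, the cores. They are computed from the least minimum cuts, which are
the sets of nodes reachable in a residual digraph (`minCut_spec`).

The cores that contain a given node are few (`length_filter_cores_le`). Indeed, by submodularity, if two
such cores belong to demands none of whose ends lies in the boundary of the other biset, then an
intersection, union or difference would be tight and contradict minimality (`Tight.conflict`). So any
two of them are in conflict, while a boundary has fewer than `ℓ` nodes if the requirements, lowered by
`s`, are at most `ℓ`. Counting the conflicts gives the bound `(4 ℓ - 3) ^ 2`, or `2 ℓ - 1` if the demands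
form a star with center `a`. Hence the greedy algorithm for hitting sets costs at most `H(Δ)` times a
fractional solution (`greedy_spec`), and a feasible solution contains `s + 1` edges for every core,
i.e. at least `(s + 1) / p` items if an item has at most `p` edges. Scaling it by `min (p / (s + 1)) 1`
gives the summand of the ratio (`phase_spec`, `solve_spec`).

The running time is handled by the predicate `PolyTime`: a function between encoded types is computed
by a program of the machine model in polynomial time. It is closed under composition, case distinction
and folds over lists whose intermediate results have polynomial size (`PolyTime.foldl`), and the
algorithms are written in terms of such folds.
-/

/-! ### Polynomial-time functions between encoded types -/

/-- Types whose elements are represented, injectively, by data values. -/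
class ToVal (α : Type) where
  toVal : α → Val
  injective : Function.Injective toVal

namespace ToVal

instance : ToVal ℕ := ⟨Val.num, fun _ _ h => Val.num.inj h⟩

instance : ToVal Bool :=
  ⟨fun b => .num (if b then 1 else 0), fun b c h => by cases b <;> cases c <;> simp_all⟩

instance {α β : Type} [ToVal α] [ToVal β] : ToVal (α × β) :=
  ⟨fun p => .pair (toVal p.1) (toVal p.2), fun p q h => by
    injection h with h₁ h₂
    exact Prod.ext (injective h₁) (injective h₂)⟩

theorem ofList_injective : Function.Injective Val.ofList := by
  intro l
  induction l with
  | nil => intro m h; cases m <;> simp_all [Val.ofList]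
  | cons a l ih =>
    intro m h
    cases m with
    | nil => simp [Val.ofList] at h
    | cons b m => simp only [Val.ofList, Val.pair.injEq] at h; rw [h.1, ih h.2]

instance {α : Type} [ToVal α] : ToVal (List α) :=
  ⟨fun l => .ofList (l.map toVal), fun _ _ h => List.map_injective_iff.2 injective (ofList_injective h)⟩

/-- The bit size of the representation. -/
def vsize {α : Type} [ToVal α] (a : α) : ℕ := (toVal a).size

end ToVal

open ToVal

theorem Val.one_le_size (v : Val) : 1 ≤ v.size := by cases v <;> simp [Val.size]

/-- The running time bounds the sizes of input and output. -/
theorem Code.Runs.size_le {c : Code} {v w : Val} {t : ℕ} (h : c.Runs v w t) :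
    v.size ≤ t ∧ w.size ≤ t := by
  induction h <;> (try simp only [Val.size] at *) <;> omega

theorem Polynomial.eval_nat_mono (T : Polynomial ℕ) {m n : ℕ} (h : m ≤ n) :
    T.eval m ≤ T.eval n := by
  rw [Polynomial.eval_eq_sum_range, Polynomial.eval_eq_sum_range]
  gcongr

section
variable {α β γ δ σ : Type} [ToVal α] [ToVal β] [ToVal γ] [ToVal δ] [ToVal σ]

theorem one_le_vsize (a : α) : 1 ≤ vsize a := Val.one_le_size _

@[simp] theorem vsize_pair (a : α) (b : β) : vsize (a, b) = vsize a + vsize b + 1 := rfl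

@[simp] theorem vsize_nil : vsize ([] : List α) = 1 := by
  simp [vsize, toVal, Val.ofList, Val.size]

@[simp] theorem vsize_cons (a : α) (l : List α) : vsize (a :: l) = vsize a + vsize l + 1 := rfl

theorem vsize_nat (n : ℕ) : vsize n = Nat.size n + 1 := rfl

theorem vsize_nat_le (n : ℕ) : vsize n ≤ n + 1 := by
  rw [vsize_nat]
  have : n.size ≤ n := Nat.size_le.2 Nat.lt_two_pow_self
  omega

theorem vsize_nat_mono {m n : ℕ} (h : m ≤ n) : vsize m ≤ vsize n := by
  simp only [vsize_nat]; have := Nat.size_le_size h; omega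

theorem vsize_bool (b : Bool) : vsize b ≤ 2 := by
  cases b <;> simp [vsize, toVal, Val.size]

theorem vsize_append (l m : List α) : vsize (l ++ m) + 1 = vsize l + vsize m := by
  induction l with
  | nil => simp; omega
  | cons a l ih => simp only [List.cons_append, vsize_cons]; omega

theorem length_lt_vsize (l : List α) : l.length < vsize l := by
  induction l with
  | nil => simp
  | cons a l ih => simp only [List.length_cons, vsize_cons]; have := one_le_vsize a; omega

theorem vsize_list_eq (l : List α) : vsize l = (l.map fun a => vsize a + 1).sum + 1 := by
  induction l with
  | nil => simp
  | cons a l ih => simp only [vsize_cons, List.map_cons, List.sum_cons, ih]; omega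

theorem vsize_list_le (l : List α) (B : ℕ) (h : ∀ a ∈ l, vsize a ≤ B) :
    vsize l ≤ l.length * (B + 1) + 1 := by
  rw [vsize_list_eq]
  have := List.sum_le_card_nsmul (l.map fun a => vsize a + 1) (B + 1) (by
    intro x hx
    obtain ⟨a, ha, rfl⟩ := List.mem_map.1 hx
    have := h a ha
    omega)
  simp only [List.length_map, smul_eq_mul] at this
  omega

theorem vsize_le_of_mem {a : α} {l : List α} (h : a ∈ l) : vsize a < vsize l := by
  induction l with
  | nil => simp at h
  | cons b l ih =>
    rcases List.mem_cons.1 h with rfl | h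
    · simp only [vsize_cons]; omega
    · have := ih h; simp only [vsize_cons]; omega

theorem List.Perm.vsize_eq {l m : List α} (h : l.Perm m) : vsize l = vsize m := by
  rw [vsize_list_eq, vsize_list_eq, (h.map _).sum_eq]

theorem List.Sublist.vsize_le {l m : List α} (h : l.Sublist m) : vsize l ≤ vsize m := by
  rw [vsize_list_eq, vsize_list_eq]
  have := (h.map fun a => vsize a + 1).sum_le_sum (fun _ _ => Nat.zero_le _)
  omega

theorem List.Subperm.vsize_le {l m : List α} (h : l.Subperm m) : vsize l ≤ vsize m := by
  obtain ⟨k, hk, hs⟩ := h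
  exact hk.vsize_eq ▸ hs.vsize_le

/-- `g a` is bounded by a polynomial in the size of `a`. -/
def PolyBound (g : α → ℕ) : Prop := ∃ T : Polynomial ℕ, ∀ a, g a ≤ T.eval (vsize a)

theorem PolyBound.mono {g h : α → ℕ} (hg : PolyBound g) (hle : ∀ a, h a ≤ g a) : PolyBound h := by
  obtain ⟨T, hT⟩ := hg
  exact ⟨T, fun a => (hle a).trans (hT a)⟩

theorem PolyBound.const (n : ℕ) : PolyBound fun _ : α => n := ⟨.C n, by simp⟩

theorem PolyBound.size : PolyBound fun a : α => vsize a := ⟨.X, by simp⟩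

theorem PolyBound.add {g h : α → ℕ} (hg : PolyBound g) (hh : PolyBound h) :
    PolyBound fun a => g a + h a := by
  obtain ⟨T, hT⟩ := hg
  obtain ⟨U, hU⟩ := hh
  exact ⟨T + U, fun a => by simpa using add_le_add (hT a) (hU a)⟩

theorem PolyBound.mul {g h : α → ℕ} (hg : PolyBound g) (hh : PolyBound h) :
    PolyBound fun a => g a * h a := by
  obtain ⟨T, hT⟩ := hg
  obtain ⟨U, hU⟩ := hh
  exact ⟨T * U, fun a => by simpa using Nat.mul_le_mul (hT a) (hU a)⟩

theorem PolyBound.eval {g : α → ℕ} (T : Polynomial ℕ) (hg : PolyBound g) :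
    PolyBound fun a => T.eval (g a) := by
  obtain ⟨U, hU⟩ := hg
  exact ⟨T.comp U, fun a => by simpa using T.eval_nat_mono (hU a)⟩

/-- The function `f` is computed by a program in time polynomial in the size of the argument. -/
@[fun_prop]
def PolyTime (f : α → β) : Prop :=
  ∃ (c : Code) (T : Polynomial ℕ), ∀ a, ∃ t, c.Runs (toVal a) (toVal (f a)) t ∧ t ≤ T.eval (vsize a)

namespace PolyTime

theorem of_bound {f : α → β} {g : α → ℕ} (c : Code) (hg : PolyBound g)
    (h : ∀ a, ∃ t, c.Runs (toVal a) (toVal (f a)) t ∧ t ≤ g a) : PolyTime f := by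
  obtain ⟨T, hT⟩ := hg
  refine ⟨c, T, fun a => ?_⟩
  obtain ⟨t, ht, hle⟩ := h a
  exact ⟨t, ht, hle.trans (hT a)⟩

theorem exists_bound {f : α → β} (h : PolyTime f) : ∃ (c : Code) (g : α → ℕ), PolyBound g ∧
    ∀ a, ∃ t, c.Runs (toVal a) (toVal (f a)) t ∧ t ≤ g a := by
  obtain ⟨c, T, h⟩ := h
  exact ⟨c, fun a => T.eval (vsize a), PolyBound.size.eval T, h⟩

theorem polyBound {f : α → β} (h : PolyTime f) : PolyBound fun a => vsize (f a) := by
  obtain ⟨c, T, h⟩ := h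
  refine ⟨T, fun a => ?_⟩
  obtain ⟨t, ht, hle⟩ := h a
  exact ht.size_le.2.trans hle

@[fun_prop]
theorem id' : PolyTime fun a : α => a := by
  refine of_bound (.prim .ident) (PolyBound.size.add PolyBound.size) fun a => ⟨_, .prim _ _, le_rfl⟩

@[fun_prop]
theorem comp {f : β → γ} {g : α → β} (hf : PolyTime f) (hg : PolyTime g) :
    PolyTime fun a => f (g a) := by
  obtain ⟨cf, T, hcf⟩ := hf
  obtain ⟨cg, v, hv, hcg⟩ := hg.exists_bound
  refine of_bound (.comp cf cg) ((hv.add (hg.polyBound.eval T)).add (.const 1)) fun a => ?_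
  obtain ⟨t₁, h₁, hl₁⟩ := hcg a
  obtain ⟨t₂, h₂, hl₂⟩ := hcf (g a)
  exact ⟨_, .comp h₁ h₂, by omega⟩

@[fun_prop]
theorem prodMk {f : α → β} {g : α → γ} (hf : PolyTime f) (hg : PolyTime g) :
    PolyTime fun a => (f a, g a) := by
  obtain ⟨cf, u, hu, hcf⟩ := hf.exists_bound
  obtain ⟨cg, v, hv, hcg⟩ := hg.exists_bound
  refine of_bound (.pair cf cg) ((hu.add hv).add (.const 1)) fun a => ?_
  obtain ⟨t₁, h₁, hl₁⟩ := hcf a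
  obtain ⟨t₂, h₂, hl₂⟩ := hcg a
  exact ⟨_, .pair h₁ h₂, by omega⟩

theorem fst' : PolyTime fun p : α × β => p.1 :=
  of_bound (.prim .fst) (PolyBound.size.add PolyBound.size) fun p =>
    ⟨_, .prim _ _, by
      change vsize p + vsize p.1 ≤ vsize p + vsize p
      have : vsize p = vsize p.1 + vsize p.2 + 1 := rfl
      omega⟩

theorem snd' : PolyTime fun p : α × β => p.2 :=
  of_bound (.prim .snd) (PolyBound.size.add PolyBound.size) fun p =>
    ⟨_, .prim _ _, by
      change vsize p + vsize p.2 ≤ vsize p + vsize p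
      have : vsize p = vsize p.1 + vsize p.2 + 1 := rfl
      omega⟩

@[fun_prop]
theorem fst {f : α → β × γ} (hf : PolyTime f) : PolyTime fun a => (f a).1 := comp fst' hf

@[fun_prop]
theorem snd {f : α → β × γ} (hf : PolyTime f) : PolyTime fun a => (f a).2 := comp snd' hf

theorem exists_const_code (v : Val) : ∃ (c : Code) (C : ℕ), ∀ w : Val,
    ∃ t, c.Runs w v t ∧ t ≤ C * (w.size + 1) := by
  induction v with
  | num n =>
    refine ⟨.prim (.const n), (Val.num n).size + 1, fun w => ⟨_, .prim _ _, ?_⟩⟩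
    simp only [Prim.apply]
    nlinarith
  | pair v₁ v₂ ih₁ ih₂ =>
    obtain ⟨c₁, C₁, h₁⟩ := ih₁
    obtain ⟨c₂, C₂, h₂⟩ := ih₂
    refine ⟨.pair c₁ c₂, C₁ + C₂ + 1, fun w => ?_⟩
    obtain ⟨t₁, hr₁, hl₁⟩ := h₁ w
    obtain ⟨t₂, hr₂, hl₂⟩ := h₂ w
    exact ⟨_, .pair hr₁ hr₂, by nlinarith⟩

@[fun_prop]
theorem const (b : β) : PolyTime fun _ : α => b := by
  obtain ⟨c, C, h⟩ := exists_const_code (toVal b)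
  exact of_bound c ((PolyBound.const C).mul (PolyBound.size.add (.const 1))) fun a => h _

@[fun_prop]
theorem bcond {b : α → Bool} {f g : α → β} (hb : PolyTime b) (hf : PolyTime f) (hg : PolyTime g) :
    PolyTime fun a => cond (b a) (f a) (g a) := by
  obtain ⟨cb, w, hw, hcb⟩ := hb.exists_bound
  obtain ⟨cf, u, hu, hcf⟩ := hf.exists_bound
  obtain ⟨cg, v, hv, hcg⟩ := hg.exists_bound
  refine of_bound (.cond cb cf cg) (((hw.add hu).add hv).add (.const 1)) fun a => ?_
  obtain ⟨t₁, h₁, hl₁⟩ := hcb a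
  cases hba : b a with
  | true =>
    obtain ⟨t₂, h₂, hl₂⟩ := hcf a
    exact ⟨_, .cond_true h₁ (by simp [hba, toVal]) h₂, by omega⟩
  | false =>
    obtain ⟨t₂, h₂, hl₂⟩ := hcg a
    have h₁' : cb.Runs (toVal a) (.num 0) t₁ := by simpa [hba, toVal] using h₁
    exact ⟨_, .cond_false h₁' h₂, by omega⟩

@[fun_prop]
theorem not {b : α → Bool} (hb : PolyTime b) : PolyTime fun a => !b a := by
  have := bcond hb (const false) (const true)
  convert this using 2 with a
  cases b a <;> rfl

@[fun_prop]
theorem and {b c : α → Bool} (hb : PolyTime b) (hc : PolyTime c) : PolyTime fun a => b a && c a := by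
  have := bcond hb hc (const false)
  convert this using 2 with a
  cases b a <;> rfl

/-- An elementary operation whose result has polynomial size is a polynomial-time function. -/
theorem of_prim {f : α → β} (p : Prim) (h : ∀ a, p.apply (toVal a) = toVal (f a))
    (hs : PolyBound fun a => vsize (f a)) : PolyTime f :=
  of_bound (.prim p) (PolyBound.size.add hs) fun a => by
    have := Code.Runs.prim p (toVal a)
    rw [h a] at this
    exact ⟨_, this, le_rfl⟩

@[fun_prop]
theorem decEq [DecidableEq β] {f g : α → β} (hf : PolyTime f) (hg : PolyTime g) :
    PolyTime fun a => decide (f a = g a) := by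
  have : PolyTime fun p : β × β => decide (p.1 = p.2) := by
    refine of_prim .eq (fun p => ?_) ((PolyBound.const 2).mono fun _ => vsize_bool _)
    simp only [toVal, Prim.apply]
    by_cases h : p.1 = p.2
    · simp [h]
    · have : ¬ ToVal.toVal p.1 = ToVal.toVal p.2 := fun h' => h (injective h')
      simp [h, this]
  exact comp this (prodMk hf hg)

@[fun_prop]
theorem decLE {f g : α → ℕ} (hf : PolyTime f) (hg : PolyTime g) :
    PolyTime fun a => decide (f a ≤ g a) := by
  have : PolyTime fun p : ℕ × ℕ => decide (p.1 ≤ p.2) := by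
    refine of_prim .le (fun p => ?_) ((PolyBound.const 2).mono fun _ => vsize_bool _)
    simp only [toVal, Prim.apply]
    by_cases h : p.1 ≤ p.2 <;> simp [h]
  exact comp this (prodMk hf hg)

@[fun_prop]
theorem decLT {f g : α → ℕ} (hf : PolyTime f) (hg : PolyTime g) :
    PolyTime fun a => decide (f a < g a) := by
  have := not (decLE hg hf)
  convert this using 2 with a
  simp [← decide_not]

@[fun_prop]
theorem add {f g : α → ℕ} (hf : PolyTime f) (hg : PolyTime g) :
    PolyTime fun a => f a + g a := by
  have : PolyTime fun p : ℕ × ℕ => p.1 + p.2 := by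
    refine of_prim .add (fun p => rfl) (PolyBound.size.mono fun p => ?_)
    obtain ⟨m, n⟩ := p
    simp only [vsize_pair, vsize_nat]
    have : (m + n).size ≤ m.size + n.size + 1 := by
      rw [Nat.size_le]
      have h1 := Nat.lt_size_self m
      have h2 := Nat.lt_size_self n
      have h3 : 2 ^ m.size ≤ 2 ^ (m.size + n.size) := Nat.pow_le_pow_right (by norm_num) (by omega)
      have h4 : 2 ^ n.size ≤ 2 ^ (m.size + n.size) := Nat.pow_le_pow_right (by norm_num) (by omega)
      rw [pow_succ]
      omega
    omega
  exact comp this (prodMk hf hg)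

@[fun_prop]
theorem mul {f g : α → ℕ} (hf : PolyTime f) (hg : PolyTime g) :
    PolyTime fun a => f a * g a := by
  have : PolyTime fun p : ℕ × ℕ => p.1 * p.2 := by
    refine of_prim .mul (fun p => rfl) (PolyBound.size.mono fun p => ?_)
    obtain ⟨m, n⟩ := p
    simp only [vsize_pair, vsize_nat]
    have : (m * n).size ≤ m.size + n.size := by
      rw [Nat.size_le, pow_add]
      exact Nat.mul_lt_mul'' (Nat.lt_size_self m) (Nat.lt_size_self n)
    omega
  exact comp this (prodMk hf hg)

@[fun_prop]
theorem sub {f g : α → ℕ} (hf : PolyTime f) (hg : PolyTime g) :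
    PolyTime fun a => f a - g a := by
  have : PolyTime fun p : ℕ × ℕ => p.1 - p.2 := by
    refine of_prim .sub (fun p => rfl) (PolyBound.size.mono fun p => ?_)
    obtain ⟨m, n⟩ := p
    have := vsize_nat_mono (Nat.sub_le m n)
    simp only [vsize_pair]
    omega
  exact comp this (prodMk hf hg)

@[fun_prop]
theorem cons {f : α → β} {g : α → List β} (hf : PolyTime f) (hg : PolyTime g) :
    PolyTime fun a => f a :: g a := by
  obtain ⟨c, T, h⟩ := prodMk hf hg
  exact ⟨c, T, h⟩

/-- Case distinction on a list. -/
def _root_.lcase {β γ : Type} (l : List β) (n : γ) (c : β → List β → γ) : γ :=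
  match l with
  | [] => n
  | x :: xs => c x xs

@[simp] theorem _root_.lcase_nil {β γ : Type} (n : γ) (c : β → List β → γ) :
    lcase [] n c = n := rfl

@[simp] theorem _root_.lcase_cons {β γ : Type} (x : β) (xs : List β) (n : γ)
    (c : β → List β → γ) : lcase (x :: xs) n c = c x xs := rfl

theorem lcase {l : α → List β} {n : α → γ} {c : α → β → List β → γ} (hl : PolyTime l)
    (hn : PolyTime n) (hc : PolyTime fun p : α × β × List β => c p.1 p.2.1 p.2.2) :
    PolyTime fun a => lcase (l a) (n a) (c a) := by
  obtain ⟨cl, u, hu, hcl⟩ := (prodMk id' hl).exists_bound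
  obtain ⟨cn, v, hv, hcn⟩ := hn.exists_bound
  obtain ⟨cc, T, hcc⟩ := hc
  have hs := (prodMk (id' (α := α)) hl).polyBound
  refine of_bound (.cond (.comp (.comp (.prim .isPair) (.prim .snd)) cl) (.comp cc cl) cn)
    ((((hu.add (((hs.add hs).add hs).add ((hs.add hs).add (.const 20)))).add hu).add hv).add
      (hs.eval T)) fun a => ?_
  obtain ⟨t₁, h₁, hl₁⟩ := hcl a
  obtain ⟨t₂, h₂, hl₂⟩ := hcn a
  have key : ∀ w : Val, w.size ≤ vsize (l a) → (Prim.isPair.apply (toVal (l a))) = w →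
      (Code.comp (.comp (.prim .isPair) (.prim .snd)) cl).Runs (toVal a) w
      (t₁ + ((vsize (a, l a) + vsize (l a)) + (vsize (l a) + w.size) + 1) + 1) := by
    rintro w - rfl
    exact .comp h₁ (.comp (.prim .snd _) (.prim .isPair _))
  cases hla : l a with
  | nil =>
    have := key (.num 0) (by simp [Val.size, one_le_vsize]) (by simp [hla, toVal, Val.ofList, Prim.apply])
    refine ⟨_, .cond_false this h₂, ?_⟩
    simp only [hla, vsize_pair, vsize_nil, Val.size, Nat.size_zero] at *
    omega
  | cons x xs =>
    obtain ⟨t₃, h₃, hl₃⟩ := hcc (a, x, xs)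
    have h1 : (Val.num 1).size = 2 := by simp [Val.size]
    have := key (.num 1) (by rw [h1, hla]; have := length_lt_vsize (x :: xs); simp at this ⊢; omega)
      (by simp [hla, toVal, Val.ofList, Prim.apply])
    rw [hla] at h₁
    refine ⟨_, .cond_true this (by simp) (.comp h₁ h₃), ?_⟩
    rw [h1]
    simp only [hla, vsize_pair, vsize_cons] at *
    omega

/-- A while-loop whose tests and bodies take time at most `W`. -/
theorem runs_iterate {b : σ → Bool} {g : σ → σ} {cb cg : Code} {W : ℕ} (n : ℕ) (s : σ)
    (hb : ∀ i ≤ n, ∃ t, cb.Runs (toVal (g^[i] s)) (toVal (b (g^[i] s))) t ∧ t ≤ W)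
    (hg : ∀ i < n, ∃ t, cg.Runs (toVal (g^[i] s)) (toVal (g (g^[i] s))) t ∧ t ≤ W)
    (htrue : ∀ i < n, b (g^[i] s) = true) (hfalse : b (g^[n] s) = false) :
    ∃ t, (Code.loop cb cg).Runs (toVal s) (toVal (g^[n] s)) t ∧ t ≤ (n + 1) * (2 * W + 1) := by
  induction n generalizing s with
  | zero =>
    obtain ⟨t, ht, hle⟩ := hb 0 le_rfl
    simp only [Function.iterate_zero, id] at ht hfalse ⊢
    rw [hfalse] at ht
    exact ⟨_, Code.Runs.loop_stop ht, by omega⟩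
  | succ n ih =>
    obtain ⟨t₁, h₁, hl₁⟩ := hb 0 (by omega)
    obtain ⟨t₂, h₂, hl₂⟩ := hg 0 (by omega)
    obtain ⟨t₃, h₃, hl₃⟩ := ih (g s) (fun i hi => hb (i + 1) (by omega))
      (fun i hi => hg (i + 1) (by omega)) (fun i hi => htrue (i + 1) (by omega)) hfalse
    have h0 := htrue 0 (by omega)
    simp only [Function.iterate_zero, id] at h₁ h₂ h0
    rw [h0] at h₁
    refine ⟨_, .loop_step h₁ (by simp [toVal]) h₂ h₃, ?_⟩
    nlinarith

/-- A while-loop that makes polynomially many rounds through values of polynomial size runs in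
polynomial time. -/
theorem iterate {b : σ → Bool} {g : σ → σ} {init : α → σ} {N : α → ℕ} (hb : PolyTime b)
    (hg : PolyTime g) (hi : PolyTime init) (hN : PolyBound N)
    (hS : ∃ T : Polynomial ℕ, ∀ a, ∀ i ≤ N a, vsize (g^[i] (init a)) ≤ T.eval (vsize a))
    (htrue : ∀ a, ∀ i < N a, b (g^[i] (init a)) = true)
    (hfalse : ∀ a, b (g^[N a] (init a)) = false) :
    PolyTime fun a => g^[N a] (init a) := by
  obtain ⟨S, hS⟩ := hS
  obtain ⟨cb, Tb, hcb⟩ := hb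
  obtain ⟨cg, Tg, hcg⟩ := hg
  obtain ⟨ci, u, hu, hci⟩ := hi.exists_bound
  have hW : PolyBound fun a : α => Tb.eval (S.eval (vsize a)) + Tg.eval (S.eval (vsize a)) :=
    ((PolyBound.size.eval S).eval Tb).add ((PolyBound.size.eval S).eval Tg)
  refine of_bound (.comp (.loop cb cg) ci)
    ((hu.add ((hN.add (.const 1)).mul (((PolyBound.const 2).mul hW).add (.const 1)))).add (.const 1))
    fun a => ?_
  obtain ⟨t₁, h₁, hl₁⟩ := hci a
  obtain ⟨t₂, h₂, hl₂⟩ := runs_iterate (W := Tb.eval (S.eval (vsize a)) + Tg.eval (S.eval (vsize a)))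
    (N a) (init a)
    (fun i hi => by
      obtain ⟨t, ht, hl⟩ := hcb (g^[i] (init a))
      exact ⟨t, ht, hl.trans ((Tb.eval_nat_mono (hS a i hi)).trans (Nat.le_add_right _ _))⟩)
    (fun i hi => by
      obtain ⟨t, ht, hl⟩ := hcg (g^[i] (init a))
      exact ⟨t, ht, hl.trans ((Tg.eval_nat_mono (hS a i hi.le)).trans (Nat.le_add_left _ _))⟩)
    (htrue a) (hfalse a)
  exact ⟨_, .comp h₁ h₂, by omega⟩

/-- Folding over a list runs in polynomial time if all intermediate results have polynomial size. -/
theorem foldl {f : α → σ → β → σ} {init : α → σ} {l : α → List β}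
    (hf : PolyTime fun p : (α × σ) × β => f p.1.1 p.1.2 p.2) (hi : PolyTime init) (hl : PolyTime l)
    (hS : ∃ T : Polynomial ℕ, ∀ a l₁ l₂, l a = l₁ ++ l₂ →
      vsize (l₁.foldl (f a) (init a)) ≤ T.eval (vsize a)) :
    PolyTime fun a => (l a).foldl (f a) (init a) := by
  -- The state of the loop: the parameter, the accumulator, and the rest of the list.
  set g : (α × σ) × List β → (α × σ) × List β :=
    fun s => _root_.lcase s.2 s fun x xs => ((s.1.1, f s.1.1 s.1.2 x), xs) with hg
  have hgP : PolyTime g := by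
    refine PolyTime.lcase (by fun_prop) (by fun_prop) ?_
    have := comp hf (g := fun p : ((α × σ) × List β) × β × List β => (p.1.1, p.2.1)) (by fun_prop)
    exact prodMk (prodMk (by fun_prop) this) (by fun_prop)
  have hbP : PolyTime fun s : (α × σ) × List β => _root_.lcase s.2 false fun _ _ => true :=
    PolyTime.lcase (by fun_prop) (by fun_prop) (by fun_prop)
  have key : ∀ (a : α) (l₁ l₂ : List β) (s : σ),
      g^[l₁.length] ((a, s), l₁ ++ l₂) = ((a, l₁.foldl (f a) s), l₂) := by
    intro a l₁ l₂
    induction l₁ with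
    | nil => intro s; rfl
    | cons x xs ih =>
      intro s
      rw [List.length_cons, Function.iterate_succ_apply]
      simpa [hg] using ih (f a s x)
  have key' : ∀ a, ∀ i ≤ (l a).length, g^[i] ((a, init a), l a)
      = ((a, ((l a).take i).foldl (f a) (init a)), (l a).drop i) := by
    intro a i hi
    have := key a ((l a).take i) ((l a).drop i) (init a)
    rwa [List.length_take, min_eq_left hi, List.take_append_drop] at this
  obtain ⟨T, hT⟩ := hS
  have hlb := hl.polyBound
  obtain ⟨U, hU⟩ := hlb
  have := iterate (init := fun a => ((a, init a), l a)) (N := fun a => (l a).length) hbP hgP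
    (by fun_prop) (hl.polyBound.mono fun a => (length_lt_vsize _).le)
    ⟨.X + T + 1 + U + 1, fun a i hi => by
      rw [key' a i hi]
      have h1 := hT a _ _ (List.take_append_drop i (l a)).symm
      have h2 := (List.drop_sublist i (l a)).vsize_le
      have h3 := hU a
      simp only [vsize_pair, Polynomial.eval_add, Polynomial.eval_X, Polynomial.eval_one] at *
      omega⟩
    (fun a i hi => by
      rw [key' a i hi.le]
      simp only
      rw [List.drop_eq_getElem_cons hi]; rfl)
    (fun a => by rw [key' a _ le_rfl, List.drop_length]; rfl)
  have := snd (fst this)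
  convert this using 2 with a
  rw [key' a _ le_rfl, List.take_length]

end PolyTime
end

/-! ### List operations in polynomial time -/

namespace PolyTime

theorem foldl_getD_aux {β : Type} (l : List β) (i j : ℕ) (d : β) :
    (l.foldl (fun (s : ℕ × β) x => (s.1 + 1, cond (decide (s.1 = i)) x s.2)) (j, d))
      = (j + l.length, if j ≤ i then l.getD (i - j) d else d) := by
  induction l generalizing j d with
  | nil => simp
  | cons x l ih =>
    rw [List.foldl_cons, ih]
    rcases lt_trichotomy j i with h | h | h
    · have : i - j = (i - (j + 1)) + 1 := by omega
      simp [h.ne, h.le, show j + 1 ≤ i from h, this]; omega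
    · subst h; simp; omega
    · simp [h.ne', show ¬ j ≤ i by omega, show ¬ j + 1 ≤ i by omega]; omega

section
variable {α β γ σ : Type} [ToVal α] [ToVal β] [ToVal γ] [ToVal σ]

attribute [fun_prop] PolyTime.lcase

theorem reverse' : PolyTime fun l : List β => l.reverse := by
  have := foldl (f := fun (_ : List β) (s : List β) (x : β) => x :: s) (init := fun _ => [])
    (l := fun l : List β => l) (by fun_prop) (by fun_prop) (by fun_prop)
    ⟨.X, fun a l₁ l₂ h => by
      simp only [List.foldl_flip_cons_eq_append', List.append_nil, Polynomial.eval_X]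
      rw [(List.reverse_perm l₁).vsize_eq]
      rw [h]
      exact (List.sublist_append_left _ _).vsize_le⟩
  simpa using this

@[fun_prop]
theorem reverse {l : α → List β} (hl : PolyTime l) : PolyTime fun a => (l a).reverse :=
  comp reverse' hl

@[fun_prop]
theorem append {l m : α → List β} (hl : PolyTime l) (hm : PolyTime m) :
    PolyTime fun a => l a ++ m a := by
  have : PolyTime fun p : List β × List β => p.1 ++ p.2 := by
    have := foldl (f := fun (_ : List β × List β) (s : List β) (x : β) => x :: s)
      (init := fun p => p.2) (l := fun p : List β × List β => p.1.reverse)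
      (by fun_prop) (by fun_prop) (by fun_prop)
      ⟨.X, fun p l₁ l₂ h => by
        simp only [List.foldl_flip_cons_eq_append', Polynomial.eval_X]
        have h1 := vsize_append l₁.reverse p.2
        have h2 := vsize_append l₁ l₂
        rw [← h, (List.reverse_perm p.1).vsize_eq] at h2
        rw [(List.reverse_perm l₁).vsize_eq] at h1
        have h3 : vsize p = vsize p.1 + vsize p.2 + 1 := rfl
        have := one_le_vsize l₂
        omega⟩
    simpa using this
  exact comp this (prodMk hl hm)

@[fun_prop]
theorem flatMap {l : α → List β} {f : α → β → List γ} (hl : PolyTime l)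
    (hf : PolyTime fun p : α × β => f p.1 p.2) : PolyTime fun a => (l a).flatMap (f a) := by
  have hfold : ∀ (g : β → List γ) (l : List β) (s : List γ),
      l.foldl (fun s x => s ++ g x) s = s ++ l.flatMap g := by
    intro g l
    induction l with
    | nil => simp
    | cons x l ih => intro s; simp [ih]
  obtain ⟨T, hT⟩ := hf.polyBound
  obtain ⟨U, hU⟩ := hl.polyBound
  have hf' := comp hf (g := fun p : (α × List γ) × β => (p.1.1, p.2)) (by fun_prop)
  have := foldl (f := fun (a : α) (s : List γ) (x : β) => s ++ f a x) (init := fun _ => [])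
    (l := l) (append (by fun_prop) hf') (by fun_prop) hl
    ⟨U * T.comp (.X + U + 1) + 1, fun a l₁ l₂ h => by
      rw [hfold, List.nil_append]
      have key : ∀ m : List β, (∀ x ∈ m, x ∈ l a) → vsize (m.flatMap (f a))
          ≤ m.length * T.eval (vsize a + U.eval (vsize a) + 1) + 1 := by
        intro m
        induction m with
        | nil => simp
        | cons x m ih =>
          intro hm
          have h1 := ih fun y hy => hm y (List.mem_cons_of_mem _ hy)
          have h2 := vsize_append (f a x) (m.flatMap (f a))
          have h3 := hT (a, x)
          have h4 : vsize (a, x) ≤ vsize a + U.eval (vsize a) + 1 := by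
            have := vsize_le_of_mem (hm x (List.mem_cons_self))
            have := hU a
            simp only [vsize_pair] at *
            omega
          have h5 := T.eval_nat_mono h4
          simp only [List.flatMap_cons, List.length_cons, add_mul] at *
          omega
      have h1 := key l₁ (fun x hx => by rw [h]; exact List.mem_append_left _ hx)
      have h2 : l₁.length ≤ U.eval (vsize a) := by
        have h3 := length_lt_vsize (l a)
        have h4 := hU a
        have : l₁.length ≤ (l a).length := by rw [h]; simp
        simp only at h4
        omega
      have h6 := Nat.mul_le_mul_right (T.eval (vsize a + U.eval (vsize a) + 1)) h2
      simp only [Polynomial.eval_add, Polynomial.eval_mul, Polynomial.eval_comp, Polynomial.eval_X,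
        Polynomial.eval_one]
      omega⟩
  convert this using 2 with a
  rw [hfold, List.nil_append]

@[fun_prop]
theorem map {l : α → List β} {f : α → β → γ} (hl : PolyTime l)
    (hf : PolyTime fun p : α × β => f p.1 p.2) : PolyTime fun a => (l a).map (f a) := by
  have := flatMap (f := fun a x => [f a x]) hl (cons hf (const []))
  convert this using 2 with a
  rw [List.map_eq_flatMap]

@[fun_prop]
theorem filter {l : α → List β} {p : α → β → Bool} (hl : PolyTime l)
    (hp : PolyTime fun q : α × β => p q.1 q.2) : PolyTime fun a => (l a).filter (p a) := by
  have : PolyTime fun q : α × β => cond (p q.1 q.2) [q.2] [] := bcond hp (by fun_prop) (by fun_prop)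
  have := flatMap (f := fun a x => cond (p a x) [x] []) hl this
  convert this using 2 with a
  generalize l a = m
  induction m with
  | nil => rfl
  | cons x m ih => simp only [List.flatMap_cons, ← ih, List.filter_cons]; cases p a x <;> simp

@[fun_prop]
theorem any {l : α → List β} {p : α → β → Bool} (hl : PolyTime l)
    (hp : PolyTime fun q : α × β => p q.1 q.2) : PolyTime fun a => (l a).any (p a) := by
  have : PolyTime fun a => _root_.lcase ((l a).filter (p a)) false fun _ _ => true := by fun_prop
  convert this using 2 with a
  generalize l a = m
  induction m with
  | nil => rfl
  | cons x m ih => simp only [List.any_cons, ih, List.filter_cons]; cases p a x <;> simp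

@[fun_prop]
theorem all {l : α → List β} {p : α → β → Bool} (hl : PolyTime l)
    (hp : PolyTime fun q : α × β => p q.1 q.2) : PolyTime fun a => (l a).all (p a) := by
  have : PolyTime fun a => !((l a).any fun x => !p a x) := by fun_prop
  convert this using 2 with a
  rw [List.all_eq_not_any_not]

@[fun_prop]
theorem decMem {f : α → β} {l : α → List β} [∀ a, Decidable (f a ∈ l a)] (hf : PolyTime f)
    (hl : PolyTime l) : PolyTime fun a => decide (f a ∈ l a) := by
  classical
  have : PolyTime fun a => (l a).any fun x => decide (f a = x) := by fun_prop
  convert this using 2 with a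
  rw [Bool.eq_iff_iff]
  simp

@[fun_prop]
theorem length {l : α → List β} (hl : PolyTime l) : PolyTime fun a => (l a).length := by
  have hfold : ∀ (l : List β) (s : ℕ), l.foldl (fun s _ => s + 1) s = s + l.length := by
    intro l
    induction l with
    | nil => simp
    | cons x l ih => intro s; simp [ih]; omega
  obtain ⟨U, hU⟩ := hl.polyBound
  have := foldl (f := fun (_ : α) (s : ℕ) (_ : β) => s + 1) (init := fun _ => 0)
    (l := l) (by fun_prop) (by fun_prop) hl
    ⟨U + 1, fun a l₁ l₂ h => by
      rw [hfold, zero_add]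
      have h1 := vsize_nat_le l₁.length
      have h2 := length_lt_vsize (l a)
      have h3 : l₁.length ≤ (l a).length := by rw [h]; simp
      have h4 := hU a
      simp only [Polynomial.eval_add, Polynomial.eval_one] at *
      omega⟩
  convert this using 2 with a
  rw [hfold, zero_add]

/-- The range of the length of a list: numbers are bounded in unary. -/
@[fun_prop]
theorem range_length {l : α → List β} (hl : PolyTime l) :
    PolyTime fun a => List.range (l a).length := by
  have hfold : ∀ (l : List β) (n : ℕ), l.foldl (fun s _ => s ++ [s.length]) (List.range n)
      = List.range (n + l.length) := by
    intro l
    induction l with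
    | nil => simp
    | cons x l ih =>
      intro n
      rw [List.foldl_cons, List.length_range, ← List.range_succ, ih]
      simp; congr 1; omega
  obtain ⟨U, hU⟩ := hl.polyBound
  have := foldl (f := fun (_ : α) (s : List ℕ) (_ : β) => s ++ [s.length]) (init := fun _ => [])
    (l := l) (by fun_prop) (by fun_prop) hl
    ⟨U * (U + 1 + 1) + 1, fun a l₁ l₂ h => by
      have := hfold l₁ 0
      rw [List.range_zero, zero_add] at this
      rw [this]
      have h2 := length_lt_vsize (l a)
      have h3 : l₁.length ≤ (l a).length := by rw [h]; simp
      have h4 := hU a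
      have h1 := vsize_list_le (List.range l₁.length) (U.eval (vsize a) + 1) (by
        intro n hn
        have := List.mem_range.1 hn
        have := vsize_nat_le n
        simp only at h4
        omega)
      rw [List.length_range] at h1
      simp only [Polynomial.eval_add, Polynomial.eval_one, Polynomial.eval_mul] at *
      refine h1.trans ?_
      gcongr
      omega⟩
  convert this using 2 with a
  have := hfold (l a) 0
  rw [List.range_zero, zero_add] at this
  exact this.symm

@[fun_prop]
theorem getD {l : α → List β} {i : α → ℕ} {d : α → β} (hl : PolyTime l) (hi : PolyTime i)
    (hd : PolyTime d) : PolyTime fun a => (l a).getD (i a) (d a) := by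
  obtain ⟨U, hU⟩ := hl.polyBound
  obtain ⟨V, hV⟩ := hd.polyBound
  have hi' := comp hi (g := fun p : (α × (ℕ × β)) × β => p.1.1) (by fun_prop)
  have := snd (foldl (f := fun (a : α) (s : ℕ × β) (x : β) =>
      (s.1 + 1, cond (decide (s.1 = i a)) x s.2)) (init := fun a => (0, d a))
    (l := l) (prodMk (by fun_prop) (bcond (decEq (by fun_prop) hi') (by fun_prop) (by fun_prop)))
    (by fun_prop) hl
    ⟨U + 1 + (U + V) + 1, fun a l₁ l₂ h => by
      rw [foldl_getD_aux]
      simp only [zero_add, Nat.zero_le, if_true, Nat.sub_zero, vsize_pair]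
      have h1 := vsize_nat_le l₁.length
      have h2 := length_lt_vsize (l a)
      have h3 : l₁.length ≤ (l a).length := by rw [h]; simp
      have h4 := hU a
      have h5 := hV a
      have h6 : vsize (l₁.getD (i a) (d a)) ≤ vsize (l a) + vsize (d a) := by
        rw [List.getD_eq_getElem?_getD]
        cases hx : l₁[i a]? with
        | none => simp
        | some x =>
          have : x ∈ l a := by rw [h]; exact List.mem_append_left _ (List.mem_of_getElem? hx)
          have := vsize_le_of_mem this
          simp; omega
      simp only [Polynomial.eval_add, Polynomial.eval_one] at *
      omega⟩)
  convert this using 2 with a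
  rw [foldl_getD_aux]
  simp

theorem erase' [DecidableEq β] {l : α → List β} {x : α → β} (hl : PolyTime l) (hx : PolyTime x) :
    PolyTime fun a => (l a).erase (x a) := by
  have hfold : ∀ (l m : List β) (x : β) (b : Bool),
      (l.foldl (fun (s : Bool × List β) y => cond (!s.1 && decide (y = x)) (true, s.2)
        (s.1, y :: s.2)) (b, m)).2 = (bif b then l else l.erase x).reverse ++ m := by
    intro l
    induction l with
    | nil => simp
    | cons y l ih =>
      intro m x b
      rw [List.foldl_cons]
      cases b
      · by_cases h : y = x
        · simp [h, ih]
        · simp [h, ih]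
      · simp [ih]
  obtain ⟨U, hU⟩ := hl.polyBound
  have hx' := comp hx (g := fun p : (α × (Bool × List β)) × β => p.1.1) (by fun_prop)
  have := reverse (snd (foldl (f := fun (a : α) (s : Bool × List β) (y : β) =>
      cond (!s.1 && decide (y = x a)) (true, s.2) (s.1, y :: s.2)) (init := fun a => (false, []))
    (l := l) (bcond (and (by fun_prop) (decEq (by fun_prop) hx')) (by fun_prop) (by fun_prop))
    (by fun_prop) hl
    ⟨U + 3, fun a l₁ l₂ h => by
      generalize hs : l₁.foldl _ (false, ([] : List β)) = s
      have h1 := hfold l₁ [] (x a) false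
      rw [hs] at h1
      have h2 : vsize s.2 ≤ vsize (l a) := by
        rw [h1]
        simp only [cond_false, List.append_nil]
        rw [(List.reverse_perm _).vsize_eq, h]
        exact (List.erase_sublist.trans (List.sublist_append_left _ _)).vsize_le
      have h3 := hU a
      have h4 := vsize_bool s.1
      have h5 : vsize s = vsize s.1 + vsize s.2 + 1 := rfl
      simp only [Polynomial.eval_add, Polynomial.eval_ofNat] at *
      omega⟩))
  convert this using 2 with a
  rw [hfold]
  simp

@[fun_prop]
theorem erase [BEq β] [LawfulBEq β] {l : α → List β} {x : α → β} (hl : PolyTime l)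
    (hx : PolyTime x) : PolyTime fun a => (l a).erase (x a) := by
  classical
  convert erase' hl hx

end

end PolyTime

/-! ### Reachability and path reversal in directed multigraphs given by lists of arcs -/

section Digraph
variable {α : Type}

/-- The number of arcs that leave the set `S`. -/
def outCount (R : List (α × α)) (S : α → Bool) : ℕ := R.countP fun e => S e.1 && !S e.2

/-- The nodes of a search tree with root `s`, given by its list of arcs. -/
def treeNodes (s : α) (T : List (α × α)) : List α := s :: T.map Prod.snd

/-- `T` lists the arcs of a tree in `R` with root `s`, every arc hanging a new node on an older
one, the most recent arc first. -/
def IsTree (s : α) (R : List (α × α)) : List (α × α) → Prop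
  | [] => True
  | e :: T => e ∈ R ∧ e.1 ∈ treeNodes s T ∧ e.2 ∉ treeNodes s T ∧ IsTree s R T

theorem mem_treeNodes_cons {s x : α} {e : α × α} {T : List (α × α)} :
    x ∈ treeNodes s (e :: T) ↔ x = e.2 ∨ x ∈ treeNodes s T := by
  simp only [treeNodes, List.map_cons, List.mem_cons]
  tauto

theorem IsTree.subset {s : α} {R T : List (α × α)} (h : IsTree s R T) : T ⊆ R := by
  induction T with
  | nil => simp
  | cons e T ih => exact List.cons_subset.2 ⟨h.1, ih h.2.2.2⟩

theorem not_mem_of_snd {s : α} {e : α × α} {T : List (α × α)} (h : e.2 ∉ treeNodes s T) :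
    e ∉ T := fun he => h (List.mem_cons_of_mem _ (List.mem_map_of_mem he))

theorem IsTree.nodup {s : α} {R T : List (α × α)} (h : IsTree s R T) : T.Nodup := by
  induction T with
  | nil => simp
  | cons e T ih => exact List.nodup_cons.2 ⟨not_mem_of_snd h.2.2.1, ih h.2.2.2⟩

theorem IsTree.subperm {s : α} {R T : List (α × α)} (h : IsTree s R T) : T.Subperm R :=
  List.subperm_of_subset h.nodup h.subset

/-- A set that contains the root and that no arc leaves contains the tree. -/
theorem treeNodes_le {s x : α} {R T : List (α × α)} (hT : IsTree s R T) (hx : x ∈ treeNodes s T)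
    {S : α → Bool} (hs : S s = true) (hS : outCount R S = 0) : S x = true := by
  have hcl : ∀ e ∈ R, S e.1 = true → S e.2 = true := by
    intro e he h1
    have := List.countP_eq_zero.1 hS e he
    simpa [h1] using this
  induction T generalizing x with
  | nil => simp [treeNodes] at hx; rwa [hx]
  | cons e T ih =>
    rcases mem_treeNodes_cons.1 hx with rfl | hx
    · exact hcl e hT.1 (ih hT.2.2.2 hT.2.1)
    · exact ih hT.2.2.2 hx

variable [DecidableEq α]

/-- Add the arc `e` to the search tree if it leads from a reached node to one not yet reached. -/
def addArc (s : α) (T : List (α × α)) (e : α × α) : List (α × α) :=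
  cond (decide (e.1 ∈ treeNodes s T) && !decide (e.2 ∈ treeNodes s T)) (e :: T) T

/-- One round of the search: try every arc. -/
def growTree (s : α) (R T : List (α × α)) : List (α × α) := R.foldl (addArc s) T

/-- A spanning tree of the part of the digraph `R` that is reachable from `s`, the most recently
added arc first. -/
def searchTree (s : α) (R : List (α × α)) : List (α × α) :=
  R.foldl (fun T _ => growTree s R T) []

/-- Walk back from `t` to the root of the search tree `T`, reversing the arcs on the way in `R`. -/
def reversePath (t : α) (R T : List (α × α)) : α × List (α × α) :=
  T.foldl (fun p e => cond (decide (e.2 = p.1)) (e.1, e.swap :: p.2.erase e) p) (t, R)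

/-- Reverse a path from `s` to `t`, if there is one, and count it. -/
def augment (s t : α) (p : List (α × α) × ℕ) : List (α × α) × ℕ :=
  cond (decide (t ∈ treeNodes s (searchTree s p.1)))
    ((reversePath t p.1 (searchTree s p.1)).2, p.2 + 1) p

/-- The residual digraph after at most `U.length` augmentations, and their number. -/
def residualArcs {β : Type} (s t : α) (R : List (α × α)) (U : List β) : List (α × α) × ℕ :=
  U.foldl (fun p _ => augment s t p) (R, 0)

/-- `R'` arises from `R` by reversing arcs. -/
def Reoriented (R R' : List (α × α)) : Prop :=
  Relation.ReflTransGen (fun R R' => ∃ e ∈ R, R' = e.swap :: R.erase e) R R'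

theorem isTree_addArc {s : α} {R T : List (α × α)} {e : α × α} (h : IsTree s R T) (he : e ∈ R) :
    IsTree s R (addArc s T e) := by
  unfold addArc
  by_cases h1 : e.1 ∈ treeNodes s T <;> by_cases h2 : e.2 ∈ treeNodes s T <;>
    simp [h1, h2, h, he, IsTree]

theorem isTree_foldl_addArc {s : α} {R T L : List (α × α)} (h : IsTree s R T) (hL : L ⊆ R) :
    IsTree s R (L.foldl (addArc s) T) := by
  induction L generalizing T with
  | nil => exact h
  | cons e L ih =>
    rw [List.cons_subset] at hL
    exact ih (isTree_addArc h hL.1) hL.2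

theorem length_le_addArc (s : α) (T : List (α × α)) (e : α × α) :
    T.length ≤ (addArc s T e).length := by
  unfold addArc
  cases (decide (e.1 ∈ treeNodes s T) && !decide (e.2 ∈ treeNodes s T)) <;> simp

theorem addArc_eq_of_length {s : α} {T : List (α × α)} {e : α × α}
    (h : (addArc s T e).length ≤ T.length) :
    addArc s T e = T ∧ (e.1 ∈ treeNodes s T → e.2 ∈ treeNodes s T) := by
  unfold addArc at *
  by_cases h1 : e.1 ∈ treeNodes s T <;> by_cases h2 : e.2 ∈ treeNodes s T <;>
    simp_all

theorem length_le_foldl_addArc (s : α) (L T : List (α × α)) :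
    T.length ≤ (L.foldl (addArc s) T).length := by
  induction L generalizing T with
  | nil => simp
  | cons e L ih => exact (length_le_addArc s T e).trans (ih _)

/-- No arc of `R` leaves the tree. -/
def Spans (s : α) (R T : List (α × α)) : Prop :=
  ∀ e ∈ R, e.1 ∈ treeNodes s T → e.2 ∈ treeNodes s T

/-- A round that adds no arc has found a spanning tree. -/
theorem spans_of_length {s : α} {L T : List (α × α)}
    (h : (L.foldl (addArc s) T).length ≤ T.length) : Spans s L T := by
  induction L generalizing T with
  | nil => intro e he; simp at he
  | cons e L ih =>
    rw [List.foldl_cons] at h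
    have h1 := length_le_foldl_addArc s L (addArc s T e)
    obtain ⟨h2, h3⟩ := addArc_eq_of_length (h1.trans h)
    rw [h2] at h
    intro e' he'
    rcases List.mem_cons.1 he' with rfl | he'
    · exact h3
    · exact ih h e' he'

theorem growTree_eq_of_spans {s : α} {R T : List (α × α)} (h : Spans s R T) :
    growTree s R T = T := by
  unfold growTree
  have key : ∀ L ⊆ R, L.foldl (addArc s) T = T := by
    intro L
    induction L with
    | nil => simp
    | cons e L ih =>
      intro hL
      rw [List.cons_subset] at hL
      have : addArc s T e = T := by
        unfold addArc
        have := h e hL.1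
        by_cases h1 : e.1 ∈ treeNodes s T <;> simp_all
      rw [List.foldl_cons, this, ih hL.2]
  exact key R (List.Subset.refl _)

theorem isTree_rounds {β : Type} (s : α) (R : List (α × α)) (L : List β) :
    IsTree s R (L.foldl (fun T _ => growTree s R T) []) := by
  have key : ∀ T, IsTree s R T → IsTree s R (L.foldl (fun T _ => growTree s R T) T) := by
    induction L with
    | nil => exact fun T h => h
    | cons x L ih => exact fun T h => ih _ (isTree_foldl_addArc h (List.Subset.refl _))
  exact key [] trivial

theorem isTree_searchTree (s : α) (R : List (α × α)) : IsTree s R (searchTree s R) :=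
  isTree_rounds s R R

theorem spans_searchTree (s : α) (R : List (α × α)) : Spans s R (searchTree s R) := by
  -- Until the tree spans, every round adds an arc, and a tree has at most as many arcs as `R`.
  have key : ∀ (L : List (α × α)) (T : List (α × α)),
      Spans s R (L.foldl (fun T _ => growTree s R T) T) ∨
      T.length + L.length ≤ (L.foldl (fun T _ => growTree s R T) T).length := by
    intro L
    induction L with
    | nil => intro T; right; simp
    | cons x L ih =>
      intro T
      rw [List.foldl_cons]
      rcases ih (growTree s R T) with h | h
      · exact .inl h
      · by_cases hT : (growTree s R T).length ≤ T.length
        · left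
          have hs := spans_of_length hT
          have hfix : ∀ L : List (α × α), L.foldl (fun T _ => growTree s R T) T = T := by
            intro L
            induction L with
            | nil => rfl
            | cons y L ih => rw [List.foldl_cons, growTree_eq_of_spans hs, ih]
          rw [growTree_eq_of_spans hs, hfix]
          exact hs
        · right
          simp only [List.length_cons]
          omega
  rcases key R [] with h | h
  · exact h
  · apply spans_of_length
    have h1 := isTree_foldl_addArc (isTree_searchTree s R) (List.Subset.refl R)
    have h2 := h1.subperm.length_le
    simp only [List.length_nil, zero_add] at h
    exact h2.trans h

theorem outCount_treeNodes {s : α} {R T : List (α × α)} (h : Spans s R T) :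
    outCount R (fun x => decide (x ∈ treeNodes s T)) = 0 := by
  rw [outCount, List.countP_eq_zero]
  intro e he
  have := h e he
  by_cases h1 : e.1 ∈ treeNodes s T <;> simp_all

/-- Reversing an arc from `x` to `y` changes the number of arcs leaving `S` by `[y ∈ S] - [x ∈ S]`. -/
theorem outCount_reverse {R : List (α × α)} {e : α × α} (he : e ∈ R) (S : α → Bool) :
    outCount (e.swap :: R.erase e) S + (S e.1).toNat = outCount R S + (S e.2).toNat := by
  have := (List.perm_cons_erase he).countP_eq fun e => S e.1 && !S e.2
  unfold outCount
  rw [this, List.countP_cons, List.countP_cons]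
  simp only [Prod.fst_swap, Prod.snd_swap]
  by_cases h1 : S e.1 = true <;> by_cases h2 : S e.2 = true <;> simp [h1, h2]

/-- Reversing a path from `s` to `t` changes the number of arcs leaving `S` by `[t ∈ S] - [s ∈ S]`. -/
theorem reversePath_aux {s t : α} {R R' R₀ T : List (α × α)} (hT : IsTree s R T) (ht : t ∈ treeNodes s T)
    (hsub : T ⊆ R') (h : Reoriented R₀ R') :
    Reoriented R₀ (reversePath t R' T).2 ∧ ∀ S : α → Bool,
      outCount (reversePath t R' T).2 S + (S s).toNat = outCount R' S + (S t).toNat := by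
  induction T generalizing t R' with
  | nil =>
    simp only [treeNodes, List.map_nil, List.mem_singleton] at ht
    subst ht
    exact ⟨h, fun S => rfl⟩
  | cons e T ih =>
    rw [List.cons_subset] at hsub
    unfold reversePath at *
    rw [List.foldl_cons]
    by_cases he : e.2 = t
    · subst he
      simp only [decide_true, cond_true]
      have := ih hT.2.2.2 hT.2.1 (R' := e.swap :: R'.erase e) (by
        intro x hx
        have hne : x ≠ e := by
          rintro rfl
          exact not_mem_of_snd hT.2.2.1 hx
        exact List.mem_cons_of_mem _ ((List.mem_erase_of_ne hne).2 (hsub.2 hx)))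
        (h.tail ⟨e, hsub.1, rfl⟩)
      refine ⟨this.1, fun S => ?_⟩
      rw [this.2 S, outCount_reverse hsub.1]
    · simp only [he, decide_false, cond_false]
      refine ih hT.2.2.2 ?_ hsub.2 h
      rcases mem_treeNodes_cons.1 ht with h | h
      · exact absurd h.symm he
      · exact h

theorem augment_spec {s t : α} {R₀ : List (α × α)} {p : List (α × α) × ℕ} (h : Reoriented R₀ p.1)
    (hcut : ∀ S : α → Bool, outCount p.1 S + p.2 * (S s).toNat = outCount R₀ S + p.2 * (S t).toNat) :
    Reoriented R₀ (augment s t p).1 ∧ ∀ S : α → Bool,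
      outCount (augment s t p).1 S + (augment s t p).2 * (S s).toNat
        = outCount R₀ S + (augment s t p).2 * (S t).toNat := by
  unfold augment
  by_cases ht : t ∈ treeNodes s (searchTree s p.1)
  · have hT := isTree_searchTree s p.1
    have := reversePath_aux hT ht hT.subset h
    simp only [ht, decide_true, cond_true]
    refine ⟨this.1, fun S => ?_⟩
    have h1 := this.2 S
    have h2 := hcut S
    rw [add_mul, add_mul]
    omega
  · simp only [ht, decide_false, cond_false]
    exact ⟨h, hcut⟩

/-- Every augmentation lowers the size of the cuts that separate `s` from `t` by one. -/
theorem residualArcs_spec {β : Type} (s t : α) (R : List (α × α)) (U : List β) :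
    Reoriented R (residualArcs s t R U).1 ∧ ∀ S : α → Bool,
      outCount (residualArcs s t R U).1 S + (residualArcs s t R U).2 * (S s).toNat
        = outCount R S + (residualArcs s t R U).2 * (S t).toNat := by
  unfold residualArcs
  have key : ∀ p : List (α × α) × ℕ, (Reoriented R p.1 ∧ ∀ S : α → Bool,
      outCount p.1 S + p.2 * (S s).toNat = outCount R S + p.2 * (S t).toNat) →
      Reoriented R (U.foldl (fun p _ => augment s t p) p).1 ∧ ∀ S : α → Bool,
      outCount (U.foldl (fun p _ => augment s t p) p).1 S
        + (U.foldl (fun p _ => augment s t p) p).2 * (S s).toNat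
        = outCount R S + (U.foldl (fun p _ => augment s t p) p).2 * (S t).toNat := by
    induction U with
    | nil => exact fun p hp => hp
    | cons x U ih => exact fun p hp => ih _ (augment_spec hp.1 hp.2)
  exact key (R, 0) ⟨.refl, by simp⟩

/-- Either the augmentations got stuck, or each of the rounds found a path. -/
theorem residualArcs_stuck_or {β : Type} (s t : α) (R : List (α × α)) (U : List β) :
    t ∉ treeNodes s (searchTree s (residualArcs s t R U).1) ∨ (residualArcs s t R U).2 = U.length := by
  unfold residualArcs
  have hfix : ∀ (L : List β) (p : List (α × α) × ℕ), t ∉ treeNodes s (searchTree s p.1) →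
      L.foldl (fun p _ => augment s t p) p = p := by
    intro L p hp
    induction L with
    | nil => rfl
    | cons x L ih =>
      have : augment s t p = p := by simp [augment, hp]
      rw [List.foldl_cons, this, ih]
  have key : ∀ p : List (α × α) × ℕ,
      t ∉ treeNodes s (searchTree s (U.foldl (fun p _ => augment s t p) p).1) ∨
      (U.foldl (fun p _ => augment s t p) p).2 = p.2 + U.length := by
    induction U with
    | nil => intro p; right; simp
    | cons x U ih =>
      intro p
      by_cases hp : t ∈ treeNodes s (searchTree s p.1)
      · rw [List.foldl_cons]
        refine (ih _).imp_right fun h => ?_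
        rw [h]
        simp [augment, hp]
        omega
      · left
        rw [hfix _ _ hp]
        exact hp
  simpa using key (R, 0)

/-- The set of nodes reachable from `s` in the residual digraph. -/
def minCut {β : Type} (s t : α) (R : List (α × α)) (U : List β) : List α :=
  treeNodes s (searchTree s (residualArcs s t R U).1)

/-- If the number of rounds suffices, the nodes reachable in the residual digraph form a minimum
cut, it is contained in every other one, and its size is the number of augmentations. -/
theorem minCut_spec {β : Type} {s t : α} {R : List (α × α)} {U : List β} {S₁ : α → Bool}
    (hs₁ : S₁ s = true) (ht₁ : S₁ t = false) (hU : outCount R S₁ < U.length) :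
    s ∈ minCut s t R U ∧ t ∉ minCut s t R U ∧
    outCount R (fun x => decide (x ∈ minCut s t R U)) = (residualArcs s t R U).2 ∧
    ∀ S : α → Bool, S s = true → S t = false → (residualArcs s t R U).2 ≤ outCount R S ∧
      (outCount R S = (residualArcs s t R U).2 → ∀ x ∈ minCut s t R U, S x = true) := by
  have hcut := (residualArcs_spec s t R U).2
  have hval : ∀ S : α → Bool, S s = true → S t = false →
      outCount (residualArcs s t R U).1 S + (residualArcs s t R U).2 = outCount R S := by
    intro S hs ht
    simpa [hs, ht] using hcut S
  have ht : t ∉ minCut s t R U := by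
    rcases residualArcs_stuck_or s t R U with h | h
    · exact h
    · have := hval S₁ hs₁ ht₁
      omega
  refine ⟨List.mem_cons_self, ht, ?_, fun S hs ht => ⟨?_, fun h x hx => ?_⟩⟩
  · have h1 := hval (fun x => decide (x ∈ minCut s t R U)) (by simp [minCut, treeNodes]) (by simpa using ht)
    have h2 := outCount_treeNodes (spans_searchTree s (residualArcs s t R U).1)
    rw [← h1]
    change outCount _ (fun x => decide (x ∈ treeNodes s (searchTree s (residualArcs s t R U).1))) + _ = _ at h1
    unfold minCut
    omega
  · have := hval S hs ht
    omega
  · have := hval S hs ht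
    exact treeNodes_le (isTree_searchTree s _) hx hs (by omega)

end Digraph

/-! ### Max-flow min-cut for undirected multigraphs with node capacities -/

section MaxFlowMinCut

/-- Replacing `A` and `B`, with `s ∈ A`, by `(A ∩ B) ∪ {s} ⊆ B ∪ {s}` does not increase the
contribution of an edge to the cut. -/
theorem toNat_shrink_edge {V : Type} [DecidableEq V] {A B : V → Bool} {s : V} (hs : A s = true)
    (x y : V) : (((A x && B x) || decide (x = s)) && !(B y || decide (y = s))).toNat
      ≤ (A x && !B y).toNat := by
  by_cases hx : x = s
  · subst hx
    cases hB : B y <;> simp [hs, Bool.toNat_le]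
  · cases hA : A x <;> cases hB : B y <;> simp [hx, Bool.toNat_le]

/-- The same replacement does not increase the contribution of a node. -/
theorem toNat_shrink_node {V : Type} [DecidableEq V] {A B : V → Bool} {s : V} (hs : A s = true)
    (w : V) : ((B w || decide (w = s)) && !((A w && B w) || decide (w = s))).toNat
      ≤ (B w && !A w).toNat := by
  by_cases hw : w = s
  · subst hw
    simp
  · cases hA : A w <;> cases hB : B w <;> simp [hw]

variable {V ι : Type} [Fintype ι]

/-- The capacity of the biset `(A, B)`: the number of edges between `A` and the complement of `B`
plus the capacity of the nodes in `B \ A`. -/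
def bisetCut [Fintype V] (ends : ι → V × V) (q : V → ℕ) (A B : V → Bool) : ℕ :=
  ∑ e, ((A (ends e).1 && !B (ends e).2).toNat + (A (ends e).2 && !B (ends e).1).toNat) +
    ∑ w, (B w && !A w).toNat * q w

/-- The arcs of the auxiliary digraph: a node `w` becomes an arc from `(w, false)` to `(w, true)`,
taken `q w` times, and an edge becomes two arcs from a copy `true` to a copy `false`. -/
def splitArc (ends : ι → V × V) (q : V → ℕ) :
    (ι × Bool) ⊕ ((w : V) × Fin (q w)) → (V × Bool) × (V × Bool)
  | .inl (e, false) => (((ends e).1, true), ((ends e).2, false))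
  | .inl (e, true) => (((ends e).2, true), ((ends e).1, false))
  | .inr j => ((j.1, false), (j.1, true))

theorem outCount_map_univ {κ α : Type} [Fintype κ] (h : κ → α × α) (S : α → Bool) :
    outCount (Finset.univ.toList.map h) S = ∑ i, (S (h i).1 && !S (h i).2).toNat := by
  rw [outCount, List.countP_map, List.countP_eq_length_filter]
  rw [← Finset.sum_map_toList]
  generalize (Finset.univ : Finset κ).toList = l
  induction l with
  | nil => rfl
  | cons i l ih =>
    simp only [List.filter_cons, List.map_cons, List.sum_cons, ← ih, Function.comp]
    by_cases hS : (S (h i).1 && !S (h i).2) = true <;> simp [hS, add_comm]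

/-- A reorientation of an indexed family of arcs is given by the set `X` of the reversed ones. -/
theorem Reoriented.exists_flags {κ α : Type} [Fintype κ] [DecidableEq α] {h : κ → α × α}
    {R : List (α × α)} (hR : Reoriented (Finset.univ.toList.map h) R) :
    ∃ X : κ → Bool, R.Perm (Finset.univ.toList.map fun i => cond (X i) (h i).swap (h i)) := by
  classical
  induction hR with
  | refl => exact ⟨fun _ => false, .refl _⟩
  | tail _ hstep ih =>
    obtain ⟨X, hX⟩ := ih
    obtain ⟨e, he, rfl⟩ := hstep
    obtain ⟨i, hi, hie⟩ := List.mem_map.1 (hX.subset he)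
    refine ⟨Function.update X i (!X i), ?_⟩
    have hl := List.perm_cons_erase hi
    have h1 := (hX.erase e).trans ((hl.map fun i => cond (X i) (h i).swap (h i)).erase e)
    rw [List.map_cons, hie, List.erase_cons_head] at h1
    refine List.Perm.trans ?_ (hl.map _).symm
    rw [List.map_cons]
    have h2 : (cond (Function.update X i (!X i) i) (h i).swap (h i)) = e.swap := by
      rw [← hie, Function.update_self]
      cases X i <;> simp
    rw [h2]
    refine List.Perm.cons _ (h1.trans (List.Perm.of_eq (List.map_congr_left fun j hj => ?_)))
    have hne : j ≠ i := by
      rintro rfl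
      exact (Finset.nodup_toList _).not_mem_erase hj
    rw [Function.update_of_ne hne]

theorem outCount_splitArc [Fintype V] (ends : ι → V × V) (q : V → ℕ) (S : V × Bool → Bool) :
    outCount (Finset.univ.toList.map (splitArc ends q)) S
      = bisetCut ends q (fun w => S (w, true)) (fun w => S (w, false)) := by
  rw [outCount_map_univ, Fintype.sum_sum_type, Fintype.sum_prod_type, Fintype.sum_sigma]
  simp [splitArc, bisetCut, mul_comm, add_comm]

variable [DecidableEq V]

theorem sum_outflow [Fintype V] (ends : ι → V × V) (f g : ι → ℕ) (A : V → Bool) :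
    ∑ w, (A w).toNat * outflow ends f g w
      = ∑ e, ((A (ends e).1).toNat * f e + (A (ends e).2).toNat * g e) := by
  simp only [outflow, Finset.mul_sum]
  rw [Finset.sum_comm]
  refine Finset.sum_congr rfl fun e _ => ?_
  simp [mul_add, Finset.sum_add_distrib]

theorem sum_inflow [Fintype V] (ends : ι → V × V) (f g : ι → ℕ) (A : V → Bool) :
    ∑ w, (A w).toNat * inflow ends f g w
      = ∑ e, ((A (ends e).2).toNat * f e + (A (ends e).1).toNat * g e) := by
  simp only [inflow, Finset.mul_sum]
  rw [Finset.sum_comm]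
  refine Finset.sum_congr rfl fun e _ => ?_
  simp [mul_add, Finset.sum_add_distrib]

/-- Weak duality: the net flow out of `A` crosses the edges between `A` and the complement of `B` or
enters `B \ A`. -/
theorem flow_value_le_bisetCut [Fintype V] {ends : ι → V × V} {q : V → ℕ} {s t : V} {f g : ι → ℕ}
    {m : ℕ} (hf : IsFlow ends q s t f g) (hm : outflow ends f g s = inflow ends f g s + m)
    {A B : V → Bool} (hAB : ∀ w, A w = true → B w = true) (hs : A s = true) (ht : B t = false) :
    m ≤ bisetCut ends q A B := by
  have hAt : A t = false := by
    by_contra h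
    simp [hAB t (by simpa using h)] at ht
  have h1 : ∑ w, (A w).toNat * outflow ends f g w
      = ∑ w, (A w).toNat * inflow ends f g w + m := by
    rw [← Finset.add_sum_erase _ _ (Finset.mem_univ s), ← Finset.add_sum_erase _ _ (Finset.mem_univ s),
      hm, hs]
    have : ∑ w ∈ Finset.univ.erase s, (A w).toNat * outflow ends f g w
        = ∑ w ∈ Finset.univ.erase s, (A w).toNat * inflow ends f g w := by
      refine Finset.sum_congr rfl fun w hw => ?_
      by_cases hwt : w = t
      · subst hwt; simp [hAt]
      · rw [hf.conserve w (Finset.ne_of_mem_erase hw) hwt]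
    rw [this]
    simp
    omega
  -- The flow through `B \ A` is bounded by the node capacities.
  have h2 : ∑ w, (B w && !A w).toNat * inflow ends f g w ≤ ∑ w, (B w && !A w).toNat * q w := by
    refine Finset.sum_le_sum fun w _ => ?_
    by_cases hw : B w = true ∧ A w = false
    · have hws : w ≠ s := by rintro rfl; simp [hs] at hw
      have hwt : w ≠ t := by rintro rfl; simp [ht] at hw
      exact Nat.mul_le_mul_left _ (hf.node_cap w hws hwt)
    · have : (B w && !A w) = false := by
        cases hB : B w <;> cases hA : A w <;> simp_all
      simp [this]
  rw [sum_outflow, sum_inflow] at h1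
  rw [sum_inflow (A := fun w => B w && !A w)] at h2
  -- Flow that leaves `A` along an edge ends in `A`, in `B \ A`, or crosses the cut.
  have h3 : ∑ e, ((A (ends e).1).toNat * f e + (A (ends e).2).toNat * g e) ≤
      ∑ e, (((A (ends e).2).toNat * f e + (A (ends e).1).toNat * g e) +
        ((B (ends e).2 && !A (ends e).2).toNat * f e + (B (ends e).1 && !A (ends e).1).toNat * g e) +
        ((A (ends e).1 && !B (ends e).2).toNat + (A (ends e).2 && !B (ends e).1).toNat)) := by
    refine Finset.sum_le_sum fun e _ => ?_
    have hc := hf.edge_cap e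
    have hx := hAB (ends e).1
    have hy := hAB (ends e).2
    cases hA1 : A (ends e).1 <;> cases hA2 : A (ends e).2 <;> cases hB1 : B (ends e).1 <;>
      cases hB2 : B (ends e).2 <;> simp_all <;> omega
  unfold bisetCut
  simp only [Finset.sum_add_distrib] at h1 h2 h3 ⊢
  omega

theorem bddAbove_flow_values [Fintype V] (ends : ι → V × V) (q : V → ℕ) {s t : V} (hst : s ≠ t) :
    BddAbove {m : ℕ | ∃ f g : ι → ℕ, IsFlow ends q s t f g ∧
      outflow ends f g s = inflow ends f g s + m} :=
  ⟨bisetCut ends q (fun w => decide (w = s)) (fun w => decide (w = s)),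
    fun _ ⟨_, _, hf, hm⟩ => flow_value_le_bisetCut hf hm (fun _ h => h) (by simp) (by simpa using hst.symm)⟩

/-- Strong duality: augment `r` times in the digraph with split nodes; the reversed arcs carry the flow. -/
theorem exists_flow_of_le_bisetCut [Fintype V] {ends : ι → V × V} {q : V → ℕ} {s t : V} (hst : s ≠ t)
    {r : ℕ} (h : ∀ A B : V → Bool, (∀ w, A w = true → B w = true) → A s = true → B t = false →
      r ≤ bisetCut ends q A B) :
    ∃ c, r ≤ c ∧ ∃ f g : ι → ℕ, IsFlow ends q s t f g ∧
      outflow ends f g s = inflow ends f g s + c := by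
  set R₀ := Finset.univ.toList.map (splitArc ends q) with hR₀
  set p := residualArcs (s, true) (t, false) R₀ (List.replicate r ()) with hp
  obtain ⟨hre, hcut⟩ := residualArcs_spec (s, true) (t, false) R₀ (List.replicate r ())
  rw [← hp] at hre hcut
  refine ⟨p.2, ?_, ?_⟩
  · rcases residualArcs_stuck_or (s, true) (t, false) R₀ (List.replicate r ()) with hst' | hst'
    · rw [← hp] at hst'
      have h1 := outCount_treeNodes (spans_searchTree (s, true) p.1)
      obtain ⟨S, hS, hmem⟩ : ∃ S : V × Bool → Bool, outCount p.1 S = 0 ∧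
          ∀ x, S x = true ↔ x ∈ treeNodes (s, true) (searchTree (s, true) p.1) :=
        ⟨_, h1, fun x => by simp⟩
      have hA : S (s, true) = true := (hmem _).2 List.mem_cons_self
      have hB : S (t, false) = false := by
        rw [← hmem] at hst'
        simpa using hst'
      have h2 := hcut S
      rw [hS, hA, hB, outCount_splitArc] at h2
      simp only [Bool.toNat_true, mul_one, zero_add, Bool.toNat_false, mul_zero, add_zero] at h2
      rw [h2]
      -- The cut need not be a biset, but removing copies of nodes turns it into a smaller one.
      generalize hAd : (fun w => S (w, true)) = A
      generalize hBd : (fun w => S (w, false)) = B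
      replace hA : A s = true := by rw [← hAd]; exact hA
      replace hB : B t = false := by rw [← hBd]; exact hB
      refine (h (fun w => (A w && B w) || decide (w = s)) (fun w => B w || decide (w = s)) ?_ (by simp)
        (by simpa [hB] using hst.symm)).trans ?_
      · intro w hw
        cases hBw : B w <;> simp_all
      · unfold bisetCut
        gcongr ∑ e, (?_ + ?_) + ∑ w, ?_ * q w with e _ w _
        · exact toNat_shrink_edge hA _ _
        · exact toNat_shrink_edge hA _ _
        · exact toNat_shrink_node hA _
    · rw [hp, hst']; simp
  · obtain ⟨X, hX⟩ := hre.exists_flags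
    -- The cut formula for a single node `z` says that the reversed arcs form a flow.
    have hdiv : ∀ z : V × Bool,
        ∑ i, (if X i then if (splitArc ends q i).2 = z then 1 else 0 else 0) +
            p.2 * (decide ((s, true) = z)).toNat
          = ∑ i, (if X i then if (splitArc ends q i).1 = z then 1 else 0 else 0) +
            p.2 * (decide ((t, false) = z)).toNat := by
      intro z
      have h1 := hcut fun x => decide (x = z)
      have h2 : outCount p.1 (fun x => decide (x = z))
          = ∑ i, ((if X i then if (splitArc ends q i).2 = z then 1 else 0 else 0) +
            (if X i then 0 else if (splitArc ends q i).1 = z then 1 else 0)) := by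
        rw [outCount, hX.countP_eq]
        refine (outCount_map_univ (fun i => cond (X i) (splitArc ends q i).swap (splitArc ends q i))
          (fun x => decide (x = z))).trans ?_
        refine Finset.sum_congr rfl fun i _ => ?_
        have hne : (splitArc ends q i).1 ≠ (splitArc ends q i).2 := by
          rcases i with ⟨e, b⟩ | j
          · cases b <;> simp [splitArc]
          · simp [splitArc]
        cases X i
        · by_cases h3 : (splitArc ends q i).1 = z
          · have : (splitArc ends q i).2 ≠ z := by rintro rfl; exact hne h3
            simp [h3, this]
          · simp [h3]
        · by_cases h3 : (splitArc ends q i).2 = z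
          · have : (splitArc ends q i).1 ≠ z := by rintro rfl; exact hne h3.symm
            simp [h3, this]
          · simp [h3]
      have h3 : outCount R₀ (fun x => decide (x = z))
          = ∑ i, ((if X i then if (splitArc ends q i).1 = z then 1 else 0 else 0) +
            (if X i then 0 else if (splitArc ends q i).1 = z then 1 else 0)) := by
        rw [outCount_map_univ]
        refine Finset.sum_congr rfl fun i _ => ?_
        have hne : (splitArc ends q i).1 ≠ (splitArc ends q i).2 := by
          rcases i with ⟨e, b⟩ | j
          · cases b <;> simp [splitArc]
          · simp [splitArc]
        by_cases h3 : (splitArc ends q i).1 = z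
        · have : (splitArc ends q i).2 ≠ z := by rintro rfl; exact hne h3
          cases X i <;> simp [h3, this]
        · cases X i <;> simp [h3]
      rw [h2, h3, Finset.sum_add_distrib, Finset.sum_add_distrib] at h1
      omega
    set φ : ι → Bool := fun e => X (.inl (e, false)) with hφ
    set γ : ι → Bool := fun e => X (.inl (e, true)) with hγ
    -- `thr w` is the flow through the arcs that represent the node `w`.
    set thr : V → ℕ := fun w => ∑ j : Fin (q w), (if X (.inr ⟨w, j⟩) then 1 else 0) with hthr
    have hthr_le : ∀ w, thr w ≤ q w := by
      intro w
      calc thr w ≤ ∑ j : Fin (q w), 1 := Finset.sum_le_sum fun j _ => by split_ifs <;> simp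
        _ = q w := by simp
    have hnode : ∀ w : V, ∑ w' : V, ∑ j : Fin (q w'), (if X (.inr ⟨w', j⟩) then
        if w' = w then 1 else 0 else 0) = thr w := by
      intro w
      rw [Finset.sum_eq_single w]
      · simp [hthr]
      · intro w' _ hne; simp [hne]
      · simp
    have hin : ∀ w, inflow ends (fun e => (φ e).toNat) (fun e => (γ e).toNat) w
        = thr w + p.2 * (decide (t = w)).toNat := by
      intro w
      have h1 := hdiv (w, false)
      rw [Fintype.sum_sum_type, Fintype.sum_prod_type, Fintype.sum_sigma, Fintype.sum_sum_type,
        Fintype.sum_prod_type, Fintype.sum_sigma] at h1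
      simp only [splitArc, Fintype.sum_bool, Prod.mk.injEq, and_true, hnode, reduceCtorEq, and_false,
        if_false, ite_self, Finset.sum_const_zero, zero_add, add_zero, decide_false, Bool.toNat_false,
        mul_zero] at h1
      rw [← h1, inflow]
      refine Finset.sum_congr rfl fun e _ => ?_
      simp only [hφ, hγ]
      cases X (.inl (e, false)) <;> cases X (.inl (e, true)) <;> simp [add_comm]
    have hout : ∀ w, outflow ends (fun e => (φ e).toNat) (fun e => (γ e).toNat) w
        = thr w + p.2 * (decide (s = w)).toNat := by
      intro w
      have h1 := hdiv (w, true)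
      rw [Fintype.sum_sum_type, Fintype.sum_prod_type, Fintype.sum_sigma, Fintype.sum_sum_type,
        Fintype.sum_prod_type, Fintype.sum_sigma] at h1
      simp only [splitArc, Fintype.sum_bool, Prod.mk.injEq, and_true, hnode, reduceCtorEq, and_false,
        if_false, ite_self, Finset.sum_const_zero, zero_add, add_zero, decide_false, Bool.toNat_false,
        mul_zero] at h1
      rw [h1, outflow]
      refine Finset.sum_congr rfl fun e _ => ?_
      simp only [hφ, hγ]
      cases X (.inl (e, false)) <;> cases X (.inl (e, true)) <;> simp [add_comm]
    -- Opposite flows along an edge are cancelled.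
    set f : ι → ℕ := fun e => (φ e && !γ e).toNat with hf
    set g : ι → ℕ := fun e => (γ e && !φ e).toNat with hg
    have hcancel : ∀ w, ∃ d, inflow ends (fun e => (φ e).toNat) (fun e => (γ e).toNat) w
          = inflow ends f g w + d ∧
        outflow ends (fun e => (φ e).toNat) (fun e => (γ e).toNat) w = outflow ends f g w + d := by
      intro w
      refine ⟨∑ e, ((if (ends e).1 = w then (φ e && γ e).toNat else 0) +
        (if (ends e).2 = w then (φ e && γ e).toNat else 0)), ?_, ?_⟩
      · rw [inflow, inflow, ← Finset.sum_add_distrib]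
        refine Finset.sum_congr rfl fun e _ => ?_
        simp only [hf, hg]
        cases φ e <;> cases γ e <;> simp [add_comm]
      · rw [outflow, outflow, ← Finset.sum_add_distrib]
        refine Finset.sum_congr rfl fun e _ => ?_
        simp only [hf, hg]
        cases φ e <;> cases γ e <;> simp
    refine ⟨f, g, ⟨fun e => ?_, fun w hs ht => ?_, fun w hs ht => ?_⟩, ?_⟩
    · simp only [hf, hg]
      cases φ e <;> cases γ e <;> simp
    · obtain ⟨d, h1, h2⟩ := hcancel w
      rw [hin] at h1
      rw [hout] at h2
      simp only [hs.symm, ht.symm, decide_false, Bool.toNat_false, mul_zero] at h1 h2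
      omega
    · obtain ⟨d, h1, h2⟩ := hcancel w
      rw [hin] at h1
      simp only [ht.symm, decide_false, Bool.toNat_false, mul_zero] at h1
      have := hthr_le w
      omega
    · obtain ⟨d, h1, h2⟩ := hcancel s
      rw [hin] at h1
      rw [hout] at h2
      simp only [hst.symm, decide_false, decide_true, Bool.toNat_false, Bool.toNat_true, mul_zero,
        mul_one] at h1 h2
      omega

/-- Max-flow min-cut. -/
theorem le_qConnectivity_iff [Fintype V] (ends : ι → V × V) (q : V → ℕ) {s t : V} (hst : s ≠ t)
    (r : ℕ) : r ≤ qConnectivity ends q s t ↔ ∀ A B : V → Bool, (∀ w, A w = true → B w = true) →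
      A s = true → B t = false → r ≤ bisetCut ends q A B := by
  constructor
  · intro h A B hAB hs ht
    have hne : {m : ℕ | ∃ f g : ι → ℕ, IsFlow ends q s t f g ∧
        outflow ends f g s = inflow ends f g s + m}.Nonempty :=
      ⟨0, fun _ => 0, fun _ => 0, ⟨by simp, by simp [inflow, outflow], by simp [inflow]⟩,
        by simp [inflow, outflow]⟩
    obtain ⟨f, g, hf, hm⟩ := Nat.sSup_mem hne (bddAbove_flow_values ends q hst)
    exact h.trans (flow_value_le_bisetCut hf hm hAB hs ht)
  · intro h
    obtain ⟨c, hc, hflow⟩ := exists_flow_of_le_bisetCut hst h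
    exact hc.trans (le_csSup (bddAbove_flow_values ends q hst) hflow)

end MaxFlowMinCut

/-! ### Cuts of bisets and uncrossing -/

/-- The capacity of the biset `(A, B)` in the multigraph with edge list `E`, where the capacity of
a node is its multiplicity in `N`. -/
def cutVal (E : List (ℕ × ℕ)) (N : List ℕ) (A B : ℕ → Bool) : ℕ :=
  E.countP (fun e => A e.1 && !B e.2) + E.countP (fun e => A e.2 && !B e.1) +
    N.countP (fun w => B w && !A w)

theorem countP_add_countP_le {α : Type} {p₁ p₂ p₃ p₄ : α → Bool} (l : List α)
    (h : ∀ x, (p₁ x).toNat + (p₂ x).toNat ≤ (p₃ x).toNat + (p₄ x).toNat) :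
    l.countP p₁ + l.countP p₂ ≤ l.countP p₃ + l.countP p₄ := by
  induction l with
  | nil => simp
  | cons x l ih =>
    have key : ∀ p : α → Bool, (x :: l).countP p = l.countP p + (p x).toNat := by
      intro p
      rw [List.countP_cons]
      by_cases hp : p x = true <;> simp [hp]
    simp only [key]
    have := h x
    omega

/-- The capacity of bisets is submodular. -/
theorem cutVal_inter_add_cutVal_union_le (E : List (ℕ × ℕ)) (N : List ℕ) (A B A' B' : ℕ → Bool) :
    cutVal E N (fun x => A x && A' x) (fun x => B x && B' x) +
      cutVal E N (fun x => A x || A' x) (fun x => B x || B' x) ≤ cutVal E N A B + cutVal E N A' B' := by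
  unfold cutVal
  have h1 := countP_add_countP_le E (p₁ := fun e => (A e.1 && A' e.1) && !(B e.2 && B' e.2))
    (p₂ := fun e => (A e.1 || A' e.1) && !(B e.2 || B' e.2)) (p₃ := fun e => A e.1 && !B e.2)
    (p₄ := fun e => A' e.1 && !B' e.2) (fun e => by
      cases A e.1 <;> cases A' e.1 <;> cases B e.2 <;> cases B' e.2 <;> simp)
  have h2 := countP_add_countP_le E (p₁ := fun e => (A e.2 && A' e.2) && !(B e.1 && B' e.1))
    (p₂ := fun e => (A e.2 || A' e.2) && !(B e.1 || B' e.1)) (p₃ := fun e => A e.2 && !B e.1)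
    (p₄ := fun e => A' e.2 && !B' e.1) (fun e => by
      cases A e.2 <;> cases A' e.2 <;> cases B e.1 <;> cases B' e.1 <;> simp)
  have h3 := countP_add_countP_le N (p₁ := fun w => (B w && B' w) && !(A w && A' w))
    (p₂ := fun w => (B w || B' w) && !(A w || A' w)) (p₃ := fun w => B w && !A w)
    (p₄ := fun w => B' w && !A' w) (fun w => by
      cases A w <;> cases A' w <;> cases B w <;> cases B' w <;> simp)
  beta_reduce
  omega

/-- The capacity is symmetric under passing to complements. -/
theorem cutVal_compl (E : List (ℕ × ℕ)) (N : List ℕ) (A B : ℕ → Bool) :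
    cutVal E N (fun x => !B x) (fun x => !A x) = cutVal E N A B := by
  unfold cutVal
  rw [Nat.add_comm (E.countP fun e => !B e.1 && !!A e.2)]
  simp only [Bool.not_not, Bool.and_comm]

theorem cutVal_diff_add_cutVal_diff_le (E : List (ℕ × ℕ)) (N : List ℕ) (A B A' B' : ℕ → Bool) :
    cutVal E N (fun x => A x && !B' x) (fun x => B x && !A' x) +
      cutVal E N (fun x => A' x && !B x) (fun x => B' x && !A x)
      ≤ cutVal E N A B + cutVal E N A' B' := by
  have h := cutVal_inter_add_cutVal_union_le E N A B (fun x => !B' x) (fun x => !A' x)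
  rw [cutVal_compl E N A' B'] at h
  rw [← cutVal_compl E N (fun x => A' x && !B x)]
  simpa only [Bool.not_and, Bool.not_not, Bool.or_comm] using h

theorem cutVal_append (E E' : List (ℕ × ℕ)) (N : List ℕ) (A B : ℕ → Bool) :
    cutVal (E ++ E') N A B = cutVal E N A B + cutVal E' [] A B := by
  simp only [cutVal, List.countP_append, List.countP_nil]
  omega

/-- `u` and `v` are the ends, in either order, of a demand edge with requirement `r`. -/
def Demand (D : List (ℕ × ℕ × ℕ)) (u v r : ℕ) : Prop := (u, v, r) ∈ D ∨ (v, u, r) ∈ D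

theorem Demand.symm {D : List (ℕ × ℕ × ℕ)} {u v r : ℕ} (h : Demand D u v r) : Demand D v u r :=
  Or.symm h

/-- Every demand is satisfied after lowering all requirements by `s`. -/
def Satisfied (E : List (ℕ × ℕ)) (N : List ℕ) (D : List (ℕ × ℕ × ℕ)) (s : ℕ) : Prop :=
  ∀ u v r, Demand D u v r → ∀ A B : ℕ → Bool, (∀ x, A x = true → B x = true) → A u = true →
    B v = false → r ≤ cutVal E N A B + s

/-- The biset `(A, B)` separates the demand `(u, v, r)`, misses its requirement, lowered by `s`,
by one, and does not contain the center `a`. -/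
structure Tight (E : List (ℕ × ℕ)) (N : List ℕ) (D : List (ℕ × ℕ × ℕ)) (a s : ℕ)
    (A B : ℕ → Bool) (u v r : ℕ) : Prop where
  demand : Demand D u v r
  sub : ∀ x, A x = true → B x = true
  left : A u = true
  right : B v = false
  center : B a = false
  cut : cutVal E N A B + s + 1 = r

/-- No tight biset has an inner part that is properly contained in `A`. -/
def MinimalInner (E : List (ℕ × ℕ)) (N : List ℕ) (D : List (ℕ × ℕ × ℕ)) (a s : ℕ)
    (A : ℕ → Bool) : Prop :=
  ∀ X Y u v r, Tight E N D a s X Y u v r → (∀ x, X x = true → A x = true) →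
    ∀ x, A x = true → X x = true

section Uncrossing

variable {E : List (ℕ × ℕ)} {N : List ℕ} {D : List (ℕ × ℕ × ℕ)} {a s : ℕ}
  {A B A' B' : ℕ → Bool} {u v r u' v' r' z : ℕ}

/-- If two minimal tight bisets intersect, and no end of the demand of one of them lies in the
boundary of the other one, then `u ∉ A'`. -/
theorem Tight.not_inner_of_disjoint_boundary (hlow : Satisfied E N D (s + 1))
    (t : Tight E N D a s A B u v r) (t' : Tight E N D a s A' B' u' v' r')
    (m : MinimalInner E N D a s A) (hz : A z = true) (hz' : A' z = true)
    (hne : ¬ ∀ x, A x = true → A' x = true)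
    (h₂ : B' v = true → A' v = true) (h₃ : B u' = true → A u' = true)
    (h₄ : B v' = true → A v' = true) (hu : A' u = true) : False := by
  have hsub := cutVal_inter_add_cutVal_union_le E N A B A' B'
  have hdiff := cutVal_diff_add_cutVal_diff_le E N A B A' B'
  have hc := t.cut
  have hc' := t'.cut
  -- The intersection and the difference are not tight, by minimality.
  have hinter : ∀ u v r, Demand D u v r → A u = true → A' u = true → (B v = false ∨ B' v = false) →
      r ≠ cutVal E N (fun x => A x && A' x) (fun x => B x && B' x) + s + 1 := by
    intro u v r hd h1 h2 h3 h4
    have := m _ _ u v r ⟨hd, fun x hx => by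
        have := t.sub x; have := t'.sub x; simp_all,
      by simp [h1, h2], by rcases h3 with h | h <;> simp [h], by simp [t.center], h4.symm⟩
      (fun x hx => by simp at hx; exact hx.1)
    exact hne fun x hx => by have := this x hx; simp at this; exact this.2
  have hdif : ∀ u v r, Demand D u v r → A u = true → B' u = false → (B v = false ∨ A' v = true) →
      r ≠ cutVal E N (fun x => A x && !B' x) (fun x => B x && !A' x) + s + 1 := by
    intro u v r hd h1 h2 h3 h4
    have := m _ _ u v r ⟨hd, fun x hx => by
        have := t.sub x; have := t'.sub x; cases hA' : A' x <;> simp_all,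
      by simp [h1, h2], by rcases h3 with h | h <;> simp [h], by simp [t.center], h4.symm⟩
      (fun x hx => by simp at hx; exact hx.1)
    have := this z hz
    have hB := t'.sub z hz'
    simp [hB] at this
  have low_inter : ∀ u v r, Demand D u v r → A u = true → A' u = true → (B v = false ∨ B' v = false) →
      r ≤ cutVal E N (fun x => A x && A' x) (fun x => B x && B' x) + (s + 1) := by
    intro u v r hd h1 h2 h3
    refine hlow u v r hd _ _ (fun x hx => ?_) (by simp [h1, h2]) (by rcases h3 with h | h <;> simp [h])
    have := t.sub x; have := t'.sub x; simp_all
  have low_union : ∀ u v r, Demand D u v r → (A u = true ∨ A' u = true) → B v = false → B' v = false →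
      r ≤ cutVal E N (fun x => A x || A' x) (fun x => B x || B' x) + (s + 1) := by
    intro u v r hd h1 h2 h3
    refine hlow u v r hd _ _ (fun x hx => ?_) (by simpa using h1) (by simp [h2, h3])
    have := t.sub x; have := t'.sub x
    simp only [Bool.or_eq_true] at hx ⊢
    tauto
  have low_dif : ∀ u v r, Demand D u v r → A u = true → B' u = false → (B v = false ∨ A' v = true) →
      r ≤ cutVal E N (fun x => A x && !B' x) (fun x => B x && !A' x) + (s + 1) := by
    intro u v r hd h1 h2 h3
    refine hlow u v r hd _ _ (fun x hx => ?_) (by simp [h1, h2]) (by rcases h3 with h | h <;> simp [h])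
    have := t.sub x; have := t'.sub x; cases hA' : A' x <;> simp_all
  have low_dif' : ∀ u v r, Demand D u v r → A' u = true → B u = false → (B' v = false ∨ A v = true) →
      r ≤ cutVal E N (fun x => A' x && !B x) (fun x => B' x && !A x) + (s + 1) := by
    intro u v r hd h1 h2 h3
    refine hlow u v r hd _ _ (fun x hx => ?_) (by simp [h1, h2]) (by rcases h3 with h | h <;> simp [h])
    have := t.sub x; have := t'.sub x; cases hA : A x <;> simp_all
  have h5 := low_inter u v r t.demand t.left hu (.inl t.right)
  have h5' := hinter u v r t.demand t.left hu (.inl t.right)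
  -- Intersection and union, or the two differences, separate the two demands, so that one of them
  -- would have to be tight. The position of `v'`, `v` and `u'` decides which pair is used.
  rcases Bool.eq_false_or_eq_true (B v') with hv' | hv'
  · have hAv' := h₄ hv'
    have h6 := low_dif v' u' r' t'.demand.symm hAv' t'.right (.inr t'.left)
    have h6' := hdif v' u' r' t'.demand.symm hAv' t'.right (.inr t'.left)
    rcases Bool.eq_false_or_eq_true (B' v) with hv | hv
    · have hAv := h₂ hv
      have h7 := low_dif' v u r t.demand.symm hAv t.right (.inr t.left)
      omega
    · have h7 := low_union u v r t.demand (.inl t.left) t.right hv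
      rcases Bool.eq_false_or_eq_true (B u') with hu' | hu'
      · have hAu' := h₃ hu'
        have h8 := low_inter u' v' r' t'.demand hAu' t'.left (.inr t'.right)
        have h8' := hinter u' v' r' t'.demand hAu' t'.left (.inr t'.right)
        omega
      · have h8 := low_dif' u' v' r' t'.demand t'.left hu' (.inl t'.right)
        omega
  · have h6 := low_union u' v' r' t'.demand (.inr t'.left) hv' t'.right
    omega

/-- If two minimal tight bisets intersect, then an end of the demand of one of them lies in the
boundary of the other one. -/
theorem Tight.conflict (hlow : Satisfied E N D (s + 1))
    (t : Tight E N D a s A B u v r) (t' : Tight E N D a s A' B' u' v' r')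
    (m : MinimalInner E N D a s A) (m' : MinimalInner E N D a s A')
    (hz : A z = true) (hz' : A' z = true)
    (hne : ¬ ∀ x, A x = true → A' x = true) (hne' : ¬ ∀ x, A' x = true → A x = true) :
    ((B' u && !A' u) || (B' v && !A' v) || (B u' && !A u') || (B v' && !A v')) = true := by
  by_contra h
  simp only [Bool.or_eq_true, Bool.and_eq_true, Bool.not_eq_true', not_or, not_and,
    Bool.not_eq_false] at h
  obtain ⟨⟨⟨h₁, h₂⟩, h₃⟩, h₄⟩ := h
  rcases Bool.eq_false_or_eq_true (B' u) with hu | hu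
  · exact t.not_inner_of_disjoint_boundary hlow t' m hz hz' hne h₂ h₃ h₄ (h₁ hu)
  rcases Bool.eq_false_or_eq_true (B u') with hu' | hu'
  · exact t'.not_inner_of_disjoint_boundary hlow t m' hz' hz hne' h₄ h₁ h₂ (h₃ hu')
  have hdiff := cutVal_diff_add_cutVal_diff_le E N A B A' B'
  have hc := t.cut
  have hc' := t'.cut
  have h5 := hlow u v r t.demand (fun x => A x && !B' x) (fun x => B x && !A' x)
    (fun x hx => by have := t.sub x; have := t'.sub x; cases hA' : A' x <;> simp_all)
    (by simp [t.left, hu]) (by simp [t.right])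
  have h6 := hlow u' v' r' t'.demand (fun x => A' x && !B x) (fun x => B' x && !A x)
    (fun x hx => by have := t.sub x; have := t'.sub x; cases hA : A x <;> simp_all)
    (by simp [t'.left, hu']) (by simp [t'.right])
  have := m (fun x => A x && !B' x) (fun x => B x && !A' x) u v r ⟨t.demand, fun x hx => by
      have := t.sub x; have := t'.sub x; cases hA' : A' x <;> simp_all,
    by simp [t.left, hu], by simp [t.right], by simp [t.center], by omega⟩
    (fun x hx => by simp at hx; exact hx.1) z hz
  have hB := t'.sub z hz'
  simp [hB] at this

end Uncrossing

/-! ### The number of minimal tight sets that contain a node -/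

/-- If any two members of `I` are related in some direction, and every member has at most `d`
predecessors, then `I` has at most `2 d + 1` members. -/
theorem card_le_of_tournament {κ : Type} (I : Finset κ) (h : κ → κ → Bool) (d : ℕ)
    (ht : ∀ i ∈ I, ∀ j ∈ I, i ≠ j → h i j = true ∨ h j i = true)
    (hd : ∀ j ∈ I, (I.filter fun i => h i j = true).card ≤ d) : I.card ≤ 2 * d + 1 := by
  classical
  have h1 : I.offDiag ⊆ (I ×ˢ I).filter (fun p => h p.1 p.2 = true) ∪
      (I ×ˢ I).filter (fun p => h p.2 p.1 = true) := by
    rintro ⟨i, j⟩ hij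
    obtain ⟨hi, hj, hne⟩ := Finset.mem_offDiag.1 hij
    rcases ht i hi j hj hne with h | h <;> simp_all
  have h2 : ((I ×ˢ I).filter (fun p => h p.1 p.2 = true)).card ≤ I.card * d := by
    rw [Finset.card_filter, Finset.sum_product_right, ← smul_eq_mul]
    refine Finset.sum_le_card_nsmul _ _ _ fun j hj => ?_
    rw [← Finset.card_filter]
    exact hd j hj
  have h3 : ((I ×ˢ I).filter (fun p => h p.2 p.1 = true)).card ≤ I.card * d := by
    rw [Finset.card_filter, Finset.sum_product, ← smul_eq_mul]
    refine Finset.sum_le_card_nsmul _ _ _ fun j hj => ?_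
    rw [← Finset.card_filter]
    exact hd j hj
  have h4 := (Finset.card_le_card h1).trans (Finset.card_union_le _ _)
  rw [Finset.offDiag_card] at h4
  by_contra hlt
  have : I.card * (2 * d + 2) ≤ I.card * I.card := Nat.mul_le_mul_left _ (by omega)
  rw [mul_add, mul_left_comm] at this
  omega

section Degree

variable {E : List (ℕ × ℕ)} {N : List ℕ} {D : List (ℕ × ℕ × ℕ)} {a s l z : ℕ}
  {κ : Type} {I : Finset κ} {A B : κ → ℕ → Bool} {u v r : κ → ℕ}

/-- A family of pairwise incomparable minimal tight bisets whose inner parts contain `z`, for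
requirements that are at most `l` after lowering. -/
structure TightFamily (E : List (ℕ × ℕ)) (N : List ℕ) (D : List (ℕ × ℕ × ℕ)) (a s l z : ℕ)
    {κ : Type} (I : Finset κ) (A B : κ → ℕ → Bool) (u v r : κ → ℕ) : Prop where
  tight : ∀ i ∈ I, Tight E N D a s (A i) (B i) (u i) (v i) (r i)
  minimal : ∀ i ∈ I, MinimalInner E N D a s (A i)
  mem : ∀ i ∈ I, A i z = true
  incomparable : ∀ i ∈ I, ∀ j ∈ I, i ≠ j → ¬ ∀ x, A i x = true → A j x = true
  le : ∀ i ∈ I, r i ≤ s + l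

/-- The boundary of a biset. -/
def boundary (N : List ℕ) (A B : ℕ → Bool) : Finset ℕ := (N.filter fun w => B w && !A w).toFinset

theorem card_boundary_le (E : List (ℕ × ℕ)) (N : List ℕ) (A B : ℕ → Bool) :
    (boundary N A B).card ≤ cutVal E N A B := by
  refine (List.toFinset_card_le _).trans ?_
  rw [← List.countP_eq_length_filter]
  unfold cutVal
  omega

theorem TightFamily.subset (h : TightFamily E N D a s l z I A B u v r) {J : Finset κ} (hJ : J ⊆ I) :
    TightFamily E N D a s l z J A B u v r :=
  ⟨fun i hi => h.tight i (hJ hi), fun i hi => h.minimal i (hJ hi), fun i hi => h.mem i (hJ hi),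
    fun i hi j hj => h.incomparable i (hJ hi) j (hJ hj), fun i hi => h.le i (hJ hi)⟩

theorem TightFamily.card_boundary_lt (h : TightFamily E N D a s l z I A B u v r) {i : κ}
    (hi : i ∈ I) : (boundary N (A i) (B i)).card + 1 ≤ l := by
  have h1 := (h.tight i hi).cut
  have h2 := h.le i hi
  have h3 := card_boundary_le E N (A i) (B i)
  omega

theorem TightFamily.conflict (h : TightFamily E N D a s l z I A B u v r)
    (hlow : Satisfied E N D (s + 1)) (hN : ∀ u v r, Demand D u v r → u ∈ N)
    {i j : κ} (hi : i ∈ I) (hj : j ∈ I) (hij : i ≠ j) :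
    (u i ∈ boundary N (A j) (B j) ∨ v i ∈ boundary N (A j) (B j)) ∨
      (u j ∈ boundary N (A i) (B i) ∨ v j ∈ boundary N (A i) (B i)) := by
  have h1 := (h.tight i hi).conflict hlow (h.tight j hj) (h.minimal i hi) (h.minimal j hj)
    (h.mem i hi) (h.mem j hj) (h.incomparable i hi j hj hij) (h.incomparable j hj i hi hij.symm)
  have h2 := hN _ _ _ (h.tight i hi).demand
  have h3 := hN _ _ _ (h.tight i hi).demand.symm
  have h4 := hN _ _ _ (h.tight j hj).demand
  have h5 := hN _ _ _ (h.tight j hj).demand.symm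
  simp only [boundary, List.mem_toFinset, List.mem_filter, h2, h3, h4, h5, true_and]
  simp only [Bool.or_eq_true] at h1 ⊢
  tauto

/-- If every two members conflict in the nodes `w i`, then these are distinct, and so at most `l - 1`
of them lie in a boundary. -/
theorem TightFamily.card_le_of_conflict (h : TightFamily E N D a s l z I A B u v r) {w : κ → ℕ}
    (hconf : ∀ i ∈ I, ∀ j ∈ I, i ≠ j → w i ∈ boundary N (A j) (B j) ∨ w j ∈ boundary N (A i) (B i))
    (hw : ∀ i ∈ I, w i ∉ boundary N (A i) (B i)) (hI : I.Nonempty) : I.card + 1 ≤ 2 * l := by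
  have hinj : Set.InjOn w I := by
    intro i hi j hj hij
    by_contra hne
    rcases hconf i hi j hj hne with h3 | h3
    · rw [hij] at h3
      exact hw j hj h3
    · rw [← hij] at h3
      exact hw i hi h3
  have := card_le_of_tournament I (fun i j => decide (w i ∈ boundary N (A j) (B j))) (l - 1)
    (by simpa using hconf) (fun j hj => by
      have h1 := h.card_boundary_lt hj
      have h2 : (I.filter fun i => decide (w i ∈ boundary N (A j) (B j)) = true).card
          ≤ (boundary N (A j) (B j)).card := by
        refine Finset.card_le_card_of_injOn w (fun i hi => ?_)
          (hinj.mono fun i hi => (Finset.mem_filter.1 hi).1)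
        simpa using (Finset.mem_filter.1 hi).2
      omega)
  obtain ⟨i, hi⟩ := hI
  have := h.card_boundary_lt hi
  omega

theorem TightFamily.left_not_mem_boundary (h : TightFamily E N D a s l z I A B u v r) {i : κ}
    (hi : i ∈ I) : u i ∉ boundary N (A i) (B i) := by
  have := (h.tight i hi).left
  simp [boundary, this]

theorem TightFamily.right_not_mem_boundary (h : TightFamily E N D a s l z I A B u v r) {i : κ}
    (hi : i ∈ I) : v i ∉ boundary N (A i) (B i) := by
  have := (h.tight i hi).right
  simp [boundary, this]

/-- If the demands have the same second end, the conflicts are conflicts of their first ends. -/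
theorem TightFamily.card_le_of_right (h : TightFamily E N D a s l z I A B u v r)
    (hlow : Satisfied E N D (s + 1)) (hN : ∀ u v r, Demand D u v r → u ∈ N) {v₀ : ℕ}
    (hv : ∀ i ∈ I, v i = v₀) (hI : I.Nonempty) : I.card + 1 ≤ 2 * l := by
  refine h.card_le_of_conflict (fun i hi j hj hij => ?_) (fun i hi => h.left_not_mem_boundary hi) hI
  have h1 := h.conflict hlow hN hi hj hij
  have h2 := h.right_not_mem_boundary hi
  have h3 := h.right_not_mem_boundary hj
  rw [hv i hi] at h1 h2
  rw [hv j hj] at h1 h3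
  tauto

theorem TightFamily.card_le_of_left (h : TightFamily E N D a s l z I A B u v r)
    (hlow : Satisfied E N D (s + 1)) (hN : ∀ u v r, Demand D u v r → u ∈ N) {u₀ : ℕ}
    (hu : ∀ i ∈ I, u i = u₀) (hI : I.Nonempty) : I.card + 1 ≤ 2 * l := by
  refine h.card_le_of_conflict (fun i hi j hj hij => ?_) (fun i hi => h.right_not_mem_boundary hi) hI
  have h1 := h.conflict hlow hN hi hj hij
  have h2 := h.left_not_mem_boundary hi
  have h3 := h.left_not_mem_boundary hj
  rw [hu i hi] at h1 h2
  rw [hu j hj] at h1 h3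
  tauto

theorem TightFamily.card_le_rootedDegBound (h : TightFamily E N D a s l z I A B u v r)
    (hlow : Satisfied E N D (s + 1)) (hN : ∀ u v r, Demand D u v r → u ∈ N) {v₀ : ℕ}
    (hv : ∀ i ∈ I, v i = v₀) : I.card ≤ rootedDegBound l := by
  rcases I.eq_empty_or_nonempty with rfl | hI
  · simp
  · have := h.card_le_of_right hlow hN hv hI
    unfold rootedDegBound
    omega

/-- Each of the at most `l - 1` nodes of a boundary is an end of the demands of at most
`2 (2 l - 1)` members of the family. -/
theorem TightFamily.card_le_degBound (h : TightFamily E N D a s l z I A B u v r)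
    (hlow : Satisfied E N D (s + 1)) (hN : ∀ u v r, Demand D u v r → u ∈ N) :
    I.card ≤ degBound l := by
  classical
  rcases I.eq_empty_or_nonempty with rfl | ⟨i₀, hi₀⟩
  · simp
  have hl := h.card_boundary_lt hi₀
  have := card_le_of_tournament I (fun i j => decide (u i ∈ boundary N (A j) (B j) ∨
      v i ∈ boundary N (A j) (B j))) ((l - 1) * (2 * (2 * l - 1)))
    (by simpa using fun i hi j hj hij => h.conflict hlow hN hi hj hij) (fun j hj => by
      have h1 := h.card_boundary_lt hj
      have h2 : (I.filter fun i => decide (u i ∈ boundary N (A j) (B j) ∨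
          v i ∈ boundary N (A j) (B j)) = true) ⊆ (boundary N (A j) (B j)).biUnion fun w =>
          (I.filter fun i => u i = w) ∪ (I.filter fun i => v i = w) := by
        intro i hi
        simp only [decide_eq_true_eq, Finset.mem_filter] at hi
        simp only [Finset.mem_biUnion, Finset.mem_union, Finset.mem_filter]
        rcases hi.2 with h3 | h3
        · exact ⟨_, h3, .inl ⟨hi.1, rfl⟩⟩
        · exact ⟨_, h3, .inr ⟨hi.1, rfl⟩⟩
      refine (Finset.card_le_card h2).trans ?_
      refine (Finset.card_biUnion_le_card_mul _ _ (2 * (2 * l - 1)) fun w _ => ?_).trans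
        (Nat.mul_le_mul_right _ (by omega))
      refine (Finset.card_union_le _ _).trans ?_
      have h4 : (I.filter fun i => u i = w).card ≤ 2 * l - 1 := by
        rcases (I.filter fun i => u i = w).eq_empty_or_nonempty with h5 | h5
        · simp [h5]
        · have := (h.subset (Finset.filter_subset (fun i => u i = w) I)).card_le_of_left hlow hN
            (u₀ := w) (fun i hi => (Finset.mem_filter.1 hi).2) h5
          omega
      have h5 : (I.filter fun i => v i = w).card ≤ 2 * l - 1 := by
        rcases (I.filter fun i => v i = w).eq_empty_or_nonempty with h5 | h5
        · simp [h5]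
        · have := (h.subset (Finset.filter_subset (fun i => v i = w) I)).card_le_of_right hlow hN
            (v₀ := w) (fun i hi => (Finset.mem_filter.1 hi).2) h5
          omega
      omega)
  refine this.trans ?_
  obtain ⟨m, rfl⟩ : ∃ m, l = m + 1 := ⟨l - 1, by omega⟩
  unfold degBound
  have e1 : 4 * (m + 1) - 3 = 4 * m + 1 := by omega
  have e2 : 2 * (m + 1) - 1 = 2 * m + 1 := by omega
  rw [e1, e2, Nat.add_sub_cancel]
  nlinarith

end Degree

/-! ### Minimal deficient sets -/

/-- The digraph in which a node `w` is split into an arc from `(w, false)` to `(w, true)`, one for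
each occurrence of `w` in `N`, and an edge is replaced by two opposite arcs. -/
def network (E : List (ℕ × ℕ)) (N : List ℕ) : List ((ℕ × Bool) × (ℕ × Bool)) :=
  E.map (fun e => ((e.1, true), (e.2, false))) ++ (E.map (fun e => ((e.2, true), (e.1, false))) ++
    N.map (fun w => ((w, false), (w, true))))

theorem outCount_network (E : List (ℕ × ℕ)) (N : List ℕ) (S : ℕ × Bool → Bool) :
    outCount (network E N) S = cutVal E N (fun x => S (x, true)) (fun x => S (x, false)) := by
  simp only [outCount, network, List.countP_append, List.countP_map, cutVal, Function.comp_def,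
    Nat.add_assoc]

theorem countP_le_of_toNat_le {α : Type} {p q : α → Bool} (l : List α)
    (h : ∀ x, (p x).toNat ≤ (q x).toNat) : l.countP p ≤ l.countP q :=
  List.countP_mono_left fun x _ hx => by
    have := h x
    by_contra hq
    simp only [Bool.not_eq_true] at hq
    simp [hx, hq] at this

theorem cutVal_shrink_le (E : List (ℕ × ℕ)) (N : List ℕ) {A B : ℕ → Bool} {u : ℕ} (hu : A u = true) :
    cutVal E N (fun x => (A x && B x) || decide (x = u)) (fun x => B x || decide (x = u))
      ≤ cutVal E N A B := by
  unfold cutVal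
  gcongr ?_ + ?_ + ?_
  · exact countP_le_of_toNat_le E fun e => toNat_shrink_edge hu _ _
  · exact countP_le_of_toNat_le E fun e => toNat_shrink_edge hu _ _
  · exact countP_le_of_toNat_le N fun e => toNat_shrink_node hu _

theorem cutVal_singleton_le (E : List (ℕ × ℕ)) (N : List ℕ) (u : ℕ) :
    cutVal E N (fun x => decide (x = u)) (fun x => decide (x = u)) ≤ E.length := by
  unfold cutVal
  have h1 := countP_add_countP_le E (p₁ := fun e => decide (e.1 = u) && !decide (e.2 = u))
    (p₂ := fun e => decide (e.2 = u) && !decide (e.1 = u)) (p₃ := fun _ => true)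
    (p₄ := fun _ => false) (fun e => by
      by_cases h1 : e.1 = u <;> by_cases h2 : e.2 = u <;> simp [h1, h2])
  have h2 : N.countP (fun w => decide (w = u) && !decide (w = u)) = 0 := by simp
  have h3 : E.countP (fun _ => true) = E.length := by simp
  have h4 : E.countP (fun _ => false) = 0 := by simp
  beta_reduce
  omega

/-- The nodes reachable from `u` in the residual network, for the demand `d = (u, v, r)`. -/
def reachSet {β : Type} (E : List (ℕ × ℕ)) (N : List ℕ) (U : List β) (d : ℕ × ℕ × ℕ) :
    List (ℕ × Bool) :=
  minCut (d.1, true) (d.2.1, false) (network E N) U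

/-- The maximum value of a flow for the demand `d`. -/
def flowValue {β : Type} (E : List (ℕ × ℕ)) (N : List ℕ) (U : List β) (d : ℕ × ℕ × ℕ) : ℕ :=
  (residualArcs (d.1, true) (d.2.1, false) (network E N) U).2

/-- The inner part of the least minimum cut for the demand `d`, if the demand is deficient (after
lowering its requirement by `s`) and the cut can be covered by an edge at `a`. -/
def coreOf {β : Type} (E : List (ℕ × ℕ)) (N : List ℕ) (a : ℕ) (U : List β) (s : ℕ)
    (d : ℕ × ℕ × ℕ) : List (List ℕ) :=
  cond (decide (flowValue E N U d + s < d.2.2) &&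
      (!decide ((a, false) ∈ reachSet E N U d) && !decide (a = d.1)))
    [((reachSet E N U d).filter fun x => x.2).map fun x => x.1] []

section Core

variable {β : Type} {E : List (ℕ × ℕ)} {N : List ℕ} {D : List (ℕ × ℕ × ℕ)} {a s u v r : ℕ}
  {U : List β}

theorem reachSet_spec (huv : u ≠ v) (hU : E.length < U.length) :
    (u, true) ∈ reachSet E N U (u, v, r) ∧ (v, false) ∉ reachSet E N U (u, v, r) ∧
    cutVal E N (fun x => decide ((x, true) ∈ reachSet E N U (u, v, r)))
      (fun x => decide ((x, false) ∈ reachSet E N U (u, v, r))) = flowValue E N U (u, v, r) ∧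
    ∀ A B : ℕ → Bool, A u = true → B v = false → flowValue E N U (u, v, r) ≤ cutVal E N A B ∧
      (cutVal E N A B = flowValue E N U (u, v, r) →
        (∀ x, (x, true) ∈ reachSet E N U (u, v, r) → A x = true) ∧
        (∀ x, (x, false) ∈ reachSet E N U (u, v, r) → B x = true)) := by
  obtain ⟨h1, h2, h3, h4⟩ := minCut_spec (R := network E N) (U := U) (s := (u, true))
    (t := (v, false)) (S₁ := fun x => decide (x.1 = u)) (by simp) (by simpa using huv.symm)
    (by
      rw [outCount_network]
      exact (cutVal_singleton_le E N u).trans_lt hU)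
  rw [outCount_network] at h3
  refine ⟨h1, h2, by convert h3 <;> rfl, fun A B hA hB => ?_⟩
  have h5 := h4 (fun x => cond x.2 (A x.1) (B x.1)) hA hB
  rw [outCount_network] at h5
  exact ⟨h5.1, fun h => ⟨fun x hx => h5.2 h _ hx, fun x hx => h5.2 h _ hx⟩⟩

theorem Satisfied.le_flowValue (h : Satisfied E N D s) (hd : Demand D u v r) (huv : u ≠ v)
    (hU : E.length < U.length) : r ≤ flowValue E N U (u, v, r) + s := by
  obtain ⟨h1, h2, h3, -⟩ := reachSet_spec (N := N) (r := r) huv hU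
  rw [← h3]
  refine (h u v r hd _ _ ?_ ?_ ?_).trans (Nat.add_le_add_right (cutVal_shrink_le E N (u := u)
    (by simpa using h1)) s)
  · intro x hx
    simp only [Bool.or_eq_true, Bool.and_eq_true] at hx ⊢
    tauto
  · simp
  · simpa [h2] using huv.symm

theorem exists_mem_coreOf (h : Satisfied E N D (s + 1)) (hd : Demand D u v r) (huv : u ≠ v)
    (hU : E.length < U.length) {A B : ℕ → Bool} (hAB : ∀ x, A x = true → B x = true)
    (hu : A u = true) (hv : B v = false) (ha : B a = false) (hcut : cutVal E N A B + s < r) :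
    ∃ C ∈ coreOf E N a U s (u, v, r), ∀ x ∈ C, A x = true := by
  have h1 := h.le_flowValue hd huv hU
  obtain ⟨-, -, -, h4⟩ := reachSet_spec (N := N) (r := r) huv hU
  obtain ⟨h5, h6⟩ := h4 A B hu hv
  obtain ⟨h7, h8⟩ := h6 (by omega)
  have h9 : (a, false) ∉ reachSet E N U (u, v, r) := fun hm => by simp [h8 a hm] at ha
  have h10 : a ≠ u := by
    rintro rfl
    simp [hAB a hu] at ha
  refine ⟨((reachSet E N U (u, v, r)).filter fun x => x.2).map fun x => x.1, ?_, ?_⟩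
  · unfold coreOf
    have h11 : flowValue E N U (u, v, r) + s < r := by omega
    simp only [h11, h9, h10, decide_true, decide_false, Bool.not_false, Bool.and_true, cond_true]
    exact List.mem_singleton_self _
  · intro x hx
    simp only [List.mem_map, List.mem_filter] at hx
    obtain ⟨⟨y, b⟩, ⟨hy, hb⟩, rfl⟩ := hx
    simp only at hb
    subst hb
    exact h7 y hy

theorem tight_of_mem_coreOf (h : Satisfied E N D (s + 1)) (hd : Demand D u v r) (huv : u ≠ v)
    (hU : E.length < U.length) {C : List ℕ} (hC : C ∈ coreOf E N a U s (u, v, r)) :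
    ∃ B, Tight E N D a s (fun x => decide (x ∈ C)) B u v r := by
  unfold coreOf at hC
  by_cases hc : (decide (flowValue E N U (u, v, r) + s < r) &&
      (!decide ((a, false) ∈ reachSet E N U (u, v, r)) && !decide (a = u))) = true
  swap
  · simp only [Bool.not_eq_true] at hc
    simp [hc] at hC
  simp only [hc, cond_true, List.mem_singleton] at hC
  simp only [Bool.and_eq_true, decide_eq_true_eq, Bool.not_eq_true', decide_eq_false_iff_not] at hc
  obtain ⟨hlt, ha, hau⟩ := hc
  have h1 := h.le_flowValue hd huv hU
  obtain ⟨h2, h3, h4, h5⟩ := reachSet_spec (N := N) (r := r) huv hU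
  have h2' : decide ((u, true) ∈ reachSet E N U (u, v, r)) = true := by simpa using h2
  have hle := cutVal_shrink_le E N (u := u)
    (A := fun x => decide ((x, true) ∈ reachSet E N U (u, v, r)))
    (B := fun x => decide ((x, false) ∈ reachSet E N U (u, v, r))) h2'
  rw [h4] at hle
  set A : ℕ → Bool := fun x => (decide ((x, true) ∈ reachSet E N U (u, v, r)) &&
    decide ((x, false) ∈ reachSet E N U (u, v, r))) || decide (x = u)
  set B : ℕ → Bool := fun x => decide ((x, false) ∈ reachSet E N U (u, v, r)) || decide (x = u)
  have hAu : A u = true := by simp [A]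
  have hBv : B v = false := by simpa [B, h3] using huv.symm
  obtain ⟨h6, h7⟩ := h5 A B hAu hBv
  obtain ⟨h8, -⟩ := h7 (by omega)
  have hAC : (fun x => decide (x ∈ C)) = A := by
    funext x
    have h9 : x ∈ C ↔ (x, true) ∈ reachSet E N U (u, v, r) := by
      rw [hC]
      simp
    rw [Bool.eq_iff_iff, decide_eq_true_eq, h9]
    refine ⟨h8 x, fun hx => ?_⟩
    simp only [A, Bool.or_eq_true, Bool.and_eq_true, decide_eq_true_eq] at hx
    rcases hx with hx | rfl
    · exact hx.1
    · exact h2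
  refine ⟨B, hAC ▸ ⟨hd, ?_, hAu, hBv, ?_, by omega⟩⟩
  · intro x hx
    simp only [A, B, Bool.or_eq_true, Bool.and_eq_true] at hx ⊢
    tauto
  · simp [B, ha, hau]

theorem coreOf_eq_nil (h : Satisfied E N D s) (hd : Demand D u v r) (huv : u ≠ v)
    (hU : E.length < U.length) : coreOf E N a U s (u, v, r) = [] := by
  have h1 := h.le_flowValue hd huv hU
  have h2 : ¬ flowValue E N U (u, v, r) + s < r := by omega
  simp [coreOf, h2]

end Core

/-- Insert `C` into an antichain of sets, keeping only inclusion-minimal members. -/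
def insertMinimal (l : List (List ℕ)) (C : List ℕ) : List (List ℕ) :=
  cond (l.any fun B => B.all fun x => decide (x ∈ C)) l
    (C :: l.filter fun B => !(C.all fun x => decide (x ∈ B)))

/-- The inclusion-minimal members of a list of sets, without repetitions. -/
def minimalSets (l : List (List ℕ)) : List (List ℕ) := l.foldl insertMinimal []

theorem insertMinimal_subperm {l m : List (List ℕ)} (h : l.Subperm m) (C : List ℕ) :
    (insertMinimal l C).Subperm (m ++ [C]) := by
  unfold insertMinimal
  cases l.any fun B => B.all fun x => decide (x ∈ C)
  · refine List.Subperm.trans ?_ (List.perm_append_singleton C m).symm.subperm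
    exact (List.subperm_cons C).2 (List.filter_sublist.subperm.trans h)
  · exact h.trans (List.sublist_append_left _ _).subperm

theorem foldl_insertMinimal_subperm {l m : List (List ℕ)} (h : l.Subperm m) (L : List (List ℕ)) :
    (L.foldl insertMinimal l).Subperm (m ++ L) := by
  induction L generalizing l m with
  | nil => simpa using h
  | cons C L ih =>
    have := ih (insertMinimal_subperm h C)
    rwa [List.append_assoc] at this

theorem minimalSets_subperm (l : List (List ℕ)) : (minimalSets l).Subperm l :=
  foldl_insertMinimal_subperm (List.Subperm.refl []) l

theorem foldl_insertMinimal_spec (l L : List (List ℕ))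
    (hl : l.Pairwise fun B C => ¬ B ⊆ C ∧ ¬ C ⊆ B) :
    (L.foldl insertMinimal l).Pairwise (fun B C => ¬ B ⊆ C ∧ ¬ C ⊆ B) ∧
    ∀ C ∈ l ++ L, ∃ B ∈ L.foldl insertMinimal l, B ⊆ C := by
  induction L generalizing l with
  | nil => exact ⟨hl, fun C hC => ⟨C, by simpa using hC, List.Subset.refl C⟩⟩
  | cons C L ih =>
    have key : (insertMinimal l C).Pairwise (fun B C => ¬ B ⊆ C ∧ ¬ C ⊆ B) ∧
        ∀ X ∈ C :: l, ∃ B ∈ insertMinimal l C, B ⊆ X := by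
      unfold insertMinimal
      by_cases h : ∃ B ∈ l, B ⊆ C
      · have : (l.any fun B => B.all fun x => decide (x ∈ C)) = true := by
          obtain ⟨B, hB, hBC⟩ := h
          exact List.any_eq_true.2 ⟨B, hB, List.all_eq_true.2 fun x hx => by simpa using hBC hx⟩
        simp only [this, cond_true]
        refine ⟨hl, fun X hX => ?_⟩
        rcases List.mem_cons.1 hX with rfl | hX
        · exact h
        · exact ⟨X, hX, List.Subset.refl X⟩
      · have : (l.any fun B => B.all fun x => decide (x ∈ C)) = false := by
          rw [Bool.eq_false_iff]
          intro h'
          obtain ⟨B, hB, hBC⟩ := List.any_eq_true.1 h'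
          exact h ⟨B, hB, fun x hx => by simpa using List.all_eq_true.1 hBC x hx⟩
        simp only [this, cond_false]
        have hmem : ∀ B, (!(C.all fun x => decide (x ∈ B))) = true ↔ ¬ C ⊆ B := by
          intro B
          rw [Bool.not_eq_true', Bool.eq_false_iff, ne_eq, List.all_eq_true]
          simp only [decide_eq_true_eq]
          rfl
        refine ⟨List.pairwise_cons.2 ⟨fun B hB => ?_, hl.sublist List.filter_sublist⟩, fun X hX => ?_⟩
        · rw [List.mem_filter, hmem] at hB
          exact ⟨hB.2, fun h' => h ⟨B, hB.1, h'⟩⟩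
        · rcases List.mem_cons.1 hX with rfl | hX
          · exact ⟨X, List.mem_cons_self, List.Subset.refl X⟩
          · by_cases hCX : C ⊆ X
            · exact ⟨C, List.mem_cons_self, hCX⟩
            · exact ⟨X, List.mem_cons_of_mem _ (List.mem_filter.2 ⟨hX, (hmem X).2 hCX⟩),
                List.Subset.refl X⟩
    obtain ⟨h1, h2⟩ := ih _ key.1
    refine ⟨h1, fun X hX => ?_⟩
    rw [List.foldl_cons]
    by_cases hXL : X ∈ L
    · exact h2 X (List.mem_append_right _ hXL)
    · obtain ⟨B, hB, hBX⟩ := key.2 X (by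
        simp only [List.mem_append, List.mem_cons] at hX ⊢
        tauto)
      obtain ⟨B', hB', hBB'⟩ := h2 B (List.mem_append_left _ hB)
      exact ⟨B', hB', fun x hx => hBX (hBB' hx)⟩

theorem minimalSets_pairwise (l : List (List ℕ)) :
    (minimalSets l).Pairwise fun B C => ¬ B ⊆ C ∧ ¬ C ⊆ B :=
  (foldl_insertMinimal_spec [] l List.Pairwise.nil).1

theorem exists_minimalSets_subset {l : List (List ℕ)} {C : List ℕ} (hC : C ∈ l) :
    ∃ B ∈ minimalSets l, B ⊆ C :=
  (foldl_insertMinimal_spec [] l List.Pairwise.nil).2 C (by simpa using hC)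

theorem minimalSets_nodup (l : List (List ℕ)) : (minimalSets l).Nodup :=
  by
  refine (minimalSets_pairwise l).imp fun {B C} h hBC => h.1 ?_
  rw [hBC]
  exact List.Subset.refl C

theorem minimalSets_incomparable {l : List (List ℕ)} {B C : List ℕ} (hB : B ∈ minimalSets l)
    (hC : C ∈ minimalSets l) (hne : B ≠ C) : ¬ B ⊆ C := by
  have h : ∀ B ∈ minimalSets l, ∀ C ∈ minimalSets l, B ≠ C → ¬ B ⊆ C ∧ ¬ C ⊆ B :=
    haveI : Std.Symm fun B C : List ℕ => ¬ B ⊆ C ∧ ¬ C ⊆ B := ⟨fun _ _ h => ⟨h.2, h.1⟩⟩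
    fun B hB C hC hne => (minimalSets_pairwise l).forall hB hC hne
  exact (h B hB C hC hne).1

/-- The minimal inner parts of the tight bisets. -/
def cores {β : Type} (E : List (ℕ × ℕ)) (N : List ℕ) (D : List (ℕ × ℕ × ℕ)) (a : ℕ) (U : List β)
    (s : ℕ) : List (List ℕ) :=
  minimalSets ((D ++ D.map fun d => (d.2.1, d.1, d.2.2)).flatMap fun d => coreOf E N a U s d)

theorem mem_append_swap_iff {D : List (ℕ × ℕ × ℕ)} {u v r : ℕ} :
    (u, v, r) ∈ D ++ D.map (fun d => (d.2.1, d.1, d.2.2)) ↔ Demand D u v r := by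
  simp only [List.mem_append, List.mem_map, Demand]
  constructor
  · rintro (h | ⟨⟨x, y, z⟩, h, heq⟩)
    · exact .inl h
    · simp only [Prod.mk.injEq] at heq
      obtain ⟨rfl, rfl, rfl⟩ := heq
      exact .inr h
  · rintro (h | h)
    · exact .inl h
    · exact .inr ⟨_, h, rfl⟩

section Cores

variable {β : Type} {E : List (ℕ × ℕ)} {N : List ℕ} {D : List (ℕ × ℕ × ℕ)} {a s u v r : ℕ}
  {U : List β}

theorem exists_mem_cores (h : Satisfied E N D (s + 1)) (hD : ∀ u v r, Demand D u v r → u ≠ v)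
    (hU : E.length < U.length) (hd : Demand D u v r)
    {A B : ℕ → Bool} (hAB : ∀ x, A x = true → B x = true)
    (hu : A u = true) (hv : B v = false) (ha : B a = false) (hcut : cutVal E N A B + s < r) :
    ∃ C ∈ cores E N D a U s, ∀ x ∈ C, A x = true := by
  obtain ⟨C, hC, hCA⟩ := exists_mem_coreOf h hd (hD u v r hd) hU hAB hu hv ha hcut
  obtain ⟨C', hC', hsub⟩ := exists_minimalSets_subset
    (List.mem_flatMap.2 ⟨(u, v, r), mem_append_swap_iff.2 hd, hC⟩)
  exact ⟨C', hC', fun x hx => hCA x (hsub hx)⟩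

theorem tight_of_mem_cores (h : Satisfied E N D (s + 1)) (hD : ∀ u v r, Demand D u v r → u ≠ v)
    (hU : E.length < U.length) {C : List ℕ} (hC : C ∈ cores E N D a U s) :
    ∃ B u v r, Tight E N D a s (fun x => decide (x ∈ C)) B u v r := by
  obtain ⟨⟨u, v, r⟩, hd, hC'⟩ := List.mem_flatMap.1 ((minimalSets_subperm _).subset hC)
  rw [mem_append_swap_iff] at hd
  obtain ⟨B, hB⟩ := tight_of_mem_coreOf h hd (hD u v r hd) hU hC'
  exact ⟨B, u, v, r, hB⟩

theorem minimalInner_of_mem_cores (h : Satisfied E N D (s + 1))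
    (hD : ∀ u v r, Demand D u v r → u ≠ v) (hU : E.length < U.length) {C : List ℕ}
    (hC : C ∈ cores E N D a U s) : MinimalInner E N D a s (fun x => decide (x ∈ C)) := by
  intro X Y u v r ht hX x hx
  obtain ⟨C', hC', hsub⟩ := exists_mem_cores h hD hU ht.demand ht.sub ht.left ht.right ht.center
    (by have := ht.cut; omega)
  by_cases hCC : C' = C
  · subst hCC
    exact hsub x (by simpa using hx)
  · exact absurd (fun y hy => by simpa using hX y (hsub y hy))
      (minimalSets_incomparable hC' hC hCC)

theorem cores_eq_nil (h : Satisfied E N D s) (hD : ∀ u v r, Demand D u v r → u ≠ v)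
    (hU : E.length < U.length) : cores E N D a U s = [] := by
  have : (D ++ D.map fun d => (d.2.1, d.1, d.2.2)).flatMap (fun d => coreOf E N a U s d) = [] := by
    rw [List.flatMap_eq_nil_iff]
    rintro ⟨u, v, r⟩ hd
    rw [mem_append_swap_iff] at hd
    exact coreOf_eq_nil h hd (hD u v r hd) hU
  rw [cores, this]
  rfl

/-- Every node lies in at most `Δ` cores. -/
theorem length_filter_cores_le {l : ℕ} (h : Satisfied E N D (s + 1))
    (hD : ∀ u v r, Demand D u v r → u ≠ v) (hN : ∀ u v r, Demand D u v r → u ∈ N)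
    (hl : ∀ u v r, Demand D u v r → r ≤ s + l) (hU : E.length < U.length) (z : ℕ) :
    ((cores E N D a U s).filter fun C => decide (z ∈ C)).length ≤ degBound l ∧
    ((∀ u v r, Demand D u v r → u = a ∨ v = a) →
      ((cores E N D a U s).filter fun C => decide (z ∈ C)).length ≤ rootedDegBound l) := by
  classical
  have hex : ∀ C : List ℕ, ∃ B u v r, C ∈ cores E N D a U s →
      Tight E N D a s (fun x => decide (x ∈ C)) B u v r := by
    intro C
    by_cases hC : C ∈ cores E N D a U s
    · obtain ⟨B, u, v, r, ht⟩ := tight_of_mem_cores h hD hU hC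
      exact ⟨B, u, v, r, fun _ => ht⟩
    · exact ⟨fun _ => false, 0, 0, 0, fun h => absurd h hC⟩
  choose B u v r ht using hex
  set I := ((cores E N D a U s).filter fun C => decide (z ∈ C)).toFinset with hI
  have hcard : I.card = ((cores E N D a U s).filter fun C => decide (z ∈ C)).length :=
    List.toFinset_card_of_nodup ((minimalSets_nodup _).filter _)
  have hmem : ∀ C ∈ I, C ∈ cores E N D a U s ∧ z ∈ C := fun C hC => by
    simpa [hI] using hC
  have hfam : TightFamily E N D a s l z I (fun C x => decide (x ∈ C)) B u v r :=
    ⟨fun C hC => ht C (hmem C hC).1, fun C hC => minimalInner_of_mem_cores h hD hU (hmem C hC).1,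
      fun C hC => by simpa using (hmem C hC).2, fun C hC C' hC' hne hsub =>
        minimalSets_incomparable (hmem C hC).1 (hmem C' hC').1 hne
          (fun x hx => by simpa using hsub x (by simpa using hx)),
      fun C hC => hl _ _ _ (ht C (hmem C hC).1).demand⟩
  rw [← hcard]
  refine ⟨hfam.card_le_degBound h hN, fun hroot => hfam.card_le_rootedDegBound h hN (v₀ := a) ?_⟩
  intro C hC
  have := ht C (hmem C hC).1
  rcases hroot _ _ _ this.demand with h1 | h1
  · have h2 := this.sub _ this.left
    rw [h1] at h2
    simp [this.center] at h2
  · exact h1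

end Cores

/-! ### The greedy algorithm for hitting sets -/

/-- An item that can be bought: an identifier, a node `v`, a cost, and a list with one entry for
each of the parallel edges from the center to `v` that it consists of. -/
abbrev Item : Type := ℕ × ℕ × ℕ × List ℕ

namespace Item

/-- The node that the edges of the item join to the center. -/
def node (i : Item) : ℕ := i.2.1

/-- The cost of the item. -/
def cost (i : Item) : ℕ := i.2.2.1

/-- A list with one entry for every edge of the item. -/
def copies (i : Item) : List ℕ := i.2.2.2

end Item

/-- The number of members of `cs` that contain the node of `i`. -/
def hitCount (cs : List (List ℕ)) (i : Item) : ℕ :=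
  (cs.filter fun C => decide (i.node ∈ C)).length

/-- The items of `rem` that minimize the cost per member of `cs` hit. -/
def bestItems (cs : List (List ℕ)) (rem : List Item) : List Item :=
  (rem.filter fun i => decide (0 < hitCount cs i)).filter fun i =>
    (rem.filter fun j => decide (0 < hitCount cs j)).all fun j =>
      decide (i.cost * hitCount cs j ≤ j.cost * hitCount cs i)

/-- The state of the greedy algorithm: the sets still to be hit, the remaining items, the chosen
items. -/
abbrev GreedyState : Type := List (List ℕ) × List Item × List Item

/-- Buy a best item, if there is one. -/
def greedyStep (st : GreedyState) : GreedyState :=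
  lcase (bestItems st.1 st.2.1) st fun i _ =>
    (st.1.filter fun C => !decide (i.node ∈ C), st.2.1.erase i, i :: st.2.2)

/-- Hit all the members of `cs`. -/
def greedy (cs : List (List ℕ)) (st : List Item × List Item) : GreedyState :=
  cs.foldl (fun st _ => greedyStep st) (cs, st)

/-- The total cost of a list of items. -/
def totalCost (l : List Item) : ℕ := (l.map Item.cost).sum

theorem totalCost_cons (i : Item) (l : List Item) : totalCost (i :: l) = i.cost + totalCost l := rfl

theorem hitCount_pos_iff {cs : List (List ℕ)} {i : Item} :
    0 < hitCount cs i ↔ ∃ C ∈ cs, i.node ∈ C := by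
  unfold hitCount
  rw [List.length_pos_iff_exists_mem]
  simp [List.mem_filter]

theorem mem_bestItems_iff {cs : List (List ℕ)} {rem : List Item} {i : Item} :
    i ∈ bestItems cs rem ↔ i ∈ rem ∧ 0 < hitCount cs i ∧
      ∀ j ∈ rem, 0 < hitCount cs j → i.cost * hitCount cs j ≤ j.cost * hitCount cs i := by
  simp only [bestItems, List.mem_filter, List.all_eq_true, decide_eq_true_eq]
  constructor
  · rintro ⟨⟨h1, h2⟩, h3⟩
    exact ⟨h1, h2, fun j hj hj' => h3 j ⟨hj, hj'⟩⟩
  · rintro ⟨h1, h2, h3⟩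
    exact ⟨⟨h1, h2⟩, fun j hj => h3 j hj.1 hj.2⟩

theorem bestItems_ne_nil {cs : List (List ℕ)} {rem : List Item} {i : Item} (hi : i ∈ rem)
    (hpos : 0 < hitCount cs i) : bestItems cs rem ≠ [] := by
  classical
  set I := (rem.filter fun i => decide (0 < hitCount cs i)).toFinset with hI
  have hmem : ∀ j, j ∈ I ↔ j ∈ rem ∧ 0 < hitCount cs j := by simp [hI]
  obtain ⟨j, hj, hmin⟩ := I.exists_min_image (fun j => (j.cost : ℚ) / hitCount cs j)
    ⟨i, (hmem i).2 ⟨hi, hpos⟩⟩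
  refine List.ne_nil_of_mem (a := j) (mem_bestItems_iff.2 ⟨((hmem j).1 hj).1, ((hmem j).1 hj).2,
    fun l hl hl' => ?_⟩)
  have h1 := hmin l ((hmem l).2 ⟨hl, hl'⟩)
  have h2 : (0 : ℚ) < hitCount cs j := by exact_mod_cast ((hmem j).1 hj).2
  have h3 : (0 : ℚ) < hitCount cs l := by exact_mod_cast hl'
  rw [div_le_div_iff₀ h2 h3] at h1
  exact_mod_cast h1

/-- Double counting of the pairs in a relation. -/
theorem sum_map_length_filter {α β : Type} (l : List α) (m : List β) (R : α → β → Bool) :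
    (l.map fun j => (m.filter fun C => R j C).length).sum
      = (m.map fun C => (l.filter fun j => R j C).length).sum := by
  induction l with
  | nil => induction m <;> simp_all
  | cons j l ih =>
    rw [List.map_cons, List.sum_cons, ih]
    clear ih
    induction m with
    | nil => simp
    | cons C m ih2 =>
      simp only [List.map_cons, List.sum_cons, List.filter_cons] at ih2 ⊢
      by_cases h : R j C = true
      · simp only [h, if_true, List.length_cons]
        omega
      · simp only [h, Bool.false_eq_true, if_false]
        omega

theorem div_le_harmonic_sub {d e : ℕ} (hd : 0 < d) (he : e ≤ d) :
    ((d : ℚ) - e) / d ≤ harmonic d - harmonic e := by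
  induction d, he using Nat.le_induction with
  | base => simp
  | succ d he ih =>
    rw [harmonic_succ]
    rcases Nat.eq_zero_or_pos d with rfl | hd'
    · have : e = 0 := by omega
      subst this
      simp
    · have h1 := ih hd'
      have h2 : (0 : ℚ) < d := by exact_mod_cast hd'
      have h3 : ((d : ℚ) - e) / ((d : ℚ) + 1) ≤ ((d : ℚ) - e) / d := by
        apply div_le_div_of_nonneg_left _ h2 (by linarith)
        have : (e : ℚ) ≤ d := by exact_mod_cast he
        linarith
      have h4 : (((d + 1 : ℕ) : ℚ) - e) / ((d + 1 : ℕ) : ℚ)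
          = ((d : ℚ) - e) / ((d : ℚ) + 1) + ((d + 1 : ℕ) : ℚ)⁻¹ := by
        push_cast
        field_simp
        ring
      rw [h4]
      linarith

theorem harmonic_mono {m n : ℕ} (h : m ≤ n) : harmonic m ≤ harmonic n := by
  unfold harmonic
  refine Finset.sum_le_sum_of_subset_of_nonneg (Finset.range_mono h) fun i _ _ => by positivity

theorem harmonic_nonneg (n : ℕ) : 0 ≤ harmonic n :=
  Finset.sum_nonneg fun i _ => by positivity

/-- The potential of a family of sets: the cost at which the items of the reference solution `O`
can still be charged. -/
def potential (O : List Item) (cs : List (List ℕ)) : ℚ :=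
  (O.map fun j => (j.cost : ℚ) * harmonic (hitCount cs j)).sum

/-- Buying a best item costs at most `θ` times the decrease of the potential, if the weights `θ` on
the items of `O` cover every set: the item pays the same for each set hit, and for every `j ∈ O` at
most what `j` would pay. -/
theorem cost_add_potential_le {O rem : List Item} {cs : List (List ℕ)} {θ : ℚ} {i : Item}
    (hθ : 0 ≤ θ) (hi : i ∈ bestItems cs rem) (hO : ∀ j ∈ O, 0 < hitCount cs j → j ∈ rem)
    (hcov : ∀ C ∈ cs, 1 ≤ θ * (O.filter fun j => decide (j.node ∈ C)).length) :
    (i.cost : ℚ) + θ * potential O (cs.filter fun C => !decide (i.node ∈ C))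
      ≤ θ * potential O cs := by
  obtain ⟨-, hpos, hbest⟩ := mem_bestItems_iff.1 hi
  set hit := cs.filter fun C => decide (i.node ∈ C) with hhit
  set cs' := cs.filter fun C => !decide (i.node ∈ C) with hcs'
  have hm : (0 : ℚ) < hitCount cs i := by exact_mod_cast hpos
  have hsplit : ∀ j : Item, hitCount cs j = hitCount hit j + hitCount cs' j := by
    intro j
    simp only [hitCount, hhit, hcs', ← List.countP_eq_length_filter]
    rw [List.countP_eq_countP_filter_add cs _ fun C => decide (i.node ∈ C)]
  have hj : ∀ j ∈ O, (i.cost : ℚ) / hitCount cs i * hitCount hit j ≤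
      (j.cost : ℚ) * harmonic (hitCount cs j) - (j.cost : ℚ) * harmonic (hitCount cs' j) := by
    intro j hjO
    rcases Nat.eq_zero_or_pos (hitCount cs j) with h0 | h0
    · have h1 := hsplit j
      have h2 : hitCount hit j = 0 := by omega
      have h3 : hitCount cs' j = 0 := by omega
      simp [h0, h2, h3]
    · have h1 := hbest j (hO j hjO h0) h0
      have h2 := div_le_harmonic_sub h0 (show hitCount cs' j ≤ hitCount cs j by
        have := hsplit j; omega)
      have h3 : ((hitCount cs j : ℕ) : ℚ) - (hitCount cs' j : ℕ) = hitCount hit j := by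
        rw [hsplit j]; push_cast; ring
      rw [h3] at h2
      have h4 : (0 : ℚ) < hitCount cs j := by exact_mod_cast h0
      have h5 : (i.cost : ℚ) / hitCount cs i ≤ (j.cost : ℚ) / hitCount cs j := by
        rw [div_le_div_iff₀ hm h4]
        exact_mod_cast h1
      calc (i.cost : ℚ) / hitCount cs i * hitCount hit j
          ≤ (j.cost : ℚ) / hitCount cs j * hitCount hit j := by gcongr
        _ = (j.cost : ℚ) * ((hitCount hit j : ℚ) / hitCount cs j) := by ring
        _ ≤ (j.cost : ℚ) * (harmonic (hitCount cs j) - harmonic (hitCount cs' j)) := by gcongr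
        _ = _ := by ring
  have hsum : (i.cost : ℚ) / hitCount cs i * ((O.map fun j => hitCount hit j).sum : ℕ)
      ≤ potential O cs - potential O cs' := by
    clear hO hcov
    unfold potential
    induction O with
    | nil => simp
    | cons j O ih =>
      have h1 := hj j List.mem_cons_self
      have h2 := ih fun j hj' => hj j (List.mem_cons_of_mem _ hj')
      simp only [List.map_cons, List.sum_cons]
      push_cast
      rw [mul_add]
      push_cast at h2
      linarith
  have hcount : (hitCount cs i : ℚ) ≤ θ * ((O.map fun j => hitCount hit j).sum : ℕ) := by
    have h1 : (O.map fun j => hitCount hit j).sum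
        = (hit.map fun C => (O.filter fun j => decide (j.node ∈ C)).length).sum :=
      sum_map_length_filter O hit fun j C => decide (j.node ∈ C)
    have h2 : hitCount cs i = hit.length := rfl
    rw [h1, h2]
    have h3 : ∀ C ∈ hit, 1 ≤ θ * (O.filter fun j => decide (j.node ∈ C)).length :=
      fun C hC => hcov C (List.mem_of_mem_filter hC)
    clear_value hit
    clear h1 h2 hj hsum hsplit hhit
    induction hit with
    | nil => simp
    | cons C l ih =>
      have h4 := h3 C List.mem_cons_self
      have h5 := ih fun C hC => h3 C (List.mem_cons_of_mem _ hC)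
      simp only [List.map_cons, List.sum_cons, List.length_cons]
      push_cast
      push_cast at h5
      rw [mul_add]
      linarith
  have h6 : (i.cost : ℚ) ≤ (i.cost : ℚ) / hitCount cs i *
      (θ * ((O.map fun j => hitCount hit j).sum : ℕ)) := by
    calc (i.cost : ℚ) = (i.cost : ℚ) / hitCount cs i * hitCount cs i := by field_simp
      _ ≤ _ := by gcongr
  have h7 := mul_le_mul_of_nonneg_left hsum hθ
  have h8 : (i.cost : ℚ) / hitCount cs i * (θ * ((O.map fun j => hitCount hit j).sum : ℕ))
      = θ * ((i.cost : ℚ) / hitCount cs i * ((O.map fun j => hitCount hit j).sum : ℕ)) := by ring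
  linarith

theorem greedyStep_of_bestItems_nil {st : GreedyState} (h : bestItems st.1 st.2.1 = []) :
    greedyStep st = st := by
  simp [greedyStep, h]

/-- What holds during the run of the greedy algorithm that starts with the sets `cs₀`, the
remaining items `rem₀`, and the chosen items `ch₀`. -/
structure GreedyInv (O : List Item) (θ : ℚ) (cs₀ : List (List ℕ)) (rem₀ ch₀ : List Item)
    (st : GreedyState) : Prop where
  subset : ∀ C ∈ st.1, C ∈ cs₀
  mem_rem : ∀ j ∈ O, 0 < hitCount st.1 j → j ∈ st.2.1
  perm : (st.2.1 ++ st.2.2).Perm (rem₀ ++ ch₀)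
  chosen : ∃ new, st.2.2 = new ++ ch₀ ∧ ∀ C ∈ cs₀, C ∈ st.1 ∨ ∃ i ∈ new, i.node ∈ C
  cost : (totalCost st.2.2 : ℚ) + θ * potential O st.1 ≤ totalCost ch₀ + θ * potential O cs₀

theorem GreedyInv.step {O : List Item} {θ : ℚ} {cs₀ : List (List ℕ)} {rem₀ ch₀ : List Item}
    {st : GreedyState} (h : GreedyInv O θ cs₀ rem₀ ch₀ st) (hθ : 0 ≤ θ)
    (hcov : ∀ C ∈ cs₀, 1 ≤ θ * (O.filter fun j => decide (j.node ∈ C)).length) :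
    GreedyInv O θ cs₀ rem₀ ch₀ (greedyStep st) ∧
      ((greedyStep st).1 = [] ∨ (greedyStep st).1.length < st.1.length) := by
  obtain ⟨cs, rem, ch⟩ := st
  cases hb : bestItems cs rem with
  | nil =>
    rw [greedyStep_of_bestItems_nil hb]
    refine ⟨h, .inl ?_⟩
    -- A set that is left would be hit by an item of `O`, which would still be available.
    by_contra hne
    obtain ⟨C, hC⟩ := List.exists_mem_of_ne_nil _ hne
    have h1 := hcov C (h.subset C hC)
    have h2 : (O.filter fun j => decide (j.node ∈ C)) ≠ [] := by
      intro h2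
      rw [h2] at h1
      simp at h1
      linarith
    obtain ⟨j, hj⟩ := List.exists_mem_of_ne_nil _ h2
    simp only [List.mem_filter, decide_eq_true_eq] at hj
    have h3 : 0 < hitCount cs j := hitCount_pos_iff.2 ⟨C, hC, hj.2⟩
    exact bestItems_ne_nil (h.mem_rem j hj.1 h3) h3 hb
  | cons i l =>
    have hi : i ∈ bestItems cs rem := hb ▸ List.mem_cons_self
    have hstep : greedyStep (cs, rem, ch)
        = (cs.filter fun C => !decide (i.node ∈ C), rem.erase i, i :: ch) := by
      simp [greedyStep, hb]
    rw [hstep]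
    obtain ⟨hrem, hpos, -⟩ := mem_bestItems_iff.1 hi
    refine ⟨⟨fun C hC => h.subset C (List.mem_of_mem_filter hC), fun j hj hj' => ?_, ?_, ?_, ?_⟩, .inr ?_⟩
    · obtain ⟨C, hC, hjC⟩ := hitCount_pos_iff.1 hj'
      have h1 : j ∈ rem := h.mem_rem j hj (hitCount_pos_iff.2 ⟨C, List.mem_of_mem_filter hC, hjC⟩)
      refine (List.mem_erase_of_ne ?_).2 h1
      rintro rfl
      have := (List.mem_filter.1 hC).2
      simp [hjC] at this
    · refine List.Perm.trans ?_ h.perm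
      refine List.perm_middle.trans ?_
      rw [← List.cons_append]
      exact (List.perm_cons_erase hrem).symm.append_right ch
    · obtain ⟨new, hnew, hhit⟩ := h.chosen
      refine ⟨i :: new, by simp only at hnew; simp [hnew], fun C hC => ?_⟩
      rcases hhit C hC with h1 | ⟨j, hj, hjC⟩
      · by_cases hiC : i.node ∈ C
        · exact .inr ⟨i, List.mem_cons_self, hiC⟩
        · exact .inl (List.mem_filter.2 ⟨h1, by simpa using hiC⟩)
      · exact .inr ⟨j, List.mem_cons_of_mem _ hj, hjC⟩
    · have h1 := cost_add_potential_le hθ hi h.mem_rem fun C hC => hcov C (h.subset C hC)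
      have h2 := h.cost
      simp only [totalCost_cons] at h2 ⊢
      push_cast
      linarith
    · obtain ⟨C, hC, hiC⟩ := hitCount_pos_iff.1 hpos
      simp only
      rw [List.length_filter_lt_length_iff_exists]
      exact ⟨C, hC, by simpa using hiC⟩

/-- Every step hits a set, so that `cs.length` steps suffice. -/
theorem greedy_spec {O : List Item} {θ : ℚ} {cs : List (List ℕ)} {rem ch : List Item}
    (hθ : 0 ≤ θ) (hO : ∀ j ∈ O, j ∈ rem)
    (hcov : ∀ C ∈ cs, 1 ≤ θ * (O.filter fun j => decide (j.node ∈ C)).length) :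
    GreedyInv O θ cs rem ch (greedy cs (rem, ch)) ∧ (greedy cs (rem, ch)).1 = [] := by
  have key : ∀ (L : List (List ℕ)) (st : GreedyState), GreedyInv O θ cs rem ch st →
      st.1.length ≤ L.length → GreedyInv O θ cs rem ch (L.foldl (fun st _ => greedyStep st) st) ∧
        (L.foldl (fun st _ => greedyStep st) st).1 = [] := by
    intro L
    induction L with
    | nil => exact fun st h hl => ⟨h, List.length_eq_zero_iff.1 (by simpa using hl)⟩
    | cons C L ih =>
      intro st h hl
      obtain ⟨h1, h2⟩ := h.step hθ hcov
      refine ih _ h1 ?_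
      rcases h2 with h2 | h2
      · simp [h2]
      · simp only [List.length_cons] at hl
        exact Nat.le_of_lt_succ (h2.trans_le hl)
  exact key cs (cs, rem, ch) ⟨fun _ h => h, fun j hj _ => hO j hj, .refl _,
    ⟨[], rfl, fun C hC => .inl hC⟩, le_rfl⟩ le_rfl

/-! ### Raising the connectivity by one -/

/-- The edges of a list of items with center `a`. -/
def starEdges (a : ℕ) (l : List Item) : List (ℕ × ℕ) :=
  l.flatMap fun i => i.copies.map fun _ => (a, i.node)

/-- The number of edges of the items in `l` whose node lies in `A`. -/
def load (l : List Item) (A : ℕ → Bool) : ℕ := (l.map fun i => cond (A i.node) i.copies.length 0).sum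

theorem load_append (l m : List Item) (A : ℕ → Bool) : load (l ++ m) A = load l A + load m A := by
  simp [load]

theorem List.Perm.load_eq {l m : List Item} (h : l.Perm m) (A : ℕ → Bool) : load l A = load m A :=
  (h.map _).sum_eq

theorem countP_starEdges (a : ℕ) (l : List Item) (p : ℕ × ℕ → Bool) :
    (starEdges a l).countP p = (l.map fun i => cond (p (a, i.node)) i.copies.length 0).sum := by
  induction l with
  | nil => rfl
  | cons i l ih =>
    rw [starEdges, List.flatMap_cons, List.countP_append, List.map_cons, List.sum_cons]
    change _ + List.countP p (starEdges a l) = _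
    rw [ih, List.countP_map]
    congr 1
    by_cases h : p (a, i.node) = true
    · have : (p ∘ fun _ : ℕ => (a, i.node)) = fun _ => true := by funext; exact h
      simp [this, h]
    · simp only [Bool.not_eq_true] at h
      have : (p ∘ fun _ : ℕ => (a, i.node)) = fun _ => false := by funext; exact h
      simp [this, h]

theorem cutVal_starEdges {a : ℕ} {A B : ℕ → Bool} (hAB : ∀ x, A x = true → B x = true)
    (ha : B a = false) (l : List Item) : cutVal (starEdges a l) [] A B = load l A := by
  have haA : A a = false := by
    by_contra h
    simp [hAB a (by simpa using h)] at ha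
  simp [cutVal, countP_starEdges, load, ha, haA]

theorem cutVal_starEdges_of_boundary {a : ℕ} {A B : ℕ → Bool} (haA : A a = false) (haB : B a = true)
    (l : List Item) : cutVal (starEdges a l) [] A B = 0 := by
  simp [cutVal, countP_starEdges, haA, haB]

theorem length_starEdges (a : ℕ) (l : List Item) :
    (starEdges a l).length = (l.flatMap Item.copies).length := by
  simp [starEdges, List.length_flatMap]

theorem load_filter_le (l : List Item) (O : Item → Bool) (A : ℕ → Bool) :
    load (l.filter O) A ≤ load l A := by
  unfold load
  exact (List.filter_sublist.map _).sum_le_sum (fun _ _ => Nat.zero_le _)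

theorem load_le_mul (l : List Item) (A : ℕ → Bool) {p : ℕ} (hp : ∀ i ∈ l, i.copies.length ≤ p) :
    load l A ≤ (l.filter fun i => A i.node).length * p := by
  induction l with
  | nil => simp [load]
  | cons i l ih =>
    have h1 := ih fun j hj => hp j (List.mem_cons_of_mem _ hj)
    have h2 := hp i List.mem_cons_self
    have h3 : load (i :: l) A = cond (A i.node) i.copies.length 0 + load l A := rfl
    rw [h3, List.filter_cons]
    by_cases h : A i.node = true
    · simp only [h, cond_true, if_true, List.length_cons, add_mul]
      omega
    · simp only [Bool.not_eq_true] at h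
      simp only [h, cond_false, Bool.false_eq_true, if_false]
      omega

theorem one_le_load {l : List Item} {A : ℕ → Bool} {i : Item} (hi : i ∈ l) (hA : A i.node = true)
    (hc : i.copies ≠ []) : 1 ≤ load l A := by
  induction l with
  | nil => simp at hi
  | cons j l ih =>
    have h3 : load (j :: l) A = cond (A j.node) j.copies.length 0 + load l A := rfl
    rcases List.mem_cons.1 hi with rfl | hi
    · have := List.length_pos_iff.2 hc
      rw [h3, hA, cond_true]
      omega
    · have := ih hi
      omega

/-- Buy items such that all requirements, lowered by `s`, are satisfied, if they are satisfied when
lowered by `s + 1`. The state consists of the remaining and the chosen items. -/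
def phase {β : Type} (E : List (ℕ × ℕ)) (N : List ℕ) (D : List (ℕ × ℕ × ℕ)) (a : ℕ) (U : List β)
    (s : ℕ) (st : List Item × List Item) : List Item × List Item :=
  (greedy (cores (E ++ starEdges a st.2) N D a U s) st).2

section Phase

variable {β : Type} {E : List (ℕ × ℕ)} {N : List ℕ} {D : List (ℕ × ℕ × ℕ)} {a s : ℕ}
  {U : List β} {items rem ch : List Item} {O : Item → Bool}

theorem phase_eq_self (hD : ∀ u v r, Demand D u v r → u ≠ v) {st : List Item × List Item}
    (h : Satisfied (E ++ starEdges a st.2) N D s) (hU : (E ++ starEdges a st.2).length < U.length) :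
    phase E N D a U s st = st := by
  rw [phase, cores_eq_nil h hD hU]
  rfl

theorem length_add_starEdges_lt (hU : (E.length + (items.flatMap Item.copies).length) < U.length)
    (hperm : (rem ++ ch).Perm items) : (E ++ starEdges a ch).length < U.length := by
  rw [List.length_append, length_starEdges]
  have := (hperm.flatMap_right Item.copies).length_eq
  rw [List.flatMap_append, List.length_append] at this
  omega

/-- The reference solution `O` has `s + 1` edges among the remaining items that cover a deficient
biset. -/
theorem le_load_rem (hopt : Satisfied (E ++ starEdges a (items.filter O)) N D 0)
    (hperm : (rem ++ ch).Perm items) {A B : ℕ → Bool} {u v r : ℕ} (hd : Demand D u v r)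
    (hAB : ∀ x, A x = true → B x = true) (hu : A u = true) (hv : B v = false) (ha : B a = false)
    (hcut : cutVal (E ++ starEdges a ch) N A B + s < r) : s + 1 ≤ load (rem.filter O) A := by
  have h1 := hopt u v r hd A B hAB hu hv
  rw [cutVal_append, cutVal_starEdges hAB ha] at h1 hcut
  have h2 := (hperm.filter O).load_eq A
  rw [List.filter_append, load_append] at h2
  have h3 := load_filter_le ch O A
  omega

/-- The factor by which a phase with slack `s` is better than the greedy bound. -/
def discount (p s : ℕ) : ℚ := min ((p : ℚ) / ((s : ℚ) + 1)) 1

theorem discount_nonneg (p s : ℕ) : 0 ≤ discount p s := le_min (by positivity) zero_le_one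

theorem nodeRatio_eq (Δ : ℕ → ℕ) (k p : ℕ) : nodeRatio Δ k p =
    ∑ i ∈ Finset.range k, harmonic (Δ (i + 1)) * discount p (k - 1 - i) := by
  have h4 : Finset.Icc 1 k = Finset.Ico (0 + 1) (k + 1) := by ext; simp
  rw [nodeRatio, h4, ← Finset.sum_Ico_add', Finset.range_eq_Ico]
  refine Finset.sum_congr rfl fun i hi => ?_
  have hi' := (Finset.mem_Ico.1 hi).2
  have h5 : ((k - 1 - i : ℕ) : ℚ) = k - (i + 1) := by
    rw [Nat.sub_sub, Nat.cast_sub (by omega)]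
    push_cast
    ring
  rw [discount, h5]
  push_cast
  rfl

/-- Every core is hit by `(s + 1) / p` items of the reference solution, and by at least one. -/
theorem one_le_discount_mul {l : List Item} {A : ℕ → Bool} {p : ℕ}
    (hp : ∀ i ∈ l, i.copies.length ≤ p) (h : s + 1 ≤ load l A) :
    1 ≤ discount p s * (l.filter fun i => A i.node).length := by
  have h1 := load_le_mul l A hp
  have h2 : s + 1 ≤ (l.filter fun i => A i.node).length * p := h.trans h1
  unfold discount
  rcases min_choice ((p : ℚ) / ((s : ℚ) + 1)) 1 with h3 | h3
  · rw [h3, div_mul_eq_mul_div, le_div_iff₀ (by positivity), one_mul]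
    rw [mul_comm] at h2
    exact_mod_cast h2
  · rw [h3, one_mul]
    have : 0 < (l.filter fun i => A i.node).length := by
      rcases Nat.eq_zero_or_pos (l.filter fun i => A i.node).length with h0 | h0
      · rw [h0] at h2; omega
      · exact h0
    exact_mod_cast this

/-- A phase removes the deficiency `s + 1`: a biset that still misses its requirement by `s + 1` would
contain a core, and that core has been hit. The cost is bounded by comparing with the items of the
reference solution `O` that have not been bought before. -/
theorem phase_spec (hD : ∀ u v r, Demand D u v r → u ≠ v)
    (hU : (E.length + (items.flatMap Item.copies).length) < U.length)
    (hc : ∀ i ∈ items, i.copies ≠ []) (hperm : (rem ++ ch).Perm items)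
    (hsat : Satisfied (E ++ starEdges a ch) N D (s + 1))
    (hopt : Satisfied (E ++ starEdges a (items.filter O)) N D 0)
    {p Δ : ℕ} (hp : ∀ i ∈ items, i.copies.length ≤ p)
    (hΔ : ∀ z, ((cores (E ++ starEdges a ch) N D a U s).filter fun C => decide (z ∈ C)).length ≤ Δ) :
    ((phase E N D a U s (rem, ch)).1 ++ (phase E N D a U s (rem, ch)).2).Perm items ∧
    Satisfied (E ++ starEdges a (phase E N D a U s (rem, ch)).2) N D s ∧
    (totalCost (phase E N D a U s (rem, ch)).2 : ℚ)
      ≤ totalCost ch + harmonic Δ * discount p s * totalCost (items.filter O) := by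
  have hU' : (E ++ starEdges a ch).length < U.length := length_add_starEdges_lt hU hperm
  set cs := cores (E ++ starEdges a ch) N D a U s with hcs
  have hrem : ∀ i ∈ rem, i ∈ items := fun i hi => hperm.subset (List.mem_append_left _ hi)
  have hcov : ∀ C ∈ cs, 1 ≤ discount p s *
      ((rem.filter O).filter fun j => decide (j.node ∈ C)).length := by
    intro C hC
    obtain ⟨B, u, v, r, ht⟩ := tight_of_mem_cores hsat hD hU' hC
    exact one_le_discount_mul (A := fun x => decide (x ∈ C))
      (fun i hi => hp i (hrem i (List.mem_of_mem_filter hi)))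
      (le_load_rem hopt hperm ht.demand ht.sub ht.left ht.right ht.center (by have := ht.cut; omega))
  obtain ⟨hinv, hdone⟩ := greedy_spec (ch := ch) (discount_nonneg p s)
    (fun j hj => List.mem_of_mem_filter hj) hcov
  have hph : phase E N D a U s (rem, ch) = (greedy cs (rem, ch)).2 := rfl
  rw [hph]
  refine ⟨hinv.perm.trans hperm, ?_, ?_⟩
  · obtain ⟨new, hnew, hhit⟩ := hinv.chosen
    have hnewitems : ∀ i ∈ new, i ∈ items := fun i hi =>
      (hinv.perm.trans hperm).subset (List.mem_append_right _ (by
        rw [hnew]; exact List.mem_append_left _ hi))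
    have hmono : ∀ A B : ℕ → Bool, cutVal (E ++ starEdges a (greedy cs (rem, ch)).2.2) N A B
        = cutVal (E ++ starEdges a ch) N A B + cutVal (starEdges a new) [] A B := by
      intro A B
      rw [hnew, cutVal_append, cutVal_append, starEdges, List.flatMap_append, cutVal_append]
      change _ + (cutVal (starEdges a new) [] A B + cutVal (starEdges a ch) [] A B) = _
      omega
    have key : ∀ u v r, Demand D u v r → ∀ A B : ℕ → Bool, (∀ x, A x = true → B x = true) →
        A u = true → B v = false → B a = false →
        r ≤ cutVal (E ++ starEdges a (greedy cs (rem, ch)).2.2) N A B + s := by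
      intro u v r hd A B hAB hu hv ha
      have h1 := hsat u v r hd A B hAB hu hv
      rw [hmono]
      by_cases hcut : cutVal (E ++ starEdges a ch) N A B + s < r
      · obtain ⟨C, hC, hCA⟩ := exists_mem_cores hsat hD hU' hd hAB hu hv ha hcut
        rcases hhit C hC with h2 | ⟨i, hi, hiC⟩
        · rw [hdone] at h2
          simp at h2
        · have h2 := one_le_load hi (hCA _ hiC) (hc i (hnewitems i hi))
          rw [cutVal_starEdges hAB ha]
          omega
      · omega
    intro u v r hd A B hAB hu hv
    rcases Bool.eq_false_or_eq_true (B a) with ha | ha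
    · rcases Bool.eq_false_or_eq_true (A a) with haA | haA
      · -- The complementary biset separates the same demand and does not contain the center.
        have := key v u r hd.symm (fun x => !B x) (fun x => !A x) (fun x hx => by
          have := hAB x
          cases hA : A x <;> simp_all) (by simp [hv]) (by simp [hu]) (by simp [haA])
        rwa [cutVal_compl] at this
      · have h1 := hopt u v r hd A B hAB hu hv
        rw [cutVal_append, cutVal_starEdges_of_boundary haA ha] at h1
        rw [cutVal_append]
        omega
    · exact key u v r hd A B hAB hu hv ha
  · have h1 := hinv.cost
    rw [hdone] at h1
    have h2 : potential (rem.filter O) [] = 0 := by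
      simp [potential, hitCount]
    have h3 : potential (rem.filter O) cs ≤ harmonic Δ * totalCost (rem.filter O) := by
      unfold potential totalCost
      generalize rem.filter O = l
      induction l with
      | nil => simp
      | cons i l ih =>
        simp only [List.map_cons, List.sum_cons]
        push_cast
        rw [mul_add]
        have h4 : harmonic (hitCount cs i) ≤ harmonic Δ := harmonic_mono (hΔ i.node)
        have h5 := mul_le_mul_of_nonneg_left h4 (Nat.cast_nonneg (α := ℚ) i.cost)
        push_cast at ih
        linarith
    have h4 : totalCost (rem.filter O) ≤ totalCost (items.filter O) := by
      have := ((hperm.filter O).map Item.cost).sum_eq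
      rw [List.filter_append, List.map_append, List.sum_append] at this
      unfold totalCost
      omega
    have h4' : (totalCost (rem.filter O) : ℚ) ≤ totalCost (items.filter O) := by exact_mod_cast h4
    have h5 : discount p s * potential (rem.filter O) cs
        ≤ discount p s * (harmonic Δ * totalCost (items.filter O)) := by
      refine mul_le_mul_of_nonneg_left (h3.trans ?_) (discount_nonneg p s)
      exact mul_le_mul_of_nonneg_left h4' (harmonic_nonneg Δ)
    rw [h2, mul_zero, add_zero] at h1
    calc _ ≤ _ := h1
      _ ≤ totalCost ch + discount p s * (harmonic Δ * totalCost (items.filter O)) := by gcongr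
      _ = _ := by ring

end Phase

/-! ### The augmentation algorithm -/

/-- The maximum requirement. -/
def maxReq (D : List (ℕ × ℕ × ℕ)) : ℕ := D.foldl (fun m d => cond (decide (m ≤ d.2.2)) d.2.2 m) 0

theorem maxReq_le_iff {D : List (ℕ × ℕ × ℕ)} {k : ℕ} : maxReq D ≤ k ↔ ∀ d ∈ D, d.2.2 ≤ k := by
  have key : ∀ m, D.foldl (fun m d => cond (decide (m ≤ d.2.2)) d.2.2 m) m ≤ k ↔
      m ≤ k ∧ ∀ d ∈ D, d.2.2 ≤ k := by
    induction D with
    | nil => simp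
    | cons d D ih =>
      intro m
      rw [List.foldl_cons, ih, List.forall_mem_cons]
      by_cases h : m ≤ d.2.2
      · simp only [h, decide_true, cond_true]
        exact ⟨fun h' => ⟨h.trans h'.1, h'⟩, fun h' => h'.2⟩
      · simp only [h, decide_false, cond_false]
        exact ⟨fun h' => ⟨h'.1, by omega, h'.2⟩, fun h' => ⟨h'.1, h'.2.2⟩⟩
  have h := key 0
  simp only [Nat.zero_le, true_and] at h
  exact h

/-- A unary bound, larger than the number of edges. -/
def edgeUnits (E : List (ℕ × ℕ)) (items : List Item) : List ℕ :=
  0 :: (E.map (fun _ => 0) ++ items.flatMap Item.copies)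

theorem length_edgeUnits (E : List (ℕ × ℕ)) (items : List Item) :
    (edgeUnits E items).length = E.length + (items.flatMap Item.copies).length + 1 := by
  simp [edgeUnits]

/-- The phases: the `i`-th one satisfies the requirements lowered by `k - 1 - i`. If there are more
phases than edges, then there is no feasible solution. -/
def runPhases (E : List (ℕ × ℕ)) (N : List ℕ) (D : List (ℕ × ℕ × ℕ)) (a : ℕ) (items : List Item)
    (U : List ℕ) (k : ℕ) : List Item × List Item :=
  (List.range U.length).foldl (fun st i =>
    cond (decide (i < k)) (phase E N D a U (k - 1 - i) st) st) (items, [])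

/-- The items bought by the algorithm. -/
def solve (E : List (ℕ × ℕ)) (N : List ℕ) (D : List (ℕ × ℕ × ℕ)) (a : ℕ) (items : List Item) :
    List Item :=
  (runPhases E N D a items (edgeUnits E items) (maxReq D)).2

section Solve

variable {E : List (ℕ × ℕ)} {N : List ℕ} {D : List (ℕ × ℕ × ℕ)} {a : ℕ}
  {items : List Item} {O : Item → Bool}

theorem Demand.le_maxReq {u v r : ℕ} (h : Demand D u v r) : r ≤ maxReq D := by
  rcases h with h | h
  · exact maxReq_le_iff.1 le_rfl _ h
  · exact maxReq_le_iff.1 le_rfl _ h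

/-- If the graph satisfies all requirements, then nothing is bought. -/
theorem solve_eq_nil (hD : ∀ u v r, Demand D u v r → u ≠ v) (h : Satisfied E N D 0) :
    solve E N D a items = [] := by
  have h0 : E ++ starEdges a [] = E := by simp [starEdges]
  have key : ∀ L : List ℕ, L.foldl (fun st i => cond (decide (i < maxReq D))
      (phase E N D a (edgeUnits E items) (maxReq D - 1 - i) st) st) (items, []) = (items, []) := by
    intro L
    induction L with
    | nil => rfl
    | cons i L ih =>
      rw [List.foldl_cons]
      have : phase E N D a (edgeUnits E items) (maxReq D - 1 - i) (items, []) = (items, []) := by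
        refine phase_eq_self hD ?_ ?_
        · intro u v r hd A B hAB hu hv
          rw [h0]
          exact (h u v r hd A B hAB hu hv).trans (by omega)
        · rw [h0, length_edgeUnits]
          omega
      rw [this]
      simp only [Bool.cond_self]
      exact ih
  rw [solve, runPhases, key]

/-- The algorithm buys a solution whose cost is at most the sum over the phases of the greedy ratio
`H(Δ)` times the discount, relative to any solution `O`. -/
theorem solve_spec (hD : ∀ u v r, Demand D u v r → u ≠ v) (hN : ∀ u v r, Demand D u v r → u ∈ N)
    (hc : ∀ i ∈ items, i.copies ≠ [])
    (hopt : Satisfied (E ++ starEdges a (items.filter O)) N D 0)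
    {p : ℕ} (hp : ∀ i ∈ items, i.copies.length ≤ p)
    {Δ : ℕ → ℕ} (hΔ : Δ = degBound ∨
      (Δ = rootedDegBound ∧ ∀ u v r, Demand D u v r → u = a ∨ v = a)) :
    (solve E N D a items).Subperm items ∧
    Satisfied (E ++ starEdges a (solve E N D a items)) N D 0 ∧
    (totalCost (solve E N D a items) : ℚ)
      ≤ nodeRatio Δ (maxReq D) p * totalCost (items.filter O) := by
  set k := maxReq D with hk
  set U := edgeUnits E items with hUdef
  have hU : E.length + (items.flatMap Item.copies).length < U.length := by
    rw [hUdef, length_edgeUnits]; omega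
  have key : ∀ m, ∀ st, (List.range m).foldl (fun st i =>
      cond (decide (i < k)) (phase E N D a U (k - 1 - i) st) st) (items, []) = st →
      (st.1 ++ st.2).Perm items ∧ Satisfied (E ++ starEdges a st.2) N D (k - m) ∧
      (totalCost st.2 : ℚ) ≤ (∑ i ∈ Finset.range (min m k),
        harmonic (Δ (i + 1)) * discount p (k - 1 - i)) * totalCost (items.filter O) := by
    intro m
    induction m with
    | zero =>
      rintro st rfl
      refine ⟨by simp, fun u v r hd A B hAB hu hv => ?_, by simp [totalCost]⟩
      exact hd.le_maxReq.trans (by omega)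
    | succ m ih =>
      rintro st rfl
      obtain ⟨h1, h2, h3⟩ := ih _ rfl
      rw [List.range_succ, List.foldl_append, List.foldl_cons, List.foldl_nil]
      generalize (List.range m).foldl (fun st i =>
        cond (decide (i < k)) (phase E N D a U (k - 1 - i) st) st) (items, []) = st at h1 h2 h3
      by_cases hm : m < k
      · simp only [hm, decide_true, cond_true]
        obtain ⟨rem, ch⟩ := st
        have hs : k - m = k - 1 - m + 1 := by omega
        rw [hs] at h2
        have hdeg := length_filter_cores_le h2 hD hN (l := m + 1) (U := U) (a := a)
          (fun u v r hd => by have := hd.le_maxReq; omega) (length_add_starEdges_lt hU h1)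
        have hdeg' : ∀ z, ((cores (E ++ starEdges a ch) N D a U (k - 1 - m)).filter
            fun C => decide (z ∈ C)).length ≤ Δ (m + 1) := by
          intro z
          rcases hΔ with rfl | ⟨rfl, hroot⟩
          · exact (hdeg z).1
          · exact (hdeg z).2 hroot
        obtain ⟨h4, h5, h6⟩ := phase_spec hD hU hc h1 h2 hopt hp hdeg'
        refine ⟨h4, by rwa [show k - (m + 1) = k - 1 - m by omega], h6.trans ?_⟩
        rw [show min (m + 1) k = m + 1 by omega, Finset.sum_range_succ, add_mul]
        rw [show min m k = m by omega] at h3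
        linarith
      · simp only [hm, decide_false, cond_false]
        refine ⟨h1, by rwa [show k - (m + 1) = k - m by omega], ?_⟩
        rwa [show min (m + 1) k = min m k by omega]
  -- A feasible requirement is at most the degree of its end, hence smaller than the number of phases.
  have hkU : k ≤ U.length := by
    refine maxReq_le_iff.2 fun d hd => ?_
    have hd' : Demand D d.1 d.2.1 d.2.2 := .inl hd
    have h1 := hopt _ _ _ hd' (fun x => decide (x = d.1)) (fun x => decide (x = d.1))
      (fun _ h => h) (by simp) (by simpa using (hD _ _ _ hd').symm)
    have h2 := cutVal_singleton_le (E ++ starEdges a (items.filter O)) N d.1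
    rw [List.length_append, length_starEdges] at h2
    have h3 : ((items.filter O).flatMap Item.copies).length ≤ (items.flatMap Item.copies).length := by
      rw [List.length_flatMap, List.length_flatMap]
      exact (List.filter_sublist.map _).sum_le_sum fun _ _ => Nat.zero_le _
    omega
  obtain ⟨h1, h2, h3⟩ := key U.length _ rfl
  refine ⟨(List.sublist_append_right _ _).subperm.trans h1.subperm,
    by rwa [Nat.sub_eq_zero_of_le hkU] at h2, h3.trans (le_of_eq ?_)⟩
  rw [min_eq_right hkU, nodeRatio_eq]

end Solve

/-! ### The algorithm runs in polynomial time -/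

theorem residualArcs_snd_le {β V : Type} [DecidableEq V] (s t : V) (R : List (V × V))
    (U : List β) :
    (residualArcs s t R U).2 ≤ U.length := by
  unfold residualArcs
  suffices h : ∀ p : List (V × V) × ℕ,
      (U.foldl (fun p _ => augment s t p) p).2 ≤ p.2 + U.length by
    simpa using h (R, 0)
  induction U with
  | nil => simp
  | cons x U ih =>
    intro p
    have h1 := ih (augment s t p)
    have h2 : (augment s t p).2 ≤ p.2 + 1 := by
      unfold augment
      cases decide (t ∈ treeNodes s (searchTree s p.1)) <;> simp
    rw [List.foldl_cons, List.length_cons]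
    omega

theorem greedyStep_sublist_perm (st : GreedyState) : (greedyStep st).1.Sublist st.1 ∧
    ((greedyStep st).2.1 ++ (greedyStep st).2.2).Perm (st.2.1 ++ st.2.2) := by
  unfold greedyStep
  cases h : bestItems st.1 st.2.1 with
  | nil => exact ⟨.refl _, .refl _⟩
  | cons i l =>
    have hi : i ∈ st.2.1 := (mem_bestItems_iff.1 (h ▸ List.mem_cons_self)).1
    exact ⟨List.filter_sublist, List.perm_middle.trans
      ((List.perm_cons_erase hi).symm.append_right _)⟩

theorem greedy_rounds_sublist_perm {β : Type} (L : List β) (st : GreedyState) :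
    (L.foldl (fun st _ => greedyStep st) st).1.Sublist st.1 ∧
    ((L.foldl (fun st _ => greedyStep st) st).2.1 ++
      (L.foldl (fun st _ => greedyStep st) st).2.2).Perm (st.2.1 ++ st.2.2) := by
  induction L generalizing st with
  | nil => exact ⟨.refl _, .refl _⟩
  | cons x L ih =>
    obtain ⟨h1, h2⟩ := greedyStep_sublist_perm st
    obtain ⟨h3, h4⟩ := ih (greedyStep st)
    exact ⟨h3.trans h1, h4.trans h2⟩

namespace PolyTime

section
variable {α β σ V : Type} [ToVal α] [ToVal β] [ToVal σ] [ToVal V]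

/-- Folding over a list runs in polynomial time if all intermediate results are smaller than some
polynomially bounded function. -/
theorem foldl_of_le {f : α → σ → β → σ} {init : α → σ} {l : α → List β} {g : α → ℕ}
    (hg : PolyBound g)
    (hf : PolyTime fun p : (α × σ) × β => f p.1.1 p.1.2 p.2) (hi : PolyTime init) (hl : PolyTime l)
    (h : ∀ a l₁ l₂, l a = l₁ ++ l₂ → vsize (l₁.foldl (f a) (init a)) ≤ g a) :
    PolyTime fun a => (l a).foldl (f a) (init a) := by
  obtain ⟨T, hT⟩ := hg
  exact foldl hf hi hl ⟨T, fun a l₁ l₂ h' => (h a l₁ l₂ h').trans (hT a)⟩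

@[fun_prop]
theorem treeNodes {s : α → V} {T : α → List (V × V)} (hs : PolyTime s) (hT : PolyTime T) :
    PolyTime fun a => treeNodes (s a) (T a) := by
  unfold _root_.treeNodes
  fun_prop

theorem vsize_swap (e : V × V) : vsize e.swap = vsize e := by
  obtain ⟨x, y⟩ := e
  simp only [Prod.swap, vsize_pair]
  omega

@[fun_prop]
theorem swap {f : α → V × β} (hf : PolyTime f) : PolyTime fun a => (f a).swap := by
  unfold Prod.swap
  fun_prop

variable [DecidableEq V]

@[fun_prop]
theorem addArc {s : α → V} {T : α → List (V × V)} {e : α → V × V} (hs : PolyTime s)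
    (hT : PolyTime T) (he : PolyTime e) : PolyTime fun a => addArc (s a) (T a) (e a) := by
  unfold _root_.addArc
  fun_prop

theorem vsize_foldl_addArc_le (s : V) (L T : List (V × V)) :
    vsize (L.foldl (_root_.addArc s) T) ≤ vsize T + vsize L := by
  induction L generalizing T with
  | nil => simp
  | cons e L ih =>
    have h : vsize (_root_.addArc s T e) ≤ vsize e + vsize T + 1 := by
      unfold _root_.addArc
      cases decide (e.1 ∈ _root_.treeNodes s T) && !decide (e.2 ∈ _root_.treeNodes s T)
      · simp only [cond_false]; omega
      · rfl
    have := ih (_root_.addArc s T e)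
    rw [List.foldl_cons, vsize_cons]
    omega

@[fun_prop]
theorem growTree {s : α → V} {R T : α → List (V × V)} (hs : PolyTime s) (hR : PolyTime R)
    (hT : PolyTime T) : PolyTime fun a => growTree (s a) (R a) (T a) := by
  refine foldl_of_le (hT.polyBound.add hR.polyBound) ?_ hT hR fun a l₁ l₂ h => ?_
  · exact addArc (comp hs (by fun_prop)) (by fun_prop) (by fun_prop)
  · have h1 := vsize_foldl_addArc_le (s a) l₁ (T a)
    have h2 : vsize l₁ ≤ vsize (R a) := by rw [h]; exact (List.sublist_append_left _ _).vsize_le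
    omega

@[fun_prop]
theorem searchTree {s : α → V} {R : α → List (V × V)} (hs : PolyTime s) (hR : PolyTime R) :
    PolyTime fun a => searchTree (s a) (R a) := by
  refine foldl_of_le hR.polyBound ?_ (const []) hR fun a l₁ l₂ h => ?_
  · exact growTree (comp hs (by fun_prop)) (comp hR (by fun_prop)) (by fun_prop)
  · exact (isTree_rounds (s a) (R a) l₁).subperm.vsize_le

theorem vsize_reversePath_le (t : V) (R T : List (V × V)) :
    vsize (reversePath t R T) ≤ vsize t + vsize R + 2 * vsize T + 1 := by
  unfold reversePath
  suffices h : ∀ p : V × List (V × V), vsize (T.foldl (fun p e => cond (decide (e.2 = p.1))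
      (e.1, e.swap :: p.2.erase e) p) p).1 ≤ vsize p.1 + vsize T ∧
      vsize (T.foldl (fun p e => cond (decide (e.2 = p.1))
      (e.1, e.swap :: p.2.erase e) p) p).2 ≤ vsize p.2 + vsize T by
    obtain ⟨h1, h2⟩ := h (t, R)
    refine (le_of_eq (vsize_pair _ _)).trans ?_
    simp only at h1 h2
    omega
  induction T with
  | nil => simp
  | cons e T ih =>
    intro p
    rw [List.foldl_cons, vsize_cons]
    obtain ⟨h1, h2⟩ := ih (cond (decide (e.2 = p.1)) (e.1, e.swap :: p.2.erase e) p)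
    have he : vsize e = vsize e.1 + vsize e.2 + 1 := rfl
    have h3 := (List.erase_sublist (a := e) (l := p.2)).vsize_le
    have h4 := vsize_swap e
    by_cases h : e.2 = p.1
    · simp only [h, decide_true, cond_true, vsize_cons] at h1 h2 ⊢
      omega
    · simp only [h, decide_false, cond_false] at h1 h2 ⊢
      omega

@[fun_prop]
theorem reversePath {t : α → V} {R T : α → List (V × V)} (ht : PolyTime t) (hR : PolyTime R)
    (hT : PolyTime T) : PolyTime fun a => reversePath (t a) (R a) (T a) := by
  refine foldl_of_le (((ht.polyBound.add hR.polyBound).add ((PolyBound.const 2).mul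
    hT.polyBound)).add (.const 1)) ?_ (prodMk ht hR) hT fun a l₁ l₂ h => ?_
  · exact bcond (decEq (by fun_prop) (by fun_prop)) (by fun_prop) (by fun_prop)
  · have h1 := vsize_reversePath_le (t a) (R a) l₁
    have h2 : vsize l₁ ≤ vsize (T a) := by rw [h]; exact (List.sublist_append_left _ _).vsize_le
    unfold _root_.reversePath at h1
    omega

@[fun_prop]
theorem augment {s t : α → V} {p : α → List (V × V) × ℕ} (hs : PolyTime s) (ht : PolyTime t)
    (hp : PolyTime p) : PolyTime fun a => augment (s a) (t a) (p a) := by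
  unfold _root_.augment
  fun_prop

theorem _root_.Reoriented.vsize_eq {R R' : List (V × V)} (h : Reoriented R R') :
    vsize R' = vsize R := by
  induction h with
  | refl => rfl
  | tail _ h ih =>
    obtain ⟨e, he, rfl⟩ := h
    rw [← ih, (List.perm_cons_erase he).vsize_eq, vsize_cons, vsize_cons, vsize_swap]

@[fun_prop]
theorem residualArcs {s t : α → V} {R : α → List (V × V)} {U : α → List β} (hs : PolyTime s)
    (ht : PolyTime t) (hR : PolyTime R) (hU : PolyTime U) :
    PolyTime fun a => residualArcs (s a) (t a) (R a) (U a) := by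
  refine foldl_of_le ((hR.polyBound.add hU.polyBound).add (.const 1)) ?_ (prodMk hR (const 0)) hU
    fun a l₁ l₂ h => ?_
  · exact augment (comp hs (by fun_prop)) (comp ht (by fun_prop)) (by fun_prop)
  · have h1 := (residualArcs_spec (s a) (t a) (R a) l₁).1.vsize_eq
    have h2 := residualArcs_snd_le (s a) (t a) (R a) l₁
    have h3 := vsize_nat_le (_root_.residualArcs (s a) (t a) (R a) l₁).2
    have h4 : l₁.length ≤ (U a).length := by rw [h]; simp
    have h5 := length_lt_vsize (U a)
    change vsize (_root_.residualArcs (s a) (t a) (R a) l₁).1 +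
      vsize (_root_.residualArcs (s a) (t a) (R a) l₁).2 + 1 ≤ _
    omega

@[fun_prop]
theorem minCut {s t : α → V} {R : α → List (V × V)} {U : α → List β} (hs : PolyTime s)
    (ht : PolyTime t) (hR : PolyTime R) (hU : PolyTime U) :
    PolyTime fun a => minCut (s a) (t a) (R a) (U a) := by
  unfold _root_.minCut
  fun_prop

end

section
variable {α β : Type} [ToVal α] [ToVal β] {E : α → List (ℕ × ℕ)} {N : α → List ℕ}
  {D : α → List (ℕ × ℕ × ℕ)} {c s : α → ℕ} {U : α → List β} {d : α → ℕ × ℕ × ℕ}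

@[fun_prop]
theorem network (hE : PolyTime E) (hN : PolyTime N) : PolyTime fun a => network (E a) (N a) := by
  unfold _root_.network
  fun_prop

@[fun_prop]
theorem reachSet (hE : PolyTime E) (hN : PolyTime N) (hU : PolyTime U) (hd : PolyTime d) :
    PolyTime fun a => reachSet (E a) (N a) (U a) (d a) := by
  unfold _root_.reachSet
  fun_prop

@[fun_prop]
theorem flowValue (hE : PolyTime E) (hN : PolyTime N) (hU : PolyTime U) (hd : PolyTime d) :
    PolyTime fun a => flowValue (E a) (N a) (U a) (d a) := by
  unfold _root_.flowValue
  fun_prop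

@[fun_prop]
theorem coreOf (hE : PolyTime E) (hN : PolyTime N) (hc : PolyTime c) (hU : PolyTime U)
    (hs : PolyTime s) (hd : PolyTime d) :
    PolyTime fun a => coreOf (E a) (N a) (c a) (U a) (s a) (d a) := by
  have hlt := decLT (add (flowValue hE hN hU hd) hs) (snd (snd hd))
  unfold _root_.coreOf
  exact bcond (and hlt (by fun_prop)) (by fun_prop) (const [])

@[fun_prop]
theorem insertMinimal {l : α → List (List ℕ)} {C : α → List ℕ} (hl : PolyTime l)
    (hC : PolyTime C) : PolyTime fun a => insertMinimal (l a) (C a) := by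
  unfold _root_.insertMinimal
  fun_prop

@[fun_prop]
theorem minimalSets {l : α → List (List ℕ)} (hl : PolyTime l) :
    PolyTime fun a => minimalSets (l a) := by
  refine foldl_of_le hl.polyBound (by fun_prop) (const []) hl fun a l₁ l₂ h => ?_
  refine (foldl_insertMinimal_subperm (List.Subperm.refl []) l₁).vsize_le.trans ?_
  rw [h]
  exact (List.sublist_append_left _ _).vsize_le

@[fun_prop]
theorem cores (hE : PolyTime E) (hN : PolyTime N) (hD : PolyTime D) (hc : PolyTime c)
    (hU : PolyTime U) (hs : PolyTime s) :
    PolyTime fun a => cores (E a) (N a) (D a) (c a) (U a) (s a) := by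
  unfold _root_.cores
  fun_prop

@[fun_prop]
theorem node {i : α → Item} (hi : PolyTime i) : PolyTime fun a => (i a).node := by
  unfold Item.node
  fun_prop

@[fun_prop]
theorem cost {i : α → Item} (hi : PolyTime i) : PolyTime fun a => (i a).cost := by
  unfold Item.cost
  fun_prop

@[fun_prop]
theorem copies {i : α → Item} (hi : PolyTime i) : PolyTime fun a => (i a).copies := by
  unfold Item.copies
  fun_prop

@[fun_prop]
theorem hitCount {cs : α → List (List ℕ)} {i : α → Item} (hcs : PolyTime cs) (hi : PolyTime i) :
    PolyTime fun a => hitCount (cs a) (i a) := by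
  unfold _root_.hitCount
  fun_prop

@[fun_prop]
theorem bestItems {cs : α → List (List ℕ)} {rem : α → List Item} (hcs : PolyTime cs)
    (hrem : PolyTime rem) : PolyTime fun a => bestItems (cs a) (rem a) := by
  unfold _root_.bestItems
  fun_prop

@[fun_prop]
theorem greedyStep {st : α → GreedyState} (hst : PolyTime st) :
    PolyTime fun a => greedyStep (st a) := by
  have : PolyTime fun st : GreedyState => _root_.greedyStep st := by
    unfold _root_.greedyStep GreedyState
    exact lcase (by fun_prop) (by fun_prop) (by fun_prop)
  exact comp this hst

theorem vsize_eq_of_perm {st st' : List Item × List Item}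
    (h : (st'.1 ++ st'.2).Perm (st.1 ++ st.2)) : vsize st' = vsize st := by
  have h1 := h.vsize_eq
  have h2 := vsize_append st'.1 st'.2
  have h3 := vsize_append st.1 st.2
  have h4 : vsize st' = vsize st'.1 + vsize st'.2 + 1 := rfl
  have h5 : vsize st = vsize st.1 + vsize st.2 + 1 := rfl
  omega

@[fun_prop]
theorem greedy {cs : α → List (List ℕ)} {st : α → List Item × List Item} (hcs : PolyTime cs)
    (hst : PolyTime st) : PolyTime fun a => greedy (cs a) (st a) := by
  refine foldl_of_le ((hcs.polyBound.add hst.polyBound).add (.const 1)) (by fun_prop)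
    (prodMk hcs hst) hcs fun a l₁ l₂ h => ?_
  obtain ⟨h1, h2⟩ := greedy_rounds_sublist_perm l₁ (cs a, st a)
  refine (le_of_eq (vsize_pair _ _)).trans ?_
  rw [vsize_eq_of_perm h2]
  have := h1.vsize_le
  simp only at this ⊢
  omega

@[fun_prop]
theorem starEdges {l : α → List Item} (hc : PolyTime c) (hl : PolyTime l) :
    PolyTime fun a => starEdges (c a) (l a) := by
  unfold _root_.starEdges
  fun_prop

@[fun_prop]
theorem phase {st : α → List Item × List Item} (hE : PolyTime E) (hN : PolyTime N)
    (hD : PolyTime D) (hc : PolyTime c) (hU : PolyTime U) (hs : PolyTime s) (hst : PolyTime st) :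
    PolyTime fun a => phase (E a) (N a) (D a) (c a) (U a) (s a) (st a) := by
  unfold _root_.phase
  fun_prop

@[fun_prop]
theorem maxReq (hD : PolyTime D) : PolyTime fun a => maxReq (D a) := by
  refine foldl_of_le hD.polyBound (by fun_prop) (const 0) hD fun a l₁ l₂ h => ?_
  have key : ∀ (L : List (ℕ × ℕ × ℕ)) (m : ℕ), vsize (L.foldl (fun m d =>
      cond (decide (m ≤ d.2.2)) d.2.2 m) m) < vsize m + vsize L := by
    intro L
    induction L with
    | nil => intro m; simp
    | cons d L ih =>
      intro m
      have h1 := ih (cond (decide (m ≤ d.2.2)) d.2.2 m)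
      have h2 : vsize d = vsize d.1 + (vsize d.2.1 + vsize d.2.2 + 1) + 1 := rfl
      rw [List.foldl_cons, vsize_cons]
      by_cases h : m ≤ d.2.2
      · simp only [h, decide_true, cond_true] at h1 ⊢
        omega
      · simp only [h, decide_false, cond_false] at h1 ⊢
        omega
  have h1 := key l₁ 0
  have h2 : vsize l₁ ≤ vsize (D a) := by rw [h]; exact (List.sublist_append_left _ _).vsize_le
  have h3 : vsize 0 = 1 := by simp [vsize_nat]
  omega

@[fun_prop]
theorem edgeUnits {items : α → List Item} (hE : PolyTime E) (hi : PolyTime items) :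
    PolyTime fun a => edgeUnits (E a) (items a) := by
  unfold _root_.edgeUnits
  fun_prop

@[fun_prop]
theorem runPhases {items : α → List Item} {U : α → List ℕ} {k : α → ℕ} (hE : PolyTime E)
    (hN : PolyTime N) (hD : PolyTime D) (hc : PolyTime c) (hi : PolyTime items) (hU : PolyTime U)
    (hk : PolyTime k) :
    PolyTime fun a => runPhases (E a) (N a) (D a) (c a) (items a) (U a) (k a) := by
  have hst : PolyTime fun a => (items a, ([] : List Item)) := by fun_prop
  refine foldl_of_le hst.polyBound ?_ hst (range_length hU) fun a l₁ l₂ h => ?_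
  · have hg : PolyTime fun p : (α × List Item × List Item) × ℕ => p.1.1 := by fun_prop
    have hE' := comp hE hg
    have hN' := comp hN hg
    have hD' := comp hD hg
    have hc' := comp hc hg
    have hU' := comp hU hg
    have hk' := comp hk hg
    fun_prop
  · refine (vsize_eq_of_perm ?_).le
    generalize (items a, ([] : List Item)) = st
    clear h
    induction l₁ generalizing st with
    | nil => exact .refl _
    | cons i L ih =>
      refine (ih _).trans ?_
      beta_reduce
      cases decide (i < k a)
      · exact .refl _
      · exact (greedy_rounds_sublist_perm _ _).2

@[fun_prop]
theorem solve {items : α → List Item} (hE : PolyTime E) (hN : PolyTime N) (hD : PolyTime D)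
    (hc : PolyTime c) (hi : PolyTime items) :
    PolyTime fun a => solve (E a) (N a) (D a) (c a) (items a) := by
  unfold _root_.solve
  fun_prop

end

end PolyTime

/-! ### Connectivity of encoded graphs -/

/-- Max-flow min-cut with the nodes replaced by numbers. -/
theorem le_qConnectivity_iff_comp {V ι : Type} [Fintype ι] [DecidableEq V] [Fintype V]
    (ends : ι → V × V) (q : V → ℕ) {s t : V} (hst : s ≠ t) {φ : V → ℕ}
    (hφ : Function.Injective φ) (r : ℕ) :
    r ≤ qConnectivity ends q s t ↔ ∀ A B : ℕ → Bool, (∀ x, A x = true → B x = true) →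
      A (φ s) = true → B (φ t) = false →
      r ≤ bisetCut ends q (fun w => A (φ w)) (fun w => B (φ w)) := by
  classical
  rw [le_qConnectivity_iff ends q hst]
  constructor
  · exact fun h A B hAB hs ht => h _ _ (fun w => hAB _) hs ht
  · intro h A B hAB hs ht
    have key : ∀ A : V → Bool, (fun w => decide (∃ v, φ v = φ w ∧ A v = true)) = A := by
      intro A
      funext w
      rw [Bool.eq_iff_iff, decide_eq_true_eq]
      constructor
      · rintro ⟨v, hv, hA⟩
        rwa [← hφ hv]
      · exact fun hA => ⟨w, rfl, hA⟩
    have := h (fun x => decide (∃ v, φ v = x ∧ A v = true))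
      (fun x => decide (∃ v, φ v = x ∧ B v = true)) (fun x hx => by
        obtain ⟨v, hv, hA⟩ := of_decide_eq_true hx
        exact decide_eq_true ⟨v, hv, hAB v hA⟩) (decide_eq_true ⟨s, rfl, hs⟩)
      ((congrFun (key B) t).trans ht)
    rwa [key A, key B] at this

theorem sum_map_range (n : ℕ) (g : ℕ → ℕ) : ((List.range n).map g).sum = ∑ i : Fin n, g i := by
  rw [← Finset.sum_range]
  rfl

theorem countP_eq_sum_get {α : Type} (l : List α) (p : α → Bool) :
    l.countP p = ∑ i : Fin l.length, (p (l.get i)).toNat := by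
  induction l with
  | nil => rfl
  | cons a l ih =>
    rw [List.countP_cons, ih]
    simp only [List.length_cons]
    rw [Fin.sum_univ_succ, Nat.add_comm]
    congr 1
    by_cases h : p a = true <;> simp [h]

/-- Truncating weights at `M` leaves a weighted sum unchanged or at least `M`. -/
theorem sum_mul_min_eq_or {ι : Type} (s : Finset ι) (g : ι → Bool) (a : ι → ℕ) (M : ℕ) :
    ∑ i ∈ s, (g i).toNat * min (a i) M = ∑ i ∈ s, (g i).toNat * a i ∨
      M ≤ ∑ i ∈ s, (g i).toNat * min (a i) M := by
  by_cases h : ∃ i ∈ s, g i = true ∧ M ≤ a i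
  · obtain ⟨i, hi, hg, ha⟩ := h
    right
    have := Finset.single_le_sum (f := fun i => (g i).toNat * min (a i) M)
      (fun i _ => Nat.zero_le _) hi
    simpa [hg, ha] using this
  · left
    refine Finset.sum_congr rfl fun i hi => ?_
    by_cases hg : g i = true
    · have : ¬ M ≤ a i := fun ha => h ⟨i, hi, hg, ha⟩
      rw [min_eq_left (by omega)]
    · simp [hg]

theorem sum_mul_min_le {ι : Type} (s : Finset ι) (g : ι → Bool) (a : ι → ℕ) (M : ℕ) :
    ∑ i ∈ s, (g i).toNat * min (a i) M ≤ ∑ i ∈ s, (g i).toNat * a i :=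
  Finset.sum_le_sum fun _ _ => Nat.mul_le_mul_left _ (min_le_left _ _)

/-- The list of nodes in which `w` occurs `min (q w) U.length` times. -/
def nodeUnits {β : Type} (q : List ℕ) (U : List β) : List ℕ :=
  (List.range q.length).flatMap fun w =>
    ((List.range U.length).filter fun i => decide (i < q.getD w 0)).map fun _ => w

theorem length_filter_range_lt (m k : ℕ) :
    ((List.range m).filter fun i => decide (i < k)).length = min k m := by
  induction m with
  | zero => simp
  | succ m ih =>
    rw [List.range_succ, List.filter_append, List.length_append, ih]
    by_cases h : m < k <;> simp [h] <;> omega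

theorem countP_nodeUnits {β : Type} {n : ℕ} (q : Fin n → ℕ) (U : List β) (p : ℕ → Bool) :
    (nodeUnits (List.ofFn q) U).countP p = ∑ w : Fin n, (p w).toNat * min (q w) U.length := by
  rw [nodeUnits, List.countP_flatMap, List.length_ofFn, sum_map_range]
  refine Finset.sum_congr rfl fun w _ => ?_
  have h1 : (List.ofFn q).getD w 0 = q w := by simp
  rw [Function.comp_apply, List.countP_map, h1]
  by_cases h : p w = true
  · have : (p ∘ fun _ : ℕ => (w : ℕ)) = fun _ => true := by funext; exact h
    simp [this, h, ← length_filter_range_lt, List.countP_eq_length_filter]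
  · simp only [Bool.not_eq_true] at h
    have : (p ∘ fun _ : ℕ => (w : ℕ)) = fun _ => false := by funext; exact h
    simp [this, h]

theorem mem_nodeUnits {β : Type} {n : ℕ} {q : Fin n → ℕ} {U : List β} (hU : 1 ≤ U.length) {w : Fin n}
    (hq : 1 ≤ q w) : (w : ℕ) ∈ nodeUnits (List.ofFn q) U := by
  simp only [nodeUnits, List.mem_flatMap, List.mem_range, List.mem_map, List.mem_filter]
  exact ⟨w, by simp, 0, ⟨by omega, by simpa using Nat.lt_of_succ_le hq⟩, rfl⟩

@[fun_prop]
theorem PolyTime.nodeUnits {α β : Type} [ToVal α] [ToVal β] {q : α → List ℕ} {U : α → List β}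
    (hq : PolyTime q) (hU : PolyTime U) : PolyTime fun a => nodeUnits (q a) (U a) := by
  unfold _root_.nodeUnits
  fun_prop

/-- One orientation of each demand suffices, by complementation. -/
theorem satisfied_iff {E : List (ℕ × ℕ)} {N : List ℕ} {D : List (ℕ × ℕ × ℕ)} {s : ℕ} :
    Satisfied E N D s ↔ ∀ d ∈ D, ∀ A B : ℕ → Bool, (∀ x, A x = true → B x = true) →
      A d.1 = true → B d.2.1 = false → d.2.2 ≤ cutVal E N A B + s := by
  constructor
  · exact fun h d hd => h _ _ _ (.inl hd)
  · rintro h u v r (hd | hd) A B hAB hu hv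
    · exact h _ hd A B hAB hu hv
    · rw [← cutVal_compl]
      refine h _ hd _ _ (fun x hx => ?_) (by simp [hv]) (by simp [hu])
      have := hAB x
      cases hA : A x <;> simp_all

theorem Satisfied.mono {E L L' : List (ℕ × ℕ)} {N : List ℕ} {D : List (ℕ × ℕ × ℕ)} {s : ℕ}
    (h : Satisfied (E ++ L) N D s) (hL : ∀ p, L.countP p ≤ L'.countP p) :
    Satisfied (E ++ L') N D s := by
  intro u v r hd A B hAB hu hv
  refine (h u v r hd A B hAB hu hv).trans ?_
  unfold cutVal
  simp only [List.countP_append]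
  have h1 := hL fun e => A e.1 && !B e.2
  have h2 := hL fun e => A e.2 && !B e.1
  omega

/-- Pairs of numbers for pairs of nodes. -/
def natPairs {n : ℕ} (E : List (Fin n × Fin n)) : List (ℕ × ℕ) :=
  E.map fun e => ((e.1 : ℕ), (e.2 : ℕ))

theorem length_natPairs {n : ℕ} (E : List (Fin n × Fin n)) : (natPairs E).length = E.length := by
  simp [natPairs]

theorem countP_natPairs {n : ℕ} (E : List (Fin n × Fin n)) (p : ℕ × ℕ → Bool) :
    (natPairs E).countP p = ∑ e : Fin E.length, (p ((E.get e).1, (E.get e).2)).toNat := by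
  rw [natPairs, List.countP_map, countP_eq_sum_get]
  rfl

namespace StarSNA

variable {x : StarSNA} {I : Finset (Fin x.F.length)} {L : List (ℕ × ℕ)}

/-- The demands, with the nodes given as numbers. -/
def demands (x : StarSNA) : List (ℕ × ℕ × ℕ) := x.D.map fun d => ((d.1 : ℕ), (d.2.1 : ℕ), d.2.2)

/-- A list that is longer than the list of edges of each of the graphs `G + I`. -/
def unitsOf (E : List (ℕ × ℕ)) (F : List ℕ) : List ℕ := 0 :: (E.map (fun _ => 0) ++ F)

/-- The units of node capacity, truncated to the number of edges. -/
def capUnits (x : StarSNA) : List ℕ :=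
  nodeUnits (List.ofFn x.q) (unitsOf (natPairs x.E) (x.F.map Fin.val))

theorem length_unitsOf : (unitsOf (natPairs x.E) (x.F.map Fin.val)).length
    = x.E.length + x.F.length + 1 := by
  simp [unitsOf, natPairs]

theorem bisetCut_ends (A B : ℕ → Bool) :
    bisetCut (x.ends I) x.q (fun w => A w) (fun w => B w) =
      (natPairs x.E).countP (fun e => A e.1 && !B e.2) +
      (natPairs x.E).countP (fun e => A e.2 && !B e.1) +
      (∑ i ∈ I, (A x.a && !B (x.F.get i)).toNat + ∑ i ∈ I, (A (x.F.get i) && !B x.a).toNat) +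
      ∑ w : Fin x.n, (B w && !A w).toNat * x.q w := by
  rw [bisetCut, Fintype.sum_sum_type, countP_natPairs, countP_natPairs]
  simp only [ends, Sum.elim_inl, Sum.elim_inr, Finset.sum_add_distrib]
  rw [Finset.sum_coe_sort I fun i => (A x.a && !B (x.F.get i)).toNat,
    Finset.sum_coe_sort I fun i => (A (x.F.get i) && !B x.a).toNat]

theorem cutVal_natPairs (A B : ℕ → Bool) :
    cutVal (natPairs x.E ++ L) x.capUnits A B =
      (natPairs x.E).countP (fun e => A e.1 && !B e.2) +
      (natPairs x.E).countP (fun e => A e.2 && !B e.1) +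
      (L.countP (fun e => A e.1 && !B e.2) + L.countP (fun e => A e.2 && !B e.1)) +
      ∑ w : Fin x.n, (B w && !A w).toNat * min (x.q w) (x.E.length + x.F.length + 1) := by
  rw [cutVal, List.countP_append, List.countP_append, capUnits, countP_nodeUnits, length_unitsOf]
  omega

/-- A requirement that holds in `G + I` is at most the number of edges, so that the truncation of the
node capacities does no harm. -/
theorem satisfied_of_feasible (h : x.Feasible I)
    (hL : ∀ p : ℕ × ℕ → Bool, ∑ i ∈ I, (p ((x.a : ℕ), (x.F.get i : ℕ))).toNat ≤ L.countP p) :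
    Satisfied (natPairs x.E ++ L) x.capUnits x.demands 0 := by
  rw [satisfied_iff]
  intro d' hd' A B hAB hu hv
  obtain ⟨d, hd, rfl⟩ := List.mem_map.1 hd'
  have hc := (le_qConnectivity_iff_comp _ _ (x.D_ne d hd) Fin.val_injective _).1 (h d hd)
  -- The degree of an end bounds the requirement.
  have hr := hc (fun y => decide (y = (d.1 : ℕ))) (fun y => decide (y = (d.1 : ℕ))) (fun _ h => h)
    (by simp) (by simpa [Fin.val_inj] using (x.D_ne d hd).symm)
  have h1 := hc A B hAB hu hv
  rw [bisetCut_ends] at h1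
  rw [bisetCut_ends (fun y => decide (y = (d.1 : ℕ))) (fun y => decide (y = (d.1 : ℕ)))] at hr
  rw [cutVal_natPairs]
  have h2 := hL fun e => A e.1 && !B e.2
  have h3 := hL fun e => A e.2 && !B e.1
  have h4 := sum_mul_min_eq_or Finset.univ (fun w : Fin x.n => B w && !A w) x.q
    (x.E.length + x.F.length + 1)
  have h5 := cutVal_singleton_le (natPairs x.E) [] (d.1 : ℕ)
  have h6 : ∑ i ∈ I, (decide ((x.a : ℕ) = d.1) && !decide ((x.F.get i : ℕ) = d.1)).toNat +
      ∑ i ∈ I, (decide ((x.F.get i : ℕ) = d.1) && !decide ((x.a : ℕ) = d.1)).toNat ≤ I.card := by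
    rw [← Finset.sum_add_distrib, Finset.card_eq_sum_ones]
    refine Finset.sum_le_sum fun i _ => ?_
    cases decide ((x.a : ℕ) = d.1) <;> cases decide ((x.F.get i : ℕ) = d.1) <;> decide
  have h7 : I.card ≤ x.F.length := by simpa using Finset.card_le_univ I
  have h8 : ∑ w : Fin x.n, (decide ((w : ℕ) = d.1) && !decide ((w : ℕ) = d.1)).toNat * x.q w = 0 := by
    simp
  rw [cutVal, length_natPairs] at h5
  simp only [List.countP_nil] at h5
  dsimp only at h1 h2 h3 hr h4 h5 ⊢
  rcases h4 with h4 | h4 <;> omega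

theorem feasible_of_satisfied (h : Satisfied (natPairs x.E ++ L) x.capUnits x.demands 0)
    (hL : ∀ p : ℕ × ℕ → Bool, L.countP p ≤ ∑ i ∈ I, (p ((x.a : ℕ), (x.F.get i : ℕ))).toNat) :
    x.Feasible I := by
  intro d hd
  rw [le_qConnectivity_iff_comp _ _ (x.D_ne d hd) Fin.val_injective]
  intro A B hAB hu hv
  have h1 := satisfied_iff.1 h _ (List.mem_map.2 ⟨d, hd, rfl⟩) A B hAB hu hv
  rw [bisetCut_ends]
  rw [cutVal_natPairs] at h1
  have h2 := hL fun e => A e.1 && !B e.2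
  have h3 := hL fun e => A e.2 && !B e.1
  have h4 := sum_mul_min_le Finset.univ (fun w : Fin x.n => B w && !A w) x.q
    (x.E.length + x.F.length + 1)
  dsimp only at h1 h2 h3 ⊢
  omega

theorem demand_ne {u v r : ℕ} (h : Demand x.demands u v r) : u ≠ v := by
  rcases h with h | h <;>
  · obtain ⟨d, hd, heq⟩ := List.mem_map.1 h
    simp only [Prod.mk.injEq] at heq
    have := x.D_ne d hd
    rw [ne_eq, ← Fin.val_inj] at this
    omega

theorem demand_mem {u v r : ℕ} (h : Demand x.demands u v r) : u ∈ x.capUnits := by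
  rcases h with h | h <;>
  · obtain ⟨d, hd, heq⟩ := List.mem_map.1 h
    simp only [Prod.mk.injEq] at heq
    obtain ⟨h1, h2, -⟩ := heq
    subst h1 h2
    exact mem_nodeUnits (by rw [length_unitsOf]; omega) (x.one_le_q _)

theorem demand_rooted (hx : x.Rooted) {u v r : ℕ} (h : Demand x.demands u v r) :
    u = x.a ∨ v = x.a := by
  rcases h with h | h <;>
  · obtain ⟨d, hd, heq⟩ := List.mem_map.1 h
    simp only [Prod.mk.injEq] at heq
    have := hx d hd
    simp only [Fin.ext_iff] at this
    omega

theorem maxReq_demands : maxReq x.demands = x.k := by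
  have key : ∀ m, maxReq x.demands ≤ m ↔ x.k ≤ m := by
    intro m
    rw [maxReq_le_iff, k, Finset.sup_le_iff]
    simp only [demands, List.forall_mem_map, List.mem_toFinset]
  exact le_antisymm ((key _).2 le_rfl) ((key _).1 le_rfl)

end StarSNA

/-! ### Approximation of star-based augmentation problems -/

theorem edgeRatio_eq (Δ : ℕ → ℕ) (k : ℕ) : edgeRatio Δ k = nodeRatio Δ k 1 := by
  refine Finset.sum_congr rfl fun l hl => ?_
  have h1 := (Finset.mem_Icc.1 hl).2
  have h2 : (l : ℚ) ≤ k := by exact_mod_cast h1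
  rw [Nat.cast_one, min_eq_left, div_eq_mul_one_div]
  rw [div_le_one (by linarith)]
  linarith

theorem nodeRatio_term_nonneg (Δ : ℕ → ℕ) {k l : ℕ} (p : ℕ) (hl : l ≤ k) :
    0 ≤ harmonic (Δ l) * min ((p : ℚ) / ((k : ℚ) - l + 1)) 1 := by
  have h : (l : ℚ) ≤ k := by exact_mod_cast hl
  refine mul_nonneg (harmonic_nonneg _) (le_min (div_nonneg (Nat.cast_nonneg _) ?_) zero_le_one)
  linarith

theorem one_le_nodeRatio {Δ : ℕ → ℕ} {k p : ℕ} (hΔ : 1 ≤ Δ k) (hk : 1 ≤ k) (hp : 1 ≤ p) :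
    1 ≤ nodeRatio Δ k p := by
  refine le_trans ?_ (Finset.single_le_sum
    (f := fun l => harmonic (Δ l) * min ((p : ℚ) / ((k : ℚ) - l + 1)) 1)
    (fun l hl => nodeRatio_term_nonneg Δ p (Finset.mem_Icc.1 hl).2) (Finset.mem_Icc.2 ⟨hk, le_rfl⟩))
  have h1 : harmonic 1 ≤ harmonic (Δ k) := harmonic_mono hΔ
  have h2 : (1 : ℚ) ≤ p := by exact_mod_cast hp
  have h3 : harmonic 1 = 1 := by simp [harmonic]
  rw [sub_self, zero_add, div_one, min_eq_right h2, mul_one]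
  linarith

/-- A program that computes a good solution of every feasible instance from a representation of the
instance witnesses an approximation ratio. -/
theorem MinProblem.admitsRatio_of_polyTime {P : MinProblem} {ρ : P.Inst → ℚ} {α : Type} [ToVal α]
    {f : α → List ℕ} (hf : PolyTime f) (input : P.Inst → α)
    (hinput : ∀ x, toVal (input x) = P.encode x) (sol : ∀ x, P.Sol x)
    (h : ∀ x S', P.Feasible x S' → P.Represents x (.ofNats (f (input x))) (sol x) ∧
      P.Feasible x (sol x) ∧ (P.cost x (sol x) : ℚ) ≤ ρ x * P.cost x S') : P.AdmitsRatio ρ := by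
  obtain ⟨c, T, hc⟩ := hf
  refine ⟨c, T, fun x => ?_⟩
  obtain ⟨t, hrun, ht⟩ := hc (input x)
  rw [hinput x] at hrun
  refine ⟨_, t, hrun, by rwa [← hinput x], ?_⟩
  rintro ⟨S', hS'⟩
  exact ⟨sol x, (h x S' hS').1, (h x S' hS').2.1, fun S'' hS'' => (h x S'' hS'').2.2⟩

theorem listsFinset_of_lt {m : ℕ} {l : List ℕ} (h : ∀ i ∈ l, i < m) :
    ListsFinset (.ofNats l) (Finset.univ.filter fun i : Fin m => decide ((i : ℕ) ∈ l) = true) := by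
  refine ⟨l.pmap (fun i hi => ⟨i, hi⟩) h, ?_, ?_⟩
  · ext i
    simp only [List.mem_toFinset, List.mem_pmap, Finset.mem_filter, Finset.mem_univ, true_and,
      decide_eq_true_eq]
    constructor
    · rintro ⟨j, hj, rfl⟩
      exact hj
    · exact fun hi => ⟨i, hi, rfl⟩
  · rw [List.map_pmap]
    simp

theorem sum_map_filter {α : Type} (l : List α) (O : α → Bool) (g : α → ℕ) :
    ((l.filter O).map g).sum = (l.map fun i => cond (O i) (g i) 0).sum := by
  induction l with
  | nil => rfl
  | cons i l ih => cases h : O i <;> simp [h, ih]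

theorem countP_starEdges_le_filter {a : ℕ} {l items : List Item} {O : Item → Bool}
    (h : l.Subperm items) (hO : ∀ i ∈ l, O i = true) (p : ℕ × ℕ → Bool) :
    (starEdges a l).countP p ≤ (starEdges a (items.filter O)).countP p := by
  have h1 := h.filter O
  rw [List.filter_eq_self.2 hO] at h1
  obtain ⟨m, hm, hs⟩ := h1
  rw [countP_starEdges, countP_starEdges, ← (hm.map _).sum_eq]
  exact (hs.map _).sum_le_sum fun _ _ => Nat.zero_le _

/-- The cost of a set is at most the total cost of items for all its members. -/
theorem sum_le_totalCost {n : ℕ} {T : Finset (Fin n)} {c : Fin n → ℕ} {l : List Item}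
    (hc : ∀ i ∈ l, ∀ w : Fin n, i.1 = w → i.cost = c w) (hT : ∀ w ∈ T, (w : ℕ) ∈ l.map Prod.fst) :
    ∑ w ∈ T, c w ≤ totalCost l := by
  induction l generalizing T with
  | nil =>
    have : T = ∅ := Finset.eq_empty_of_forall_notMem fun w hw => by simpa using hT w hw
    simp [this]
  | cons i l ih =>
    rw [totalCost_cons]
    have hc' : ∀ i ∈ l, ∀ w : Fin n, i.1 = w → i.cost = c w :=
      fun j hj => hc j (List.mem_cons_of_mem _ hj)
    by_cases h : ∃ w : Fin n, i.1 = w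
    · obtain ⟨w, hw⟩ := h
      have h1 := ih (T := T.erase w) hc' (fun v hv => by
        have := hT v (Finset.mem_of_mem_erase hv)
        rw [List.map_cons, List.mem_cons] at this
        rcases this with h2 | h2
        · exact absurd (Fin.ext (h2.trans hw)) (Finset.ne_of_mem_erase hv)
        · exact h2)
      have h2 := hc i List.mem_cons_self w hw
      by_cases hwT : w ∈ T
      · rw [← Finset.add_sum_erase T c hwT, h2]
        omega
      · rw [Finset.erase_eq_of_notMem hwT] at h1
        omega
    · have h1 := ih (T := T) hc' (fun v hv => by
        have := hT v hv
        rw [List.map_cons, List.mem_cons] at this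
        rcases this with h2 | h2
        · exact absurd ⟨v, h2.symm⟩ h
        · exact h2)
      omega

/-- The edges of the star `F` as items. -/
def edgeItems (F c : List ℕ) : List Item :=
  (List.range c.length).map fun i => (i, F.getD i 0, c.getD i 0, [0])

/-- The nodes of the star `F` as items, each of which stands for all its edges. -/
def nodeItems (F c : List ℕ) : List Item :=
  ((List.range c.length).map fun w => (w, w, c.getD w 0, F.filter fun v => decide (v = w))).filter
    fun i => !decide (i.copies = [])

@[fun_prop]
theorem PolyTime.edgeItems {α : Type} [ToVal α] {F c : α → List ℕ} (hF : PolyTime F)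
    (hc : PolyTime c) : PolyTime fun a => edgeItems (F a) (c a) := by
  unfold _root_.edgeItems
  fun_prop

@[fun_prop]
theorem PolyTime.nodeItems {α : Type} [ToVal α] {F c : α → List ℕ} (hF : PolyTime F)
    (hc : PolyTime c) : PolyTime fun a => nodeItems (F a) (c a) := by
  unfold _root_.nodeItems
  fun_prop

/-- Edges of the star grouped by their ends. -/
theorem sum_length_filter_eq_countP {n : ℕ} (F : List (Fin n)) (h : ℕ → Bool) :
    ∑ w : Fin n, cond (h w) ((F.map Fin.val).filter fun v => decide (v = (w : ℕ))).length 0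
      = F.countP fun v : Fin n => h v := by
  induction F with
  | nil => simp
  | cons v F ih =>
    rw [List.countP_cons, ← ih]
    have key : ∀ w : Fin n,
        cond (h w) (((v :: F).map Fin.val).filter fun v => decide (v = (w : ℕ))).length 0 =
        cond (h w) ((F.map Fin.val).filter fun v => decide (v = (w : ℕ))).length 0 +
          if w = v then (h v).toNat else 0 := by
      intro w
      rw [List.map_cons, List.filter_cons]
      by_cases hw : w = v
      · subst hw
        cases hh : h w <;> simp
      · have : ¬ (v : ℕ) = w := fun h => hw (Fin.ext h.symm)
        simp [hw, this]
    rw [Finset.sum_congr rfl fun w _ => key w, Finset.sum_add_distrib, Finset.sum_ite_eq']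
    cases hh : h v <;> simp

namespace StarSNA

/-- Instances as tuples. -/
abbrev Data : Type :=
  ℕ × List (ℕ × ℕ) × List ℕ × ℕ × List ℕ × List (ℕ × ℕ × ℕ) × ℕ

/-- The tuple that represents an instance; the last entry ends the list in the encoding. -/
def data (x : StarSNA) : Data :=
  (x.n, natPairs x.E, List.ofFn x.q, x.a, x.F.map Fin.val, x.demands, 0)

theorem toVal_data (x : StarSNA) : toVal x.data = x.encode := by
  simp only [data, natPairs, demands, encode, toVal, Val.ofList, Val.ofNats, List.map_map]
  rfl

/-- The items bought for an instance given as a tuple. -/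
def buy (x : Data) (items : List Item) : List Item :=
  solve x.2.1 (nodeUnits x.2.2.1 (unitsOf x.2.1 x.2.2.2.2.1)) x.2.2.2.2.2.1 x.2.2.2.1 items

/-- The algorithm for edge costs. -/
def edgeAlgorithm (y : Data × List ℕ) : List ℕ :=
  (buy y.1 (edgeItems y.1.2.2.2.2.1 y.2)).map fun i => i.1

/-- The algorithm for node costs: take all edges to the nodes that were bought. -/
def nodeAlgorithm (y : Data × List ℕ) : List ℕ :=
  (List.range y.1.2.2.2.2.1.length).filter fun i =>
    decide (y.1.2.2.2.2.1.getD i 0 ∈ (buy y.1 (nodeItems y.1.2.2.2.2.1 y.2)).map fun i => i.1)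

theorem polyTime_edgeAlgorithm : PolyTime edgeAlgorithm := by
  unfold edgeAlgorithm buy unitsOf
  fun_prop

theorem polyTime_nodeAlgorithm : PolyTime nodeAlgorithm := by
  unfold nodeAlgorithm buy unitsOf
  fun_prop

variable {x : StarSNA}

theorem countP_edgeItems (c : Fin x.F.length → ℕ) (W : ℕ → Bool) (p : ℕ × ℕ → Bool) :
    (starEdges x.a ((edgeItems (x.F.map Fin.val) (List.ofFn c)).filter fun i => W i.1)).countP p
      = ∑ i ∈ Finset.univ.filter (fun i : Fin x.F.length => W i = true),
        (p ((x.a : ℕ), (x.F.get i : ℕ))).toNat := by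
  rw [countP_starEdges, sum_map_filter, edgeItems, List.map_map, List.length_ofFn, sum_map_range,
    Finset.sum_filter]
  refine Finset.sum_congr rfl fun i _ => ?_
  have h : (x.F.map Fin.val).getD i 0 = (x.F.get i : ℕ) := by simp
  simp only [Function.comp_apply, Item.node, Item.copies, h]
  cases W i <;> cases p ((x.a : ℕ), (x.F.get i : ℕ)) <;> simp

theorem totalCost_edgeItems (c : Fin x.F.length → ℕ) (W : ℕ → Bool) :
    totalCost ((edgeItems (x.F.map Fin.val) (List.ofFn c)).filter fun i => W i.1)
      = ∑ i ∈ Finset.univ.filter (fun i : Fin x.F.length => W i = true), c i := by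
  rw [totalCost, sum_map_filter, edgeItems, List.map_map, List.length_ofFn, sum_map_range,
    Finset.sum_filter]
  refine Finset.sum_congr rfl fun i _ => ?_
  simp only [Function.comp_apply, Item.cost]
  cases W i <;> simp

theorem countP_nodeItems (c : Fin x.n → ℕ) (W : ℕ → Bool) (p : ℕ × ℕ → Bool) :
    (starEdges x.a ((nodeItems (x.F.map Fin.val) (List.ofFn c)).filter fun i => W i.1)).countP p
      = ∑ i ∈ Finset.univ.filter (fun i : Fin x.F.length => W (x.F.get i) = true),
        (p ((x.a : ℕ), (x.F.get i : ℕ))).toNat := by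
  rw [countP_starEdges, sum_map_filter, nodeItems, sum_map_filter, List.map_map, List.length_ofFn,
    sum_map_range, Finset.sum_filter]
  have h := sum_length_filter_eq_countP x.F fun v => W v && p (x.a, v)
  rw [countP_eq_sum_get] at h
  refine Eq.trans (Finset.sum_congr rfl fun w _ => ?_) (h.trans (Finset.sum_congr rfl fun i _ => ?_))
  · simp only [Function.comp_apply, Item.node, Item.copies]
    generalize (x.F.map Fin.val).filter (fun v => decide (v = (w : ℕ))) = m
    cases m <;> cases W w <;> cases p (x.a, w) <;> simp
  · cases W (x.F.get i) <;> simp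

theorem totalCost_nodeItems_le (c : Fin x.n → ℕ) (W : ℕ → Bool) :
    totalCost ((nodeItems (x.F.map Fin.val) (List.ofFn c)).filter fun i => W i.1)
      ≤ ∑ w ∈ Finset.univ.filter (fun w : Fin x.n => W w = true), c w := by
  rw [totalCost, sum_map_filter, nodeItems, sum_map_filter, List.map_map, List.length_ofFn,
    sum_map_range, Finset.sum_filter]
  refine Finset.sum_le_sum fun i _ => ?_
  simp only [Function.comp_apply, Item.cost]
  cases W i
  · cases !decide (Item.copies _ = []) <;> simp
  · cases !decide (Item.copies _ = []) <;> simp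

/-- The set of edges computed by the algorithm for edge costs. -/
def edgeSolution (x : StarSNA) (c : Fin x.F.length → ℕ) : Finset (Fin x.F.length) :=
  Finset.univ.filter fun i => decide ((i : ℕ) ∈ edgeAlgorithm (x.data, List.ofFn c)) = true

/-- The set of edges computed by the algorithm for node costs. -/
def nodeSolution (x : StarSNA) (c : Fin x.n → ℕ) : Finset (Fin x.F.length) :=
  Finset.univ.filter fun i => decide ((i : ℕ) ∈ nodeAlgorithm (x.data, List.ofFn c)) = true

theorem edgeSolution_spec (c : Fin x.F.length → ℕ) {Δ : ℕ → ℕ}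
    (hΔ : Δ = degBound ∨ (Δ = rootedDegBound ∧ x.Rooted)) {S : Finset (Fin x.F.length)}
    (hS : x.Feasible S) :
    ListsFinset (.ofNats (edgeAlgorithm (x.data, List.ofFn c))) (x.edgeSolution c) ∧
    x.Feasible (x.edgeSolution c) ∧
    ((∑ i ∈ x.edgeSolution c, c i : ℕ) : ℚ) ≤ edgeRatio Δ x.k * (∑ i ∈ S, c i : ℕ) := by
  set items := edgeItems (x.F.map Fin.val) (List.ofFn c) with hitems
  set W : ℕ → Bool := fun j => decide (∃ h : j < x.F.length, (⟨j, h⟩ : Fin _) ∈ S) with hW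
  have hWS : Finset.univ.filter (fun i : Fin x.F.length => W i = true) = S := by
    ext i
    simp [hW]
  have hmem : ∀ i ∈ items, ∃ j : Fin x.F.length, i = ((j : ℕ), (x.F.get j : ℕ), c j, [0]) := by
    intro i hi
    obtain ⟨j, hj, rfl⟩ := List.mem_map.1 hi
    rw [List.mem_range, List.length_ofFn] at hj
    exact ⟨⟨j, hj⟩, by simp [hj]⟩
  have hopt : Satisfied (natPairs x.E ++ starEdges x.a (items.filter fun i => W i.1))
      x.capUnits x.demands 0 :=
    satisfied_of_feasible hS fun p => by rw [countP_edgeItems, hWS]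
  obtain ⟨h1, h2, h3⟩ := solve_spec (Δ := Δ) (p := 1) (fun _ _ _ => demand_ne)
    (fun _ _ _ => demand_mem) (fun i hi => by obtain ⟨j, rfl⟩ := hmem i hi; simp [Item.copies])
    hopt (fun i hi => by obtain ⟨j, rfl⟩ := hmem i hi; simp [Item.copies])
    (hΔ.imp_right fun h => ⟨h.1, fun _ _ _ => demand_rooted h.2⟩)
  set sol := solve (natPairs x.E) x.capUnits x.demands x.a items with hsol
  have halg : edgeAlgorithm (x.data, List.ofFn c) = sol.map fun i => i.1 := rfl
  refine ⟨listsFinset_of_lt fun i hi => ?_, ?_, ?_⟩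
  · rw [halg] at hi
    obtain ⟨item, hitem, rfl⟩ := List.mem_map.1 hi
    obtain ⟨j, rfl⟩ := hmem item (h1.subset hitem)
    exact j.2
  · refine feasible_of_satisfied h2 fun p => ?_
    rw [edgeSolution, ← countP_edgeItems c fun i => decide (i ∈ edgeAlgorithm (x.data, List.ofFn c))]
    refine countP_starEdges_le_filter h1 (fun i hi => ?_) p
    rw [halg, decide_eq_true_eq]
    exact List.mem_map_of_mem hi
  · have h4 : ∑ i ∈ x.edgeSolution c, c i ≤ totalCost sol := by
      refine sum_le_totalCost (fun i hi w hw => ?_) fun w hw => ?_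
      · obtain ⟨j, rfl⟩ := hmem i (h1.subset hi)
        rw [← Fin.ext hw]
        rfl
      · simpa [edgeSolution, halg] using hw
    rw [totalCost_edgeItems, hWS, maxReq_demands, ← edgeRatio_eq] at h3
    exact le_trans (by exact_mod_cast h4) h3

theorem one_le_of_degBound {Δ : ℕ → ℕ} {k : ℕ} (hΔ : Δ = degBound ∨ Δ = rootedDegBound)
    (hk : 1 ≤ k) : 1 ≤ Δ k := by
  rcases hΔ with rfl | rfl
  · exact Nat.one_le_pow _ _ (by omega)
  · unfold rootedDegBound
    omega

theorem count_le_pMax (w : Fin x.n) :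
    ((x.F.map Fin.val).filter fun v => decide (v = (w : ℕ))).length ≤ x.pMax := by
  refine le_trans (le_of_eq ?_) (Finset.le_sup (f := fun v => x.F.count v) (Finset.mem_univ w))
  rw [List.filter_map, List.length_map, List.count, List.countP_eq_length_filter]
  congr 2
  funext v
  rw [Bool.eq_iff_iff]
  simp [Fin.ext_iff]

theorem mem_endnodes {S : Finset (Fin x.F.length)} {w : Fin x.n} :
    w ∈ x.endnodes S ↔ S.Nonempty ∧ w = x.a ∨ ∃ i ∈ S, x.F.get i = w := by
  simp only [endnodes, Finset.mem_biUnion, Finset.mem_insert, Finset.mem_singleton]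
  constructor
  · rintro ⟨i, hi, h | h⟩
    · exact .inl ⟨⟨i, hi⟩, h⟩
    · exact .inr ⟨i, hi, h.symm⟩
  · rintro (⟨⟨i, hi⟩, h⟩ | ⟨i, hi, h⟩)
    · exact ⟨i, hi, .inl h⟩
    · exact ⟨i, hi, .inr h.symm⟩

theorem nodeSolution_spec (c : Fin x.n → ℕ) {Δ : ℕ → ℕ}
    (hΔ : Δ = degBound ∨ (Δ = rootedDegBound ∧ x.Rooted)) {S : Finset (Fin x.F.length)}
    (hS : x.Feasible S) :
    ListsFinset (.ofNats (nodeAlgorithm (x.data, List.ofFn c))) (x.nodeSolution c) ∧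
    x.Feasible (x.nodeSolution c) ∧
    ((∑ w ∈ x.endnodes (x.nodeSolution c), c w : ℕ) : ℚ)
      ≤ nodeRatio Δ x.k x.pMax * (∑ w ∈ x.endnodes S, c w : ℕ) := by
  set items := nodeItems (x.F.map Fin.val) (List.ofFn c) with hitems
  set W : ℕ → Bool := fun v => decide (∃ i ∈ S, (x.F.get i : ℕ) = v) with hW
  have hmem : ∀ i ∈ items, i.copies ≠ [] ∧ ∃ w : Fin x.n,
      i = ((w : ℕ), (w : ℕ), c w, (x.F.map Fin.val).filter fun v => decide (v = (w : ℕ))) := by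
    intro i hi
    obtain ⟨hi, hne⟩ := List.mem_filter.1 hi
    obtain ⟨w, hw, rfl⟩ := List.mem_map.1 hi
    rw [List.mem_range, List.length_ofFn] at hw
    exact ⟨by simpa using hne, ⟨w, hw⟩, by simp [hw]⟩
  have hopt : Satisfied (natPairs x.E ++ starEdges x.a (items.filter fun i => W i.1))
      x.capUnits x.demands 0 := by
    refine satisfied_of_feasible hS fun p => ?_
    rw [countP_nodeItems]
    refine Finset.sum_le_sum_of_subset fun i hi => ?_
    rw [Finset.mem_filter]
    exact ⟨Finset.mem_univ i, decide_eq_true ⟨i, hi, rfl⟩⟩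
  obtain ⟨h1, h2, h3⟩ := solve_spec (Δ := Δ) (p := x.pMax) (fun _ _ _ => demand_ne)
    (fun _ _ _ => demand_mem) (fun i hi => (hmem i hi).1)
    hopt (fun i hi => by obtain ⟨-, w, rfl⟩ := hmem i hi; exact count_le_pMax w)
    (hΔ.imp_right fun h => ⟨h.1, fun _ _ _ => demand_rooted h.2⟩)
  have hnil := solve_eq_nil (E := natPairs x.E) (N := x.capUnits) (a := x.a) (items := items)
    (fun _ _ _ => demand_ne (x := x))
  set sol := solve (natPairs x.E) x.capUnits x.demands x.a items with hsol
  have halg : ∀ i : ℕ, i ∈ nodeAlgorithm (x.data, List.ofFn c) ↔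
      ∃ h : i < x.F.length, (x.F.get ⟨i, h⟩ : ℕ) ∈ sol.map fun i => i.1 := by
    intro i
    unfold nodeAlgorithm
    rw [List.mem_filter, List.mem_range, decide_eq_true_eq]
    change i < (x.F.map Fin.val).length ∧ (x.F.map Fin.val).getD i 0 ∈ sol.map (fun i => i.1) ↔ _
    rw [List.length_map]
    constructor
    · rintro ⟨hi, h⟩
      exact ⟨hi, by simpa [hi] using h⟩
    · rintro ⟨hi, h⟩
      exact ⟨hi, by simpa [hi] using h⟩
  have hsolution : x.nodeSolution c = Finset.univ.filter fun i : Fin x.F.length =>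
      decide ((x.F.get i : ℕ) ∈ sol.map fun i => i.1) = true := by
    ext i
    simp only [nodeSolution, Finset.mem_filter, Finset.mem_univ, true_and, decide_eq_true_eq, halg]
    exact ⟨fun ⟨_, h⟩ => h, fun h => ⟨i.2, h⟩⟩
  refine ⟨listsFinset_of_lt fun i hi => ((halg i).1 hi).1, ?_, ?_⟩
  · refine feasible_of_satisfied h2 fun p => ?_
    rw [hsolution, ← countP_nodeItems c fun v => decide (v ∈ sol.map fun i => i.1)]
    refine countP_starEdges_le_filter h1 (fun i hi => ?_) p
    rw [decide_eq_true_eq]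
    exact List.mem_map_of_mem hi
  · rw [maxReq_demands] at h3
    by_cases hne : (x.nodeSolution c).Nonempty
    swap
    · rw [Finset.not_nonempty_iff_eq_empty.1 hne]
      have h4 : 0 ≤ nodeRatio Δ x.k x.pMax :=
        Finset.sum_nonneg fun l hl => nodeRatio_term_nonneg Δ _ (Finset.mem_Icc.1 hl).2
      simpa [endnodes] using mul_nonneg h4 (Nat.cast_nonneg (α := ℚ) (∑ w ∈ x.endnodes S, c w))
    obtain ⟨i₀, hi₀⟩ := hne
    -- The center is paid for by the reference solution, too: otherwise nothing is bought.
    have hSne : S.Nonempty := by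
      rw [Finset.nonempty_iff_ne_empty]
      rintro rfl
      have h4 := satisfied_of_feasible (L := []) hS (by simp)
      rw [List.append_nil] at h4
      have h5 := hnil h4
      rw [hsolution, Finset.mem_filter] at hi₀
      simp [h5] at hi₀
    have hk : 1 ≤ x.k := by
      by_contra hk
      refine absurd (hnil ?_) fun h5 => ?_
      · intro u v r hd A B hAB hu hv
        have h6 := hd.le_maxReq
        rw [maxReq_demands] at h6
        omega
      · rw [hsolution, Finset.mem_filter] at hi₀
        simp [h5] at hi₀
    have hp : 1 ≤ x.pMax := by
      obtain ⟨i, hi⟩ := hSne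
      refine le_trans ?_ (Finset.le_sup (f := fun v => x.F.count v) (Finset.mem_univ (x.F.get i)))
      exact List.count_pos_iff.2 (List.get_mem _ _)
    have hratio := one_le_nodeRatio (p := x.pMax) (one_le_of_degBound (hΔ.imp_right And.left) hk)
      hk hp
    have hcost : ∑ w ∈ x.endnodes S, c w
        = c x.a + ∑ w ∈ Finset.univ.filter (fun w : Fin x.n => W w = true), c w := by
      have ha : x.a ∉ Finset.univ.filter (fun w : Fin x.n => W w = true) := by
        rw [Finset.mem_filter, hW, decide_eq_true_eq]
        rintro ⟨-, i, hi, h⟩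
        exact x.F_ne _ (List.get_mem _ _) (Fin.ext h)
      rw [← Finset.sum_insert ha]
      refine Finset.sum_congr (Finset.ext fun w => ?_) fun _ _ => rfl
      rw [mem_endnodes, Finset.mem_insert, Finset.mem_filter, hW, decide_eq_true_eq]
      simp [hSne, Fin.ext_iff]
    have hsolcost : ∑ w ∈ x.endnodes (x.nodeSolution c), c w ≤ c x.a + totalCost sol := by
      have ha : x.a ∈ x.endnodes (x.nodeSolution c) := mem_endnodes.2 (.inl ⟨⟨i₀, hi₀⟩, rfl⟩)
      rw [← Finset.add_sum_erase _ c ha]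
      refine Nat.add_le_add_left (sum_le_totalCost (fun i hi w hw => ?_) fun w hw => ?_) _
      · obtain ⟨-, j, rfl⟩ := hmem i (h1.subset hi)
        rw [← Fin.ext hw]
        rfl
      · obtain ⟨hw1, hw2⟩ := Finset.mem_erase.1 hw
        rcases mem_endnodes.1 hw2 with h | ⟨i, hi, rfl⟩
        · exact absurd h.2 hw1
        · rw [hsolution, Finset.mem_filter, decide_eq_true_eq] at hi
          exact hi.2
    have h4 := totalCost_nodeItems_le c W
    rw [hcost]
    have h5 : (totalCost (items.filter fun i => W i.1) : ℚ)
        ≤ (∑ w ∈ Finset.univ.filter (fun w : Fin x.n => W w = true), c w : ℕ) := by exact_mod_cast h4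
    have h6 : ((∑ w ∈ x.endnodes (x.nodeSolution c), c w : ℕ) : ℚ) ≤ c x.a + totalCost sol := by
      exact_mod_cast hsolcost
    have h7 := mul_le_mul_of_nonneg_left h5 (zero_le_one.trans hratio)
    have h8 := mul_le_mul_of_nonneg_right hratio (Nat.cast_nonneg (α := ℚ) (c x.a))
    rw [Nat.cast_add, mul_add]
    linarith

theorem admitsRatio_edgeCost : edgeCost.AdmitsRatio fun y => edgeRatio degBound y.1.k :=
  MinProblem.admitsRatio_of_polyTime polyTime_edgeAlgorithm
    (fun y : edgeCost.Inst => (y.1.data, List.ofFn y.2))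
    (fun y => congrArg₂ Val.pair y.1.toVal_data rfl) (fun y => y.1.edgeSolution y.2)
    fun y _ hS => edgeSolution_spec y.2 (.inl rfl) hS

theorem admitsRatio_rootedEdgeCost :
    rootedEdgeCost.AdmitsRatio fun y => edgeRatio rootedDegBound y.1.1.k :=
  MinProblem.admitsRatio_of_polyTime polyTime_edgeAlgorithm
    (fun y : rootedEdgeCost.Inst => (y.1.1.data, List.ofFn y.1.2))
    (fun y => congrArg₂ Val.pair y.1.1.toVal_data rfl) (fun y => y.1.1.edgeSolution y.1.2)
    fun y _ hS => edgeSolution_spec y.1.2 (.inr ⟨rfl, y.2⟩) hS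

theorem admitsRatio_nodeCost : nodeCost.AdmitsRatio fun y => nodeRatio degBound y.1.k y.1.pMax :=
  MinProblem.admitsRatio_of_polyTime polyTime_nodeAlgorithm
    (fun y : nodeCost.Inst => (y.1.data, List.ofFn y.2))
    (fun y => congrArg₂ Val.pair y.1.toVal_data rfl) (fun y => y.1.nodeSolution y.2)
    fun y _ hS => nodeSolution_spec y.2 (.inl rfl) hS

theorem admitsRatio_rootedNodeCost :
    rootedNodeCost.AdmitsRatio fun y => nodeRatio rootedDegBound y.1.1.k y.1.1.pMax :=
  MinProblem.admitsRatio_of_polyTime polyTime_nodeAlgorithm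
    (fun y : rootedNodeCost.Inst => (y.1.1.data, List.ofFn y.1.2))
    (fun y => congrArg₂ Val.pair y.1.1.toVal_data rfl) (fun y => y.1.1.nodeSolution y.1.2)
    fun y _ hS => nodeSolution_spec y.1.2 (.inr ⟨rfl, y.2⟩) hS

end StarSNA

/-! ### Approximation of source location -/

/-- The ratio as a sum over the slacks `j = k - ℓ`. -/
theorem nodeRatio_eq_reflect (Δ : ℕ → ℕ) (k p : ℕ) : nodeRatio Δ k p =
    ∑ j ∈ Finset.range k, harmonic (Δ (k - j)) * discount p j := by
  rw [nodeRatio_eq, ← Finset.sum_range_reflect]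
  refine Finset.sum_congr rfl fun j hj => ?_
  have := Finset.mem_range.1 hj
  rw [show k - 1 - j + 1 = k - j by omega, show k - 1 - (k - 1 - j) = j by omega]

theorem nodeRatio_mono {Δ : ℕ → ℕ} (hΔ : Monotone Δ) {k k' p p' : ℕ} (hk : k ≤ k') (hp : p ≤ p') :
    nodeRatio Δ k p ≤ nodeRatio Δ k' p' := by
  rw [nodeRatio_eq_reflect, nodeRatio_eq_reflect]
  refine (Finset.sum_le_sum fun j _ => ?_).trans (Finset.sum_le_sum_of_subset_of_nonneg
    (Finset.range_mono hk) fun j _ _ => mul_nonneg (harmonic_nonneg _) (discount_nonneg _ _))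
  refine mul_le_mul (harmonic_mono (hΔ (by omega))) ?_ (discount_nonneg _ _) (harmonic_nonneg _)
  refine min_le_min_right _ ?_
  gcongr

theorem rootedDegBound_mono : Monotone rootedDegBound := fun k l h => by
  unfold rootedDegBound
  omega

@[fun_prop]
theorem PolyTime.min {α : Type} [ToVal α] {f g : α → ℕ} (hf : PolyTime f) (hg : PolyTime g) :
    PolyTime fun a => min (f a) (g a) := by
  have := bcond (decLE hf hg) hf hg
  convert this using 2 with a
  by_cases h : f a ≤ g a <;> simp [h]
  omega

@[fun_prop]
theorem PolyTime.max {α : Type} [ToVal α] {f g : α → ℕ} (hf : PolyTime f) (hg : PolyTime g) :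
    PolyTime fun a => max (f a) (g a) := by
  have := bcond (decLE hf hg) hg hf
  convert this using 2 with a
  by_cases h : f a ≤ g a <;> simp [h]
  omega

namespace SSL

/-- Instances as tuples. -/
abbrev Data : Type :=
  ℕ × List (ℕ × ℕ) × List ℕ × List ℕ × List ℕ × List ℕ × ℕ

/-- The tuple that represents an instance; the last entry ends the list in the encoding. -/
def data (x : SSL) : Data :=
  (x.n, natPairs x.E, List.ofFn x.q, List.ofFn x.p, List.ofFn x.d, List.ofFn x.c, 0)

theorem toVal_data (x : SSL) : toVal x.data = x.encode := by
  simp only [data, natPairs, encode, toVal, Val.ofList, Val.ofNats, List.map_map]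
  rfl

/-- A list that is longer than the list of edges. -/
def unitsOf (E : List (ℕ × ℕ)) : List ℕ := 0 :: E.map fun _ => 0

/-- The items of the augmentation problem: at most `M` of the edges from the new node to `w`, where
`M` exceeds the degree of `w`. -/
def sourceItems (E : List (ℕ × ℕ)) (p c : List ℕ) : List Item :=
  (List.range c.length).map fun w => (w, w, c.getD w 0,
    (List.range (unitsOf E).length).filter fun i => decide (i < p.getD w 0))

/-- The requirement that remains when the supply `p` of a node with demand `d` is truncated at `M`. A
node that is not a source receives less than `M`, so that truncating its demand at `M` does no harm. -/
def truncDemand (M p d : ℕ) : ℕ := max (min d M) (d - (p - M))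

/-- The demands of the augmentation problem with the new node `n`. -/
def sourceDemands (n : ℕ) (E : List (ℕ × ℕ)) (p d : List ℕ) : List (ℕ × ℕ × ℕ) :=
  (List.range d.length).map fun w =>
    (n, w, truncDemand (unitsOf E).length (p.getD w 0) (d.getD w 0))

/-- The items bought for an instance given as a tuple. -/
def buy (x : Data) : List Item :=
  solve x.2.1 (x.1 :: nodeUnits x.2.2.1 (unitsOf x.2.1))
    (sourceDemands x.1 x.2.1 x.2.2.2.1 x.2.2.2.2.1) x.1 (sourceItems x.2.1 x.2.2.2.1 x.2.2.2.2.2.1)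

/-- The algorithm for source location. -/
def algorithm (x : Data) : List ℕ := (buy x).map fun i => i.1

theorem polyTime_algorithm : PolyTime algorithm := by
  unfold algorithm buy sourceDemands sourceItems truncDemand unitsOf
  fun_prop

variable {x : SSL} {A B : ℕ → Bool}

/-- The items of an instance. -/
def items (x : SSL) : List Item := sourceItems (natPairs x.E) (List.ofFn x.p) (List.ofFn x.c)

/-- The demands of the augmentation problem. -/
def demands (x : SSL) : List (ℕ × ℕ × ℕ) :=
  sourceDemands x.n (natPairs x.E) (List.ofFn x.p) (List.ofFn x.d)

/-- The units of node capacity, truncated. -/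
def capUnits (x : SSL) : List ℕ := x.n :: nodeUnits (List.ofFn x.q) (unitsOf (natPairs x.E))

theorem length_unitsOf : (unitsOf (natPairs x.E)).length = x.E.length + 1 := by
  simp [unitsOf, natPairs]

theorem mem_demands {d : ℕ × ℕ × ℕ} : d ∈ x.demands ↔
    ∃ v : Fin x.n, d = (x.n, (v : ℕ), truncDemand (x.E.length + 1) (x.p v) (x.d v)) := by
  rw [demands, sourceDemands, length_unitsOf]
  simp only [List.mem_map, List.mem_range, List.length_ofFn]
  constructor
  · rintro ⟨v, hv, rfl⟩
    exact ⟨⟨v, hv⟩, by simp [hv]⟩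
  · rintro ⟨v, rfl⟩
    exact ⟨v, v.2, by simp⟩

theorem mem_items {i : Item} (hi : i ∈ x.items) : ∃ w : Fin x.n, i = ((w : ℕ), (w : ℕ), x.c w,
    (List.range (x.E.length + 1)).filter fun i => decide (i < x.p w)) := by
  obtain ⟨w, hw, rfl⟩ := List.mem_map.1 hi
  rw [List.mem_range, List.length_ofFn] at hw
  exact ⟨⟨w, hw⟩, by simp [hw, length_unitsOf]⟩

theorem countP_items (W : ℕ → Bool) (p : ℕ × ℕ → Bool) :
    (starEdges x.n (x.items.filter fun i => W i.1)).countP p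
      = ∑ w ∈ Finset.univ.filter (fun w : Fin x.n => W w = true),
        (p (x.n, (w : ℕ))).toNat * min (x.p w) (x.E.length + 1) := by
  rw [countP_starEdges, sum_map_filter, items, sourceItems, List.map_map, List.length_ofFn,
    sum_map_range, Finset.sum_filter, length_unitsOf]
  refine Finset.sum_congr rfl fun w _ => ?_
  have h : (List.ofFn x.p).getD w 0 = x.p w := by simp
  simp only [Function.comp_apply, Item.node, Item.copies, h, length_filter_range_lt]
  cases W w <;> cases p (x.n, (w : ℕ)) <;> simp

theorem totalCost_items (W : ℕ → Bool) : totalCost (x.items.filter fun i => W i.1)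
      = ∑ w ∈ Finset.univ.filter (fun w : Fin x.n => W w = true), x.c w := by
  rw [totalCost, sum_map_filter, items, sourceItems, List.map_map, List.length_ofFn, sum_map_range,
    Finset.sum_filter]
  refine Finset.sum_congr rfl fun w _ => ?_
  simp only [Function.comp_apply, Item.cost]
  cases W w <;> simp

/-- The number of a node; the new node gets the number `n`. -/
def number (x : SSL) (o : Option (Fin x.n)) : ℕ := o.elim x.n Fin.val

theorem number_injective (x : SSL) : Function.Injective x.number := by
  rintro (_ | v) (_ | w) h
  · rfl
  · exact absurd h w.2.ne'
  · exact absurd h v.2.ne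
  · exact congrArg some (Fin.ext h)

theorem bisetCut_ends (S : Finset (Fin x.n)) (hA : A x.n = true) (hB : B x.n = true) :
    bisetCut (x.ends S) (fun u => u.elim 0 x.q) (fun w => A (x.number w)) (fun w => B (x.number w)) =
      cutVal (natPairs x.E) [] A B + ∑ u ∈ S, (!B u).toNat * x.p u +
      ∑ w : Fin x.n, (B w && !A w).toNat * x.q w := by
  rw [bisetCut, Fintype.sum_sum_type, Fintype.sum_option, cutVal, countP_natPairs, countP_natPairs,
    Fintype.sum_sigma, ← Finset.sum_coe_sort S fun u => (!B u).toNat * x.p u]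
  simp [ends, number, hA, hB, Finset.sum_add_distrib, mul_comm]

theorem cutVal_items (W : ℕ → Bool) (hA : A x.n = true) (hB : B x.n = true) :
    cutVal (natPairs x.E ++ starEdges x.n (x.items.filter fun i => W i.1)) x.capUnits A B =
      cutVal (natPairs x.E) [] A B + ∑ u ∈ Finset.univ.filter (fun w : Fin x.n => W w = true),
        (!B u).toNat * min (x.p u) (x.E.length + 1) +
      ∑ w : Fin x.n, (B w && !A w).toNat * min (x.q w) (x.E.length + 1) := by
  rw [cutVal, List.countP_append, List.countP_append, capUnits, List.countP_cons, countP_nodeUnits,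
    length_unitsOf, countP_items, countP_items, cutVal]
  simp [hA, hB]
  omega

theorem sum_eq_add_sum_erase {n : ℕ} (S : Finset (Fin n)) {v : Fin n} (hv : B v = false)
    (g : Fin n → ℕ) : ∑ u ∈ S, (!B u).toNat * g u =
      (if v ∈ S then g v else 0) + ∑ u ∈ S.erase v, (!B u).toNat * g u := by
  by_cases h : v ∈ S
  · rw [← Finset.add_sum_erase S _ h]
    simp [h, hv]
  · simp [h]

/-- Truncation yields an equivalent augmentation problem: the flow to `v` other than the supply of `v`
itself is at most the degree of `v`, and larger supplies or capacities elsewhere play no role. -/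
theorem le_pqConnectivity_iff (W : ℕ → Bool) (v : Fin x.n) :
    x.d v ≤ x.pqConnectivity (Finset.univ.filter fun w : Fin x.n => W w = true) v ↔
    ∀ A B : ℕ → Bool, (∀ y, A y = true → B y = true) → A x.n = true → B v = false →
      truncDemand (x.E.length + 1) (x.p v) (x.d v) ≤
        cutVal (natPairs x.E ++ starEdges x.n (x.items.filter fun i => W i.1)) x.capUnits A B := by
  rw [pqConnectivity, le_qConnectivity_iff_comp _ _ (Option.some_ne_none v).symm x.number_injective]
  set S := Finset.univ.filter fun w : Fin x.n => W w = true with hS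
  -- The cut that separates only `v` bounds the demand.
  set C : ℕ → Bool := fun y => !decide (y = (v : ℕ)) with hC
  have hCn : C x.n = true := by simpa [hC] using v.2.ne'
  have hCv : C v = false := by simp [hC]
  have h1 : cutVal (natPairs x.E) [] C C ≤ x.E.length := by
    rw [hC, cutVal_compl, ← length_natPairs]
    exact cutVal_singleton_le _ _ _
  have h2 : ∀ g : Fin x.n → ℕ, ∑ u ∈ S.erase v, (!C u).toNat * g u = 0 := fun g =>
    Finset.sum_eq_zero fun u hu => by
      have := Finset.ne_of_mem_erase hu
      rw [ne_eq, Fin.ext_iff] at this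
      simp [hC, this]
  have h3 : ∀ g : Fin x.n → ℕ, ∑ w : Fin x.n, (C w && !C w).toNat * g w = 0 := by simp
  constructor
  · intro h A B hAB hn hv
    have h4 := h C C (fun _ h => h) hCn hCv
    have h5 := h A B hAB hn hv
    rw [bisetCut_ends S hCn hCn, sum_eq_add_sum_erase S hCv, h2, h3] at h4
    rw [bisetCut_ends S hn (hAB _ hn), sum_eq_add_sum_erase S hv] at h5
    rw [cutVal_items W hn (hAB _ hn), ← hS, sum_eq_add_sum_erase S hv]
    have h6 := sum_mul_min_eq_or (S.erase v) (fun u => !B u) x.p (x.E.length + 1)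
    have h7 := sum_mul_min_eq_or Finset.univ (fun w : Fin x.n => B w && !A w) x.q (x.E.length + 1)
    unfold truncDemand
    by_cases hvS : v ∈ S
    · simp only [hvS, if_true] at h4 h5 ⊢
      omega
    · simp only [hvS, if_false] at h4 h5 ⊢
      omega
  · intro h A B hAB hn hv
    have h4 := h C C (fun _ h => h) hCn hCv
    have h5 := h A B hAB hn hv
    rw [cutVal_items W hCn hCn, ← hS, sum_eq_add_sum_erase S hCv, h2, h3] at h4
    rw [cutVal_items W hn (hAB _ hn), ← hS, sum_eq_add_sum_erase S hv] at h5
    rw [bisetCut_ends S hn (hAB _ hn), sum_eq_add_sum_erase S hv]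
    have h6 := sum_mul_min_le (S.erase v) (fun u => !B u) x.p (x.E.length + 1)
    have h7 := sum_mul_min_le Finset.univ (fun w : Fin x.n => B w && !A w) x.q (x.E.length + 1)
    have h8 := sum_mul_min_eq_or (S.erase v) (fun u => !B u) x.p (x.E.length + 1)
    have h9 := sum_mul_min_eq_or Finset.univ (fun w : Fin x.n => B w && !A w) x.q (x.E.length + 1)
    unfold truncDemand at h4 h5
    by_cases hvS : v ∈ S
    · simp only [hvS, if_true] at h4 h5 ⊢
      omega
    · simp only [hvS, if_false] at h4 h5 ⊢
      omega

theorem forall_le_pqConnectivity_iff (W : ℕ → Bool) :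
    (∀ v, x.d v ≤ x.pqConnectivity (Finset.univ.filter fun w : Fin x.n => W w = true) v) ↔
    Satisfied (natPairs x.E ++ starEdges x.n (x.items.filter fun i => W i.1)) x.capUnits
      x.demands 0 := by
  rw [satisfied_iff]
  constructor
  · intro h d hd
    obtain ⟨v, rfl⟩ := mem_demands.1 hd
    exact (le_pqConnectivity_iff W v).1 (h v)
  · exact fun h v => (le_pqConnectivity_iff W v).2 (h _ (mem_demands.2 ⟨v, rfl⟩))

/-- The set of sources computed by the algorithm. -/
def solution (x : SSL) : Finset (Fin x.n) :=
  Finset.univ.filter fun w => decide ((w : ℕ) ∈ algorithm x.data) = true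

theorem demand_cases {u v r : ℕ} (h : Demand x.demands u v r) : ∃ w : Fin x.n,
    r ≤ x.d w ∧ (u = x.n ∧ v = w ∨ u = w ∧ v = x.n) := by
  have key : ∀ w, truncDemand (x.E.length + 1) (x.p w) (x.d w) ≤ x.d w := fun w => by
    unfold truncDemand
    omega
  rcases h with h | h <;>
  · obtain ⟨w, h⟩ := mem_demands.1 h
    simp only [Prod.mk.injEq] at h
    have := key w
    exact ⟨w, by omega, by omega⟩

theorem maxReq_demands_le : maxReq x.demands ≤ x.k :=
  maxReq_le_iff.2 fun d hd => by
    obtain ⟨w, h, -⟩ := demand_cases (x := x) (.inl hd)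
    exact h.trans (Finset.le_sup (f := x.d) (Finset.mem_univ w))

theorem solution_spec {S : Finset (Fin x.n)} (hS : ∀ v, x.d v ≤ x.pqConnectivity S v) :
    ListsFinset (.ofNats (algorithm x.data)) x.solution ∧
    (∀ v, x.d v ≤ x.pqConnectivity x.solution v) ∧
    ((∑ u ∈ x.solution, x.c u : ℕ) : ℚ)
      ≤ nodeRatio rootedDegBound x.k x.pMax * (∑ u ∈ S, x.c u : ℕ) := by
  set W : ℕ → Bool := fun j => decide (∃ h : j < x.n, (⟨j, h⟩ : Fin _) ∈ S) with hW
  have hWS : Finset.univ.filter (fun i : Fin x.n => W i = true) = S := by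
    ext i
    simp [hW]
  have hopt := (forall_le_pqConnectivity_iff W).1 (by rwa [hWS])
  have hlen : ∀ w : Fin x.n, ((List.range (x.E.length + 1)).filter
      fun i => decide (i < x.p w)).length = min (x.p w) (x.E.length + 1) := fun w =>
    length_filter_range_lt _ _
  have hp1 : ∀ w, 1 ≤ x.p w := fun w => (x.one_le_q w).trans (x.q_le_p w)
  obtain ⟨h1, h2, h3⟩ := solve_spec (Δ := rootedDegBound) (p := x.pMax) (fun u v r h => by
      obtain ⟨w, -, h⟩ := demand_cases h
      have := w.2
      omega)
    (fun u v r h => by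
      obtain ⟨w, -, h⟩ := demand_cases h
      rcases h with ⟨rfl, -⟩ | ⟨rfl, -⟩
      · exact List.mem_cons_self
      · exact List.mem_cons_of_mem _ (mem_nodeUnits (by rw [length_unitsOf]; omega) (x.one_le_q w)))
    (fun i hi => by
      obtain ⟨w, rfl⟩ := mem_items hi
      have := hp1 w
      rw [← List.length_pos_iff]
      change 0 < ((List.range (x.E.length + 1)).filter fun i => decide (i < x.p w)).length
      rw [hlen]
      omega)
    hopt
    (fun i hi => by
      obtain ⟨w, rfl⟩ := mem_items hi
      exact (hlen w).le.trans ((min_le_left _ _).trans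
        (Finset.le_sup (f := x.p) (Finset.mem_univ w))))
    (.inr ⟨rfl, fun u v r h => by
      obtain ⟨w, -, h⟩ := demand_cases h
      omega⟩)
  set sol := solve (natPairs x.E) x.capUnits x.demands x.n x.items with hsol
  have halg : algorithm x.data = sol.map fun i => i.1 := rfl
  refine ⟨listsFinset_of_lt fun i hi => ?_, ?_, ?_⟩
  · rw [halg] at hi
    obtain ⟨item, hitem, rfl⟩ := List.mem_map.1 hi
    obtain ⟨j, rfl⟩ := mem_items (h1.subset hitem)
    exact j.2
  · refine (forall_le_pqConnectivity_iff fun w => decide (w ∈ algorithm x.data)).2 (h2.mono fun p => ?_)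
    refine countP_starEdges_le_filter h1 (fun i hi => ?_) p
    rw [halg, decide_eq_true_eq]
    exact List.mem_map_of_mem hi
  · have h4 : ∑ u ∈ x.solution, x.c u ≤ totalCost sol := by
      refine sum_le_totalCost (fun i hi w hw => ?_) fun w hw => ?_
      · obtain ⟨j, rfl⟩ := mem_items (h1.subset hi)
        rw [← Fin.ext hw]
        rfl
      · simpa [solution, halg] using hw
    rw [totalCost_items, hWS] at h3
    refine le_trans (by exact_mod_cast h4) (h3.trans ?_)
    exact mul_le_mul_of_nonneg_right (nodeRatio_mono rootedDegBound_mono maxReq_demands_le le_rfl)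
      (Nat.cast_nonneg _)

theorem admitsRatio : problem.AdmitsRatio fun x => nodeRatio rootedDegBound x.k x.pMax :=
  MinProblem.admitsRatio_of_polyTime polyTime_algorithm data toVal_data solution
    fun _ _ hS => solution_spec hS

end SSL

/-! ### Bounds for the ratios -/

theorem nodeRatio_le {Δ : ℕ → ℕ} (hΔ : Monotone Δ) (k p : ℕ) :
    nodeRatio Δ k p ≤ min (k : ℚ) ((p : ℚ) * harmonic k) * harmonic (Δ k) := by
  have h : nodeRatio Δ k p ≤ (∑ j ∈ Finset.range k, discount p j) * harmonic (Δ k) := by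
    rw [nodeRatio_eq_reflect, Finset.sum_mul]
    refine Finset.sum_le_sum fun j _ => ?_
    rw [mul_comm]
    exact mul_le_mul_of_nonneg_left (harmonic_mono (hΔ (Nat.sub_le k j))) (discount_nonneg p j)
  refine h.trans (mul_le_mul_of_nonneg_right (le_min ?_ ?_) (harmonic_nonneg _))
  · have := Finset.sum_le_card_nsmul (Finset.range k) (discount p) 1 fun j _ => min_le_right _ _
    simpa using this
  · rw [harmonic, Finset.mul_sum]
    refine Finset.sum_le_sum fun j _ => (min_le_left _ _).trans (le_of_eq ?_)
    push_cast
    rw [div_eq_mul_inv]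

theorem edgeRatio_le {Δ : ℕ → ℕ} (hΔ : Monotone Δ) (k : ℕ) :
    edgeRatio Δ k ≤ harmonic k * harmonic (Δ k) := by
  rw [edgeRatio_eq]
  refine (nodeRatio_le hΔ k 1).trans (mul_le_mul_of_nonneg_right ?_ (harmonic_nonneg _))
  rw [Nat.cast_one, one_mul]
  exact min_le_right _ _

theorem degBound_mono : Monotone degBound := fun k l h =>
  Nat.pow_le_pow_left (by omega) 2

theorem isBigO_harmonic_mul_harmonic {Δ : ℕ → ℕ} (hΔ : ∀ k, Δ k ≤ (4 * k) ^ 2) :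
    (fun k : ℕ => ((harmonic k * harmonic (Δ k) : ℚ) : ℝ)) =O[atTop]
      fun k : ℕ => Real.log k ^ 2 := by
  refine IsBigO.of_bound (2 * (3 + 2 * Real.log 4)) ?_
  filter_upwards [eventually_ge_atTop 3] with k hk
  have h0 : (3 : ℝ) ≤ k := by exact_mod_cast hk
  have h1 : 1 ≤ Real.log k := by
    rw [Real.le_log_iff_exp_le (by linarith)]
    exact (Real.exp_one_lt_d9.le.trans (by norm_num)).trans h0
  have h4 : 0 ≤ Real.log 4 := Real.log_nonneg (by norm_num)
  have h2 : (harmonic k : ℝ) ≤ 2 * Real.log k := (harmonic_le_one_add_log k).trans (by linarith)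
  have h3 : (harmonic (Δ k) : ℝ) ≤ (3 + 2 * Real.log 4) * Real.log k := by
    have h5 : (harmonic (Δ k) : ℝ) ≤ harmonic ((4 * k) ^ 2) := by exact_mod_cast harmonic_mono (hΔ k)
    refine h5.trans ((harmonic_le_one_add_log _).trans ?_)
    push_cast
    rw [Real.log_pow, Real.log_mul (by norm_num) (by linarith)]
    push_cast
    nlinarith
  have h6 : (0 : ℝ) ≤ harmonic k := by exact_mod_cast harmonic_nonneg k
  have h7 : (0 : ℝ) ≤ harmonic (Δ k) := by exact_mod_cast harmonic_nonneg (Δ k)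
  rw [Rat.cast_mul, Real.norm_of_nonneg (mul_nonneg h6 h7), Real.norm_of_nonneg (sq_nonneg _)]
  calc (harmonic k : ℝ) * harmonic (Δ k)
      ≤ (2 * Real.log k) * ((3 + 2 * Real.log 4) * Real.log k) :=
        mul_le_mul h2 h3 h7 (by linarith)
    _ = _ := by ring

theorem degBound_le (k : ℕ) : degBound k ≤ (4 * k) ^ 2 := Nat.pow_le_pow_left (Nat.sub_le _ _) 2

theorem rootedDegBound_le (k : ℕ) : rootedDegBound k ≤ (4 * k) ^ 2 := by
  unfold rootedDegBound
  rcases Nat.eq_zero_or_pos k with rfl | hk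
  · simp
  · nlinarith [Nat.sub_le (2 * k) 1]

theorem theorem4 :
    -- edge costs
    StarSNA.edgeCost.AdmitsRatio (fun y => edgeRatio degBound y.1.k) ∧
    StarSNA.rootedEdgeCost.AdmitsRatio (fun y => edgeRatio rootedDegBound y.1.1.k) ∧
    (∀ k : ℕ, edgeRatio degBound k ≤ harmonic k * harmonic (degBound k)) ∧
    (∀ k : ℕ, edgeRatio rootedDegBound k ≤ harmonic k * harmonic (rootedDegBound k)) ∧
    ((fun k : ℕ => ((harmonic k * harmonic (degBound k) : ℚ) : ℝ))
      =O[atTop] fun k : ℕ => Real.log k ^ 2) ∧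
    ((fun k : ℕ => ((harmonic k * harmonic (rootedDegBound k) : ℚ) : ℝ))
      =O[atTop] fun k : ℕ => Real.log k ^ 2) ∧
    -- node costs
    StarSNA.nodeCost.AdmitsRatio (fun y => nodeRatio degBound y.1.k y.1.pMax) ∧
    StarSNA.rootedNodeCost.AdmitsRatio
      (fun y => nodeRatio rootedDegBound y.1.1.k y.1.1.pMax) ∧
    SSL.problem.AdmitsRatio (fun x => nodeRatio rootedDegBound x.k x.pMax) ∧
    (∀ k p : ℕ, nodeRatio degBound k p ≤
      min (k : ℚ) ((p : ℚ) * harmonic k) * harmonic (degBound k)) ∧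
    (∀ k p : ℕ, nodeRatio rootedDegBound k p ≤
      min (k : ℚ) ((p : ℚ) * harmonic k) * harmonic (rootedDegBound k)) := by
  exact ⟨StarSNA.admitsRatio_edgeCost, StarSNA.admitsRatio_rootedEdgeCost,
    edgeRatio_le degBound_mono, edgeRatio_le rootedDegBound_mono,
    isBigO_harmonic_mul_harmonic degBound_le, isBigO_harmonic_mul_harmonic rootedDegBound_le,
    StarSNA.admitsRatio_nodeCost, StarSNA.admitsRatio_rootedNodeCost, SSL.admitsRatio,
    nodeRatio_le degBound_mono, nodeRatio_le rootedDegBound_mono⟩
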